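/- Let $m\ge 1$ and $N\ge 0$ be integers. An $m$-dimensional polyhedron in $\mathbb R^N$ is a nonempty bounded intersection of finitely many closed half-spaces whose affine hull has dimension $m$; if it is oriented, $\eta(\sigma)\in\Lambda_m\mathbb R^N$ denotes the simple unit $m$-vector of its orientation. For an abelian group $G$, the group $\mathcal P_m(G)$ of polyhedral $m$-chains is the group of formal sums $\sum g_i\sigma_i$ ($g_i\in G$, $\sigma_i$ oriented $m$-dimensional polyhedra) modulo the relations $g\sigma\equiv g\sigma'+g\sigma''$ whenever $\sigma',\sigma''$ are obtained from $\sigma$ by subdivision along a hyperplane, and $g\sigma\equiv -g\tilde\sigma$ whenever $\tilde\sigma$ is $\sigma$ with the opposite orientation. The class of $g\sigma$ is written $g[\sigma]$. The boundary homomorphism $\partial:\mathcal P_m(G)\to\mathcal P_{m-1}(G)$ sends $g[\sigma]$ to $\sum_\tau g[\tau]$, summed over the $(m-1)$-dimensional faces $\tau$ of $\sigma$ with the induced orientation, i.e. $\eta(\sigma)=\eta(\tau)\wedge\nu$, where $\nu$ is the unit normal to $\tau$ in the plane of $\sigma$ that points out of $\sigma$. A chain is supported in a set $K$ if it can be written $\sum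 g_i[\sigma_i]$ with all $\sigma_i\subseteq K$. Let $V=\sum_{i=1}^k c_i\operatorname{var}(\sigma_i)$, $c_i\ge 0$, be an $m$-dimensional polyhedral varifold in $\mathbb R^N$, where $\operatorname{var}(\sigma)$ is the multiplicity-one rectifiable varifold with weight measure $\mathcal H^m\llcorner\sigma$, and let $$\langle V\rangle=\sum_{i=1}^k c_i\,\eta(\sigma_i)[\sigma_i]\in\mathcal P_m(\Lambda_m\mathbb R^N),$$ which does not depend on the orientations chosen for the $\sigma_i$. Let $\Gamma$ be the union of some of the $(m-1)$-dimensional faces of the polyhedra $\sigma_i$. Then $V$ is stationary in $\mathbb R^N\setminus\Gamma$ (that is, $\int \operatorname{div}_S X(x)\,dV(x,S)=0$ for every $C^1$ vector field $X$ with compact support in $\mathbb R^N\setminus\Gamma$) if and only if $\partial\langle V\rangle$ is supported in $\Gamma$. Moreover, if any two distinct $\sigma_i,\sigma_j$ ($i\neq j$) are disjoint or meet in a common face of dimension $<m$, then each of these two conditions is equivalent to the balancing identity $$\sum_{i:\ \tau\text{ is a face of }\sigma_i} c_i\,\eta(\sigma_i)=0$$ for every $(m-1)$-dimensional face $\tau\not\subseteq\Gamma$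 of the $\sigma_i$, where $\tau$ is given an orientation and each $\sigma_i$ with face $\tau$ is given the orientation that induces the chosen one on $\tau$. -/

import Mathlib

open MeasureTheory Set
open scoped RealInnerProductSpace ENNReal NNReal

namespace PolyVar

/-- Euclidean space `ℝ^N`. -/
abbrev E (N : ℕ) := EuclideanSpace ℝ (Fin N)

/-- An `m`-dimensional polyhedron in `ℝ^N`: a nonempty bounded intersection of finitely many closed
half-spaces whose affine hull has dimension `m`. -/
structure Polyhedron (m N : ℕ) where
  carrier : Set (E N)
  nonempty : carrier.Nonempty
  isBounded : Bornology.IsBounded carrier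
  halfSpaces : ∃ (k : ℕ) (a : Fin k → E N) (b : Fin k → ℝ), carrier = {x | ∀ j, ⟪a j, x⟫ ≤ b j}
  finrank_eq : Module.finrank ℝ (vectorSpan ℝ carrier) = m

/-- `η` is one of the two simple unit `m`-vectors of the linear subspace `S`. (The explicit sign
matters only for `m = 0`.) -/
def Orients {m N : ℕ} (S : Submodule ℝ (E N)) (η : ⋀[ℝ]^m (E N)) : Prop :=
  ∃ v : Fin m → E N, Orthonormal ℝ v ∧ Submodule.span ℝ (range v) = S ∧
    (η = exteriorPower.ιMulti ℝ m v ∨ η = -exteriorPower.ιMulti ℝ m v)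

/-- An oriented polyhedron: a polyhedron `σ` with a simple unit `m`-vector `η(σ)` of its plane. -/
structure OrientedPolyhedron (m N : ℕ) extends Polyhedron m N where
  η : ⋀[ℝ]^m (E N)
  orients : Orients (vectorSpan ℝ carrier) η

variable {m n N : ℕ}

theorem Polyhedron.ext' {σ τ : Polyhedron m N} (h : σ.carrier = τ.carrier) : σ = τ := by
  cases σ; cases τ; simp_all

theorem OrientedPolyhedron.ext' {σ τ : OrientedPolyhedron m N} (h : σ.carrier = τ.carrier)
    (h' : σ.η = τ.η) : σ = τ := by
  obtain ⟨σ, _, _⟩ := σ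
  obtain ⟨τ, _, _⟩ := τ
  obtain rfl : σ = τ := Polyhedron.ext' h
  simp_all

theorem Orients.neg {S : Submodule ℝ (E N)} {η : ⋀[ℝ]^m (E N)} (h : Orients S η) :
    Orients S (-η) := by
  obtain ⟨v, h1, h2, h3⟩ := h
  refine ⟨v, h1, h2, ?_⟩
  rcases h3 with rfl | rfl
  · exact Or.inr rfl
  · exact Or.inl (neg_neg _)

/-- The same polyhedron with the opposite orientation. -/
def OrientedPolyhedron.reverse (σ : OrientedPolyhedron m N) : OrientedPolyhedron m N :=
  { σ with
    η := -σ.η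
    orients := σ.orients.neg }

theorem exists_orients (S : Submodule ℝ (E N)) (h : Module.finrank ℝ S = m) :
    ∃ η : ⋀[ℝ]^m (E N), Orients S η := by
  subst h
  let b := stdOrthonormalBasis ℝ S
  refine ⟨_, fun i => (b i : E N), ?_, ?_, Or.inl rfl⟩
  · exact b.orthonormal.comp_linearIsometry S.subtypeₗᵢ
  · have := congrArg (Submodule.map S.subtype) b.toBasis.span_eq
    rw [Submodule.map_span, ← range_comp, Submodule.map_top, Submodule.range_subtype] at this
    simpa [Function.comp_def] using this

theorem ιMulti_ne_zero {v : Fin m → E N} (hv : Orthonormal ℝ v) :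
    exteriorPower.ιMulti ℝ m v ≠ 0 := by
  have h := exteriorPower.ιMulti_family_linearIndependent_field (n := m) hv.linearIndependent
  have := h.ne_zero (Set.powersetCard.ofFinEmbEquiv (RelEmbedding.refl _))
  simpa [exteriorPower.ιMulti_family, Function.comp_def] using this

/-- Two simple unit `m`-vectors of the same plane agree up to sign. -/
theorem Orients.eq_or_eq_neg {S : Submodule ℝ (E N)} {η ζ : ⋀[ℝ]^m (E N)} (h : Orients S η)
    (h' : Orients S ζ) : η = ζ ∨ η = -ζ := by
  obtain ⟨v, hv, hvS, hη⟩ := h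
  obtain ⟨w, hw, hwS, hζ⟩ := h'
  suffices exteriorPower.ιMulti ℝ m v = exteriorPower.ιMulti ℝ m w ∨
      exteriorPower.ιMulti ℝ m v = -exteriorPower.ιMulti ℝ m w by
    rcases hη with rfl | rfl <;> rcases hζ with rfl | rfl <;> rcases this with h | h <;> simp [h]
  have key : ∀ u : Fin m → E N, Orthonormal ℝ u → Submodule.span ℝ (range u) = S →
      ∃ b : OrthonormalBasis (Fin m) ℝ S, ∀ i, (b i : E N) = u i := by
    intro u hu huS
    have hmem : ∀ i, u i ∈ S := fun i => huS ▸ Submodule.subset_span ⟨i, rfl⟩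
    let u' : Fin m → S := fun i => ⟨u i, hmem i⟩
    have hu' : Orthonormal ℝ u' := by
      rw [orthonormal_iff_ite] at hu ⊢
      exact hu
    have hspan : ⊤ ≤ Submodule.span ℝ (range u') := by
     intro x _
     have hx : (x : E N) ∈ Submodule.span ℝ (range u) := huS ▸ x.2
     have : Submodule.map S.subtype (Submodule.span ℝ (range u')) = Submodule.span ℝ (range u) := by
       rw [Submodule.map_span, ← range_comp]; rfl
     rw [← this] at hx
     obtain ⟨y, hy, hyx⟩ := hx
     rwa [← Subtype.ext hyx]
    exact ⟨OrthonormalBasis.mk hu' hspan, fun i => by rw [OrthonormalBasis.coe_mk]⟩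
  obtain ⟨bv, hbv⟩ := key v hv hvS
  obtain ⟨bw, hbw⟩ := key w hw hwS
  have hdet := bw.det_to_matrix_orthonormalBasis_real bv
  let f : S [⋀^Fin m]→ₗ[ℝ] ⋀[ℝ]^m (E N) :=
    (exteriorPower.ιMulti ℝ m).compLinearMap S.subtype
  have hfv : f bv = exteriorPower.ιMulti ℝ m v := by
    change exteriorPower.ιMulti ℝ m (fun i => (bv i : E N)) = _
    simp_rw [hbv]
  have hfw : f bw = exteriorPower.ιMulti ℝ m w := by
    change exteriorPower.ιMulti ℝ m (fun i => (bw i : E N)) = _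
    simp_rw [hbw]
  have hf : f bv = bw.toBasis.det bv • f bw := by
    rw [← sub_eq_zero, ← Module.forall_dual_apply_eq_zero_iff ℝ]
    intro φ
    have := congrArg (fun g => g bv) ((φ.compAlternatingMap f).eq_smul_basis_det bw.toBasis)
    simp only [LinearMap.compAlternatingMap_apply, AlternatingMap.smul_apply, smul_eq_mul,
      OrthonormalBasis.coe_toBasis] at this
    rw [map_sub, map_smul, this, smul_eq_mul, mul_comm, sub_self]
  rw [hfv, hfw] at hf
  rcases hdet with h | h <;> rw [h] at hf
  · exact Or.inl (by rw [hf, one_smul])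
  · exact Or.inr (Subtype.ext (by rw [hf]; simp))

theorem ιMulti_snoc (u : Fin n → E N) (x : E N) :
    (exteriorPower.ιMulti ℝ (n + 1) (Fin.snoc u x : Fin (n + 1) → E N) :
      ExteriorAlgebra ℝ (E N)) =
      (exteriorPower.ιMulti ℝ n u : ExteriorAlgebra ℝ (E N)) * ExteriorAlgebra.ι ℝ x := by
  simp only [exteriorPower.ιMulti_apply_coe, ExteriorAlgebra.ιMulti_apply]
  rw [List.ofFn_succ']
  simp

theorem Orients.ne_zero {S : Submodule ℝ (E N)} {η : ⋀[ℝ]^m (E N)} (h : Orients S η) : η ≠ 0 := by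
  obtain ⟨v, hv, -, rfl | rfl⟩ := h
  · exact ιMulti_ne_zero hv
  · exact neg_ne_zero.2 (ιMulti_ne_zero hv)

theorem finrank_inf_lt {S : Submodule ℝ (E N)} {ν : E N} (hν : ν ∈ S) (h1 : ‖ν‖ = 1) :
    Module.finrank ℝ (S ⊓ (ℝ ∙ ν)ᗮ : Submodule ℝ (E N)) < Module.finrank ℝ S := by
  refine Submodule.finrank_lt_finrank_of_lt (lt_of_le_of_ne inf_le_left fun h => ?_)
  have : ν ∈ S ⊓ (ℝ ∙ ν)ᗮ := by rw [h]; exact hν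
  have h2 := Submodule.mem_orthogonal_singleton_iff_inner_right.1 this.2
  rw [real_inner_self_eq_norm_sq, h1] at h2
  norm_num at h2

/-- A hyperplane `T` of `S` orthogonal to `ν ∈ S` contains every vector of `S` orthogonal to `ν`. -/
theorem mem_of_inner_eq_zero {S T : Submodule ℝ (E N)} {ν : E N} (hν : ν ∈ S) (h1 : ‖ν‖ = 1)
    (hS : Module.finrank ℝ S = n + 1) (hT : Module.finrank ℝ T = n) (hTS : T ≤ S)
    (hTν : ∀ x ∈ T, ⟪ν, x⟫ = 0) {x : E N} (hx : x ∈ S) (hx0 : ⟪ν, x⟫ = 0) : x ∈ T := by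
  have hle : T ≤ S ⊓ (ℝ ∙ ν)ᗮ := fun y hy =>
    ⟨hTS hy, Submodule.mem_orthogonal_singleton_iff_inner_right.2 (hTν y hy)⟩
  have := finrank_inf_lt hν h1
  rw [Submodule.eq_of_le_of_finrank_le hle (by omega)]
  exact ⟨hx, Submodule.mem_orthogonal_singleton_iff_inner_right.2 hx0⟩

theorem inner_eq_mul_of_forall {S T : Submodule ℝ (E N)} {ν g : E N} (hν : ν ∈ S) (h1 : ‖ν‖ = 1)
    (hS : Module.finrank ℝ S = n + 1) (hT : Module.finrank ℝ T = n) (hTS : T ≤ S)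
    (hTν : ∀ x ∈ T, ⟪ν, x⟫ = 0) (hg : ∀ x ∈ T, ⟪g, x⟫ = 0) {x : E N} (hx : x ∈ S) :
    ⟪g, x⟫ = ⟪g, ν⟫ * ⟪ν, x⟫ := by
  have hmem : x - ⟪ν, x⟫ • ν ∈ T :=
    mem_of_inner_eq_zero hν h1 hS hT hTS hTν (S.sub_mem hx (S.smul_mem _ hν)) (by
      rw [inner_sub_right, inner_smul_right, real_inner_self_eq_norm_sq, h1]; ring)
  have := hg _ hmem
  rw [inner_sub_right, inner_smul_right] at this
  linarith

/-- `ν` is the unit vector in the plane of `σ` that is normal to the face `τ` and points out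
from `σ`: the face `τ` is where `⟪ν, ·⟫` attains its maximum over `σ`. -/
def IsOuterNormal (ν : E N) (τ σ : Set (E N)) : Prop :=
  ν ∈ vectorSpan ℝ σ ∧ ‖ν‖ = 1 ∧ τ = {x ∈ σ | ∀ y ∈ σ, ⟪ν, y⟫ ≤ ⟪ν, x⟫}

theorem IsOuterNormal.subset {ν : E N} {τ σ : Set (E N)} (h : IsOuterNormal ν τ σ) : τ ⊆ σ := by
  rw [h.2.2]; exact fun x hx => hx.1

theorem inner_eq_zero_of_const {g : E N} {s : Set (E N)}
    (h : ∀ x ∈ s, ∀ y ∈ s, ⟪g, x⟫ = ⟪g, y⟫) : ∀ x ∈ vectorSpan ℝ s, ⟪g, x⟫ = 0 := by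
  intro x hx
  have hle : vectorSpan ℝ s ≤ (ℝ ∙ g)ᗮ := by
    rw [vectorSpan_def, Submodule.span_le]
    rintro _ ⟨y, hy, z, hz, rfl⟩
    refine Submodule.mem_orthogonal_singleton_iff_inner_right.2 ?_
    change ⟪g, y - z⟫ = 0
    rw [inner_sub_right, h y hy z hz, sub_self]
  exact Submodule.mem_orthogonal_singleton_iff_inner_right.1 (hle hx)

theorem IsOuterNormal.inner_eq_zero {ν : E N} {τ σ : Set (E N)} (h : IsOuterNormal ν τ σ) :
    ∀ x ∈ vectorSpan ℝ τ, ⟪ν, x⟫ = 0 := by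
  refine inner_eq_zero_of_const fun x hx y hy => ?_
  rw [h.2.2] at hx hy
  exact le_antisymm (hy.2 x hx.1) (hx.2 y hy.1)

theorem sub_mem_vectorSpan {s : Set (E N)} {x y : E N} (hx : x ∈ s) (hy : y ∈ s) :
    x - y ∈ vectorSpan ℝ s := by simpa using vsub_mem_vectorSpan ℝ hx hy

theorem IsOuterNormal.exists_inner_ne {ν : E N} {τ σ : Set (E N)} (h : IsOuterNormal ν τ σ) :
    ∃ x ∈ σ, ∃ y ∈ σ, ⟪ν, x⟫ ≠ ⟪ν, y⟫ := by
  by_contra! hc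
  have := inner_eq_zero_of_const hc ν h.1
  rw [real_inner_self_eq_norm_sq, h.2.1] at this
  norm_num at this

theorem eq_of_smul_eq {S : Submodule ℝ (E N)} {μ ν : E N} (hμ : μ ∈ S) (hν : ν ∈ S)
    (h1 : ‖μ‖ = 1) (h2 : ‖ν‖ = 1) {c d : ℝ} (hc : 0 < c) (hd : 0 < d)
    (h : ∀ x ∈ S, c * ⟪μ, x⟫ = d * ⟪ν, x⟫) : μ = ν := by
  have hz : c • μ - d • ν = 0 := by
    have hm : c • μ - d • ν ∈ S := S.sub_mem (S.smul_mem _ hμ) (S.smul_mem _ hν)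
    have := h _ hm
    rw [← inner_self_eq_zero (𝕜 := ℝ)]
    conv_lhs => rw [inner_sub_left, inner_smul_left, inner_smul_left]
    simp only [conj_trivial]
    linarith
  rw [sub_eq_zero] at hz
  have hn := congrArg norm hz
  rw [norm_smul, norm_smul, h1, h2, Real.norm_of_nonneg hc.le, Real.norm_of_nonneg hd.le] at hn
  obtain rfl : c = d := by linarith
  exact smul_right_injective _ hc.ne' hz

theorem IsOuterNormal.unique {τ : Polyhedron n N} {σ : Polyhedron (n + 1) N} {μ ν : E N}
    (hμ : IsOuterNormal μ τ.carrier σ.carrier) (hν : IsOuterNormal ν τ.carrier σ.carrier) :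
    μ = ν := by
  have key : ∀ x ∈ vectorSpan ℝ σ.carrier, ⟪μ, x⟫ = ⟪μ, ν⟫ * ⟪ν, x⟫ := fun x hx =>
    inner_eq_mul_of_forall hν.1 hν.2.1 σ.finrank_eq τ.finrank_eq (vectorSpan_mono ℝ hν.subset)
      hν.inner_eq_zero hμ.inner_eq_zero hx
  obtain ⟨t, ht⟩ := τ.nonempty
  have hpos : 0 < ⟪μ, ν⟫ := by
    by_contra! hle
    obtain ⟨x, hx, y, hy, hne⟩ := hμ.exists_inner_ne
    have hz : ∀ z ∈ σ.carrier, ⟪μ, z⟫ = ⟪μ, t⟫ := by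
      intro z hz
      have h1 := key (z - t) (sub_mem_vectorSpan hz (hμ.subset ht))
      rw [inner_sub_right, inner_sub_right] at h1
      have h2 := hμ.2.2 ▸ ht
      have h3 := hν.2.2 ▸ ht
      have h4 := h2.2 z hz
      have h5 := h3.2 z hz
      nlinarith [mul_nonneg_of_nonpos_of_nonpos hle (sub_nonpos.2 h5)]
    exact hne ((hz x hx).trans (hz y hy).symm)
  exact eq_of_smul_eq hμ.1 hν.1 hμ.2.1 hν.2.1 one_pos hpos fun x hx => by rw [one_mul, key x hx]

/-- `τ` is an `(m-1)`-dimensional face of the `m`-dimensional polyhedron `σ`. -/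
def IsFacet (τ : Polyhedron n N) (σ : Polyhedron (n + 1) N) : Prop :=
  IsExposed ℝ σ.carrier τ.carrier

/-- `τ` is an `(m-1)`-dimensional face of `σ` with the orientation induced by `σ`, that is
`η(σ) = η(τ) ∧ ν` for the outer unit normal `ν`. -/
def IsOrientedFacet (τ : OrientedPolyhedron n N) (σ : OrientedPolyhedron (n + 1) N) : Prop :=
  ∃ ν, IsOuterNormal ν τ.carrier σ.carrier ∧
    (σ.η : ExteriorAlgebra ℝ (E N)) = (τ.η : ExteriorAlgebra ℝ (E N)) * ExteriorAlgebra.ι ℝ ν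

theorem IsOrientedFacet.ext {τ τ' : OrientedPolyhedron n N} {σ : OrientedPolyhedron (n + 1) N}
    (h : IsOrientedFacet τ σ) (h' : IsOrientedFacet τ' σ) (hc : τ.carrier = τ'.carrier) :
    τ = τ' := by
  refine OrientedPolyhedron.ext' hc ?_
  obtain ⟨ν, hν, hη⟩ := h
  obtain ⟨ν', hν', hη'⟩ := h'
  have ho := τ'.orients
  rw [← hc] at ho hν'
  obtain rfl := IsOuterNormal.unique (τ := τ.toPolyhedron) (σ := σ.toPolyhedron) hν hν'
  rcases τ.orients.eq_or_eq_neg ho with h | h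
  · exact h
  · exfalso
    refine σ.orients.ne_zero (Subtype.ext ?_)
    have h2 : (σ.η : ExteriorAlgebra ℝ (E N)) = -σ.η := by
      conv_lhs => rw [hη, h]
      rw [hη']; simp
    rw [Submodule.coe_zero]
    have h3 : (2 : ℝ) • (σ.η : ExteriorAlgebra ℝ (E N)) = 0 := by
      rw [two_smul]; nth_rewrite 1 [h2]; simp
    exact (smul_eq_zero.1 h3).resolve_left (by norm_num)

/-- Every `(m-1)`-dimensional face lies on one of the half-space boundaries defining `σ`. -/
theorem exists_halfSpace {τ : Polyhedron n N} {σ : Polyhedron (n + 1) N} {ν : E N}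
    (hν : IsOuterNormal ν τ.carrier σ.carrier) {k : ℕ} {a : Fin k → E N} {b : Fin k → ℝ}
    (hσ : σ.carrier = {x | ∀ j, ⟪a j, x⟫ ≤ b j}) :
    ∃ j, ∃ c : ℝ, 0 < c ∧ ∀ x ∈ vectorSpan ℝ σ.carrier, ⟪a j, x⟫ = c * ⟪ν, x⟫ := by
  obtain ⟨t, ht⟩ := τ.nonempty
  suffices ∃ j, (∀ y ∈ τ.carrier, ⟪a j, y⟫ = b j) ∧ ∃ x ∈ σ.carrier, ⟪a j, x⟫ < b j by
    obtain ⟨j, hj, x, hx, hxb⟩ := this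
    have key : ∀ x ∈ vectorSpan ℝ σ.carrier, ⟪a j, x⟫ = ⟪a j, ν⟫ * ⟪ν, x⟫ := fun x hx =>
      inner_eq_mul_of_forall hν.1 hν.2.1 σ.finrank_eq τ.finrank_eq (vectorSpan_mono ℝ hν.subset)
        hν.inner_eq_zero
        (inner_eq_zero_of_const fun y hy z hz => (hj y hy).trans (hj z hz).symm) hx
    refine ⟨j, _, ?_, key⟩
    have h1 := key (x - t) (sub_mem_vectorSpan hx (hν.subset ht))
    rw [inner_sub_right, inner_sub_right, hj t ht] at h1
    have h2 := (hν.2.2 ▸ ht).2 x hx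
    by_contra! hle
    nlinarith [mul_nonneg_of_nonpos_of_nonpos hle (sub_nonpos.2 h2)]
  by_contra! hc
  have hτσ : ∀ y ∈ τ.carrier, ∀ j, ⟪a j, y⟫ ≤ b j := fun y hy => by
    have := hν.subset hy
    rw [hσ] at this
    exact this
  have hconv : Convex ℝ τ.carrier := by
    obtain ⟨k', a', b', h'⟩ := τ.halfSpaces
    rw [h', ofPred_forall]
    exact convex_iInter fun j => convex_halfSpace_le (innerₛₗ ℝ (a' j)).isLinear _
  -- a point of the face where all inactive constraints are strict
  have hex : ∀ s : Finset (Fin k), ∃ y ∈ τ.carrier, ∀ j ∈ s,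
      (∃ x ∈ σ.carrier, ⟪a j, x⟫ < b j) → ⟪a j, y⟫ < b j := by
    classical
    intro s
    induction s using Finset.induction_on with
    | empty => exact ⟨t, ht, by simp⟩
    | insert j s hjs ih =>
      obtain ⟨y, hy, hys⟩ := ih
      by_cases hj : ∃ z ∈ τ.carrier, ⟪a j, z⟫ < b j
      · obtain ⟨z, hz, hzb⟩ := hj
        refine ⟨(1 / 2 : ℝ) • y + (1 / 2 : ℝ) • z,
          hconv hy hz (by norm_num) (by norm_num) (by norm_num), ?_⟩
        intro i hi hi'
        rw [inner_add_right, inner_smul_right, inner_smul_right]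
        rcases Finset.mem_insert.1 hi with rfl | hi
        · linarith [hτσ y hy i]
        · linarith [hys i hi hi', hτσ z hz i]
      · push Not at hj
        refine ⟨y, hy, fun i hi hi' => ?_⟩
        rcases Finset.mem_insert.1 hi with rfl | hi
        · obtain ⟨x, hx, hxb⟩ := hi'
          have := hc i (fun y hy => le_antisymm (hτσ y hy i) (hj y hy)) x hx
          linarith
        · exact hys i hi hi'
  obtain ⟨y, hy, hys⟩ := hex Finset.univ
  -- moving in the direction of the outer normal stays inside
  have hev : ∀ j, ∀ᶠ ε : ℝ in nhdsWithin 0 (Ioi 0), ⟪a j, y + ε • ν⟫ ≤ b j := by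
    intro j
    by_cases hj : ∃ x ∈ σ.carrier, ⟪a j, x⟫ < b j
    · have h1 := hys j (Finset.mem_univ _) hj
      have hcont : Continuous fun ε : ℝ => ⟪a j, y + ε • ν⟫ := by fun_prop
      have := hcont.tendsto 0
      simp only [zero_smul, add_zero] at this
      exact ((this.eventually (gt_mem_nhds h1)).filter_mono nhdsWithin_le_nhds).mono
        fun _ h => h.le
    · push Not at hj
      have hx : ∀ x ∈ σ.carrier, ⟪a j, x⟫ = b j := fun x hx =>
        le_antisymm ((hσ ▸ hx : x ∈ {x | ∀ j, ⟪a j, x⟫ ≤ b j}) j) (hj x hx)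
      have h0 := inner_eq_zero_of_const (fun x hx' y hy' => (hx x hx').trans (hx y hy').symm)
        ν hν.1
      refine Filter.Eventually.of_forall fun ε => ?_
      rw [inner_add_right, inner_smul_right, h0, hx y (hν.subset hy)]
      simp
  have hall := (Filter.eventually_all.2 hev).and self_mem_nhdsWithin
  obtain ⟨ε, hε, hε0⟩ := hall.exists
  have hmem : y + ε • ν ∈ σ.carrier := by rw [hσ]; exact hε
  have := (hν.2.2 ▸ hy).2 _ hmem
  rw [inner_add_right, inner_smul_right, real_inner_self_eq_norm_sq, hν.2.1] at this
  have : 0 < ε := hε0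
  linarith

theorem finite_facets (σ : OrientedPolyhedron (n + 1) N) :
    {τ : OrientedPolyhedron n N | IsOrientedFacet τ σ}.Finite := by
  obtain ⟨k, a, b, hσ⟩ := σ.halfSpaces
  have h : ∀ τ : {τ : OrientedPolyhedron n N | IsOrientedFacet τ σ}, ∃ ν,
      IsOuterNormal ν τ.1.carrier σ.carrier ∧ ∃ j, ∃ c : ℝ, 0 < c ∧
        ∀ x ∈ vectorSpan ℝ σ.carrier, ⟪a j, x⟫ = c * ⟪ν, x⟫ := by
    rintro ⟨τ, ν, hν, -⟩
    exact ⟨ν, hν, exists_halfSpace (τ := τ.toPolyhedron) (σ := σ.toPolyhedron) hν hσ⟩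
  choose ν hν j c hc hj using h
  have hinj : Function.Injective j := by
    intro τ τ' hjj
    have hνν : ν τ = ν τ' := eq_of_smul_eq (hν τ).1 (hν τ').1 (hν τ).2.1 (hν τ').2.1
      (hc τ) (hc τ') fun x hx => by rw [← hj τ x hx, ← hj τ' x hx, hjj]
    refine Subtype.ext (τ.2.ext τ'.2 ?_)
    rw [(hν τ).2.2, (hν τ').2.2, hνν]
  exact @Set.toFinite _ _ (Finite.of_injective j hinj)

theorem Polyhedron.convex (σ : Polyhedron m N) : Convex ℝ σ.carrier := by
  obtain ⟨k, a, b, h⟩ := σ.halfSpaces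
  rw [h, ofPred_forall]
  exact convex_iInter fun j => convex_halfSpace_le (innerₛₗ ℝ (a j)).isLinear _

theorem halfSpaces_inter {s : Set (E N)}
    (h : ∃ (k : ℕ) (a : Fin k → E N) (b : Fin k → ℝ), s = {x | ∀ j, ⟪a j, x⟫ ≤ b j})
    (f : E N) (r : ℝ) : ∃ (k : ℕ) (a : Fin k → E N) (b : Fin k → ℝ),
      {x ∈ s | ⟪f, x⟫ ≤ r} = {x | ∀ j, ⟪a j, x⟫ ≤ b j} := by
  obtain ⟨k, a, b, rfl⟩ := h
  refine ⟨k + 1, Fin.cons f a, Fin.cons r b, ?_⟩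
  ext x
  simp [Fin.forall_fin_succ, and_comm]

theorem vectorSpan_cut {s : Set (E N)} (hs : Convex ℝ s) {f p : E N} {a : ℝ} (hp : p ∈ s)
    (hpa : ⟪f, p⟫ < a) : vectorSpan ℝ {x ∈ s | ⟪f, x⟫ ≤ a} = vectorSpan ℝ s := by
  refine le_antisymm (vectorSpan_mono ℝ fun x hx => hx.1) ?_
  rw [vectorSpan_eq_span_vsub_set_right ℝ hp, Submodule.span_le]
  rintro _ ⟨y, hy, rfl⟩
  change y - p ∈ vectorSpan ℝ {x ∈ s | ⟪f, x⟫ ≤ a}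
  have hcont : Continuous fun t : ℝ => ⟪f, p + t • (y - p)⟫ := by fun_prop
  have h0 := hcont.tendsto 0
  simp only [zero_smul, add_zero] at h0
  have hev := ((h0.eventually (gt_mem_nhds hpa)).filter_mono nhdsWithin_le_nhds).and
    (Ioc_mem_nhdsGT (zero_lt_one (α := ℝ)))
  obtain ⟨t, ht, ht0, ht1⟩ := hev.exists
  have hmem : p + t • (y - p) ∈ s := hs.add_smul_sub_mem hp hy ⟨ht0.le, ht1⟩
  have := sub_mem_vectorSpan (s := {x ∈ s | ⟪f, x⟫ ≤ a}) ⟨hmem, ht.le⟩ ⟨hp, hpa.le⟩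
  rw [add_sub_cancel_left] at this
  exact (Submodule.smul_mem_iff _ ht0.ne').1 this

/-- The part of `τ` in the half-space `⟪f, ·⟫ ≤ a` (and `τ` itself if `τ` does not meet the open
half-space). -/
noncomputable def lowerPart (f : E N) (a : ℝ) (τ : OrientedPolyhedron m N) :
    OrientedPolyhedron m N :=
  open scoped Classical in
  if h : ∃ x ∈ τ.carrier, ⟪f, x⟫ < a then
    { carrier := {x ∈ τ.carrier | ⟪f, x⟫ ≤ a}
      nonempty := by obtain ⟨x, hx, hxa⟩ := h; exact ⟨x, hx, hxa.le⟩
      isBounded := τ.isBounded.subset fun x hx => hx.1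
      halfSpaces := halfSpaces_inter τ.halfSpaces f a
      finrank_eq := by
        obtain ⟨x, hx, hxa⟩ := h
        rw [vectorSpan_cut τ.convex hx hxa, τ.finrank_eq]
      η := τ.η
      orients := by
        obtain ⟨x, hx, hxa⟩ := h
        rw [vectorSpan_cut τ.convex hx hxa]
        exact τ.orients }
  else τ

theorem lowerPart_carrier {f : E N} {a : ℝ} {τ : OrientedPolyhedron m N}
    (h : ∃ x ∈ τ.carrier, ⟪f, x⟫ < a) :
    (lowerPart f a τ).carrier = {x ∈ τ.carrier | ⟪f, x⟫ ≤ a} := by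
  rw [lowerPart, dif_pos h]

theorem lowerPart_η (f : E N) (a : ℝ) (τ : OrientedPolyhedron m N) :
    (lowerPart f a τ).η = τ.η := by
  rw [lowerPart]; split_ifs <;> rfl

/-- A hyperplane crossing a polyhedron cuts out a polyhedron of one dimension less. -/
theorem finrank_slice {s : Set (E N)} (hs : Convex ℝ s)
    (hn : Module.finrank ℝ (vectorSpan ℝ s) = n + 1) {f p q : E N} {a : ℝ} (hp : p ∈ s)
    (hpa : ⟪f, p⟫ < a) (hq : q ∈ s) (hqa : a < ⟪f, q⟫) :
    {x ∈ s | ⟪f, x⟫ = a}.Nonempty ∧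
      Module.finrank ℝ (vectorSpan ℝ {x ∈ s | ⟪f, x⟫ = a}) = n := by
  set w := {x ∈ s | ⟪f, x⟫ = a} with hw
  have cross : ∀ x ∈ s, ∀ y ∈ s, ⟪f, x⟫ < a → a ≤ ⟪f, y⟫ →
      ∃ t : ℝ, 0 < t ∧ x + t • (y - x) ∈ w := by
    intro x hx y hy hxa hya
    have hd : 0 < ⟪f, y⟫ - ⟪f, x⟫ := by linarith
    refine ⟨(a - ⟪f, x⟫) / (⟪f, y⟫ - ⟪f, x⟫), div_pos (by linarith) hd,
      hs.add_smul_sub_mem hx hy ⟨(div_pos (by linarith) hd).le, ?_⟩, ?_⟩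
    · rw [div_le_one hd]; linarith
    · rw [inner_add_right, inner_smul_right, inner_sub_right, div_mul_cancel₀ _ hd.ne']; ring
  have cross' : ∀ x ∈ s, ∀ y ∈ s, a < ⟪f, x⟫ → ⟪f, y⟫ < a →
      ∃ t : ℝ, 0 < t ∧ x + t • (y - x) ∈ w := by
    intro x hx y hy hxa hya
    have hd : 0 < ⟪f, x⟫ - ⟪f, y⟫ := by linarith
    refine ⟨(⟪f, x⟫ - a) / (⟪f, x⟫ - ⟪f, y⟫), div_pos (by linarith) hd,
      hs.add_smul_sub_mem hx hy ⟨(div_pos (by linarith) hd).le, ?_⟩, ?_⟩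
    · rw [div_le_one hd]; linarith
    · rw [inner_add_right, inner_smul_right, inner_sub_right, div_mul_eq_mul_div]
      field_simp
      ring
  obtain ⟨t₀, -, hz₀⟩ := cross p hp q hq hpa hqa.le
  set z₀ := p + t₀ • (q - p)
  refine ⟨⟨z₀, hz₀⟩, ?_⟩
  -- the slice together with the direction `p - z₀` spans everything
  have hup : ∀ y ∈ s, a ≤ ⟪f, y⟫ → y - z₀ ∈ vectorSpan ℝ w ⊔ (ℝ ∙ (p - z₀)) := by
    intro y hy hya
    obtain ⟨t, ht, hz⟩ := cross p hp y hy hpa hya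
    have h1 : (p + t • (y - p)) - z₀ ∈ vectorSpan ℝ w ⊔ (ℝ ∙ (p - z₀)) :=
      Submodule.mem_sup_left (sub_mem_vectorSpan hz hz₀)
    have h2 : p - z₀ ∈ vectorSpan ℝ w ⊔ (ℝ ∙ (p - z₀)) :=
      Submodule.mem_sup_right (Submodule.mem_span_singleton_self _)
    have h3 := Submodule.sub_mem _ h1 h2
    rw [show p + t • (y - p) - z₀ - (p - z₀) = t • (y - p) by abel] at h3
    have h4 := Submodule.add_mem _ ((Submodule.smul_mem_iff _ ht.ne').1 h3) h2
    rwa [sub_add_sub_cancel] at h4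
  have hdown : ∀ y ∈ s, ⟪f, y⟫ < a → y - z₀ ∈ vectorSpan ℝ w ⊔ (ℝ ∙ (p - z₀)) := by
    intro y hy hya
    obtain ⟨t, ht, hz⟩ := cross' q hq y hy hqa hya
    have h1 : (q + t • (y - q)) - z₀ ∈ vectorSpan ℝ w ⊔ (ℝ ∙ (p - z₀)) :=
      Submodule.mem_sup_left (sub_mem_vectorSpan hz hz₀)
    have h2 := hup q hq hqa.le
    have h3 := Submodule.sub_mem _ h1 h2
    rw [show q + t • (y - q) - z₀ - (q - z₀) = t • (y - q) by abel] at h3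
    have h4 := Submodule.add_mem _ ((Submodule.smul_mem_iff _ ht.ne').1 h3) h2
    rwa [sub_add_sub_cancel] at h4
  have hle : vectorSpan ℝ s ≤ vectorSpan ℝ w ⊔ (ℝ ∙ (p - z₀)) := by
    rw [vectorSpan_eq_span_vsub_set_right ℝ hz₀.1, Submodule.span_le]
    rintro _ ⟨y, hy, rfl⟩
    rcases lt_or_ge ⟪f, y⟫ a with h | h
    · exact hdown y hy h
    · exact hup y hy h
  have h1 := Submodule.finrank_mono hle
  have h2 := Submodule.finrank_add_le_finrank_add_finrank (vectorSpan ℝ w) (ℝ ∙ (p - z₀))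
  have h3 : Module.finrank ℝ (ℝ ∙ (p - z₀)) ≤ 1 :=
    (finrank_span_le_card ({p - z₀} : Set (E N))).trans (by simp)
  have hlt : vectorSpan ℝ w < vectorSpan ℝ s := by
    refine lt_of_le_of_ne (vectorSpan_mono ℝ fun x hx => hx.1) fun h => ?_
    have hmem : p - z₀ ∈ vectorSpan ℝ w := h ▸ sub_mem_vectorSpan hp hz₀.1
    have := inner_eq_zero_of_const (g := f) (s := w) (fun x hx y hy => hx.2.trans hy.2.symm) _ hmem
    rw [inner_sub_right, hz₀.2] at this
    linarith
  have h4 := Submodule.finrank_lt_finrank_of_lt hlt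
  omega

/-- Existence of the induced orientation. -/
theorem exists_induced {S T : Submodule ℝ (E N)} {ν : E N} {η : ⋀[ℝ]^(n + 1) (E N)}
    (hη : Orients S η) (hν : ν ∈ S) (h1 : ‖ν‖ = 1) (hS : Module.finrank ℝ S = n + 1)
    (hT : Module.finrank ℝ T = n) (hTS : T ≤ S) (hTν : ∀ x ∈ T, ⟪ν, x⟫ = 0) :
    ∃ ζ : ⋀[ℝ]^n (E N), Orients T ζ ∧
      (η : ExteriorAlgebra ℝ (E N)) = (ζ : ExteriorAlgebra ℝ (E N)) * ExteriorAlgebra.ι ℝ ν := by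
  obtain ⟨ζ, hζ⟩ := exists_orients T hT
  obtain ⟨u, hu, huT, -⟩ := id hζ
  have hmem : ∀ i, u i ∈ T := fun i => huT ▸ Submodule.subset_span ⟨i, rfl⟩
  have ho : Orthonormal ℝ (Fin.snoc u ν : Fin (n + 1) → E N) := by
    rw [orthonormal_iff_ite] at hu ⊢
    intro i j
    refine Fin.lastCases ?_ (fun i => ?_) i <;> refine Fin.lastCases ?_ (fun j => ?_) j
    · simp [h1]
    · simp [hTν _ (hmem j), (Fin.castSucc_lt_last j).ne']
    · rw [real_inner_comm]
      simp [hTν _ (hmem i), (Fin.castSucc_lt_last i).ne]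
    · simpa using hu i j
  have hspan : Submodule.span ℝ (range (Fin.snoc u ν : Fin (n + 1) → E N)) = S := by
    refine Submodule.eq_of_le_of_finrank_eq ?_ ?_
    · rw [Submodule.span_le]
      rintro _ ⟨i, rfl⟩
      refine Fin.lastCases ?_ (fun i => ?_) i
      · simpa using hν
      · simpa using hTS (hmem i)
    · rw [finrank_span_eq_card ho.linearIndependent, hS, Fintype.card_fin]
  have hor : Orients S (exteriorPower.ιMulti ℝ (n + 1) (Fin.snoc u ν : Fin (n + 1) → E N)) :=
    ⟨_, ho, hspan, Or.inl rfl⟩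
  rcases hη.eq_or_eq_neg hor with h | h
  · exact ⟨_, ⟨u, hu, huT, Or.inl rfl⟩, by rw [h, ιMulti_snoc]⟩
  · exact ⟨_, ⟨u, hu, huT, Or.inr rfl⟩, by
      rw [h, Submodule.coe_neg, ιMulti_snoc, Submodule.coe_neg, neg_mul]⟩

/-- The oriented facets of an oriented polyhedron. -/
noncomputable def facets (σ : OrientedPolyhedron (n + 1) N) : Finset (OrientedPolyhedron n N) :=
  (finite_facets σ).toFinset

theorem mem_facets {σ : OrientedPolyhedron (n + 1) N} {τ : OrientedPolyhedron n N} :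
    τ ∈ facets σ ↔ IsOrientedFacet τ σ := by simp [facets]

/-- `w` is the slice `⟪f, ·⟫ = a` of `σ`, oriented by the direction in which `⟪f, ·⟫` increases. -/
def IsSlice (σ : OrientedPolyhedron (n + 1) N) (f : E N) (a : ℝ) (w : OrientedPolyhedron n N) :
    Prop :=
  w.carrier = {x ∈ σ.carrier | ⟪f, x⟫ = a} ∧
    ∃ ν ∈ vectorSpan ℝ σ.carrier, ‖ν‖ = 1 ∧
      (∃ c : ℝ, 0 < c ∧ ∀ x ∈ vectorSpan ℝ σ.carrier, ⟪f, x⟫ = c * ⟪ν, x⟫) ∧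
      (σ.η : ExteriorAlgebra ℝ (E N)) = (w.η : ExteriorAlgebra ℝ (E N)) * ExteriorAlgebra.ι ℝ ν

theorem exists_slice (σ : OrientedPolyhedron (n + 1) N) {f : E N} {a : ℝ}
    (h1 : ∃ x ∈ σ.carrier, ⟪f, x⟫ < a) (h2 : ∃ x ∈ σ.carrier, a < ⟪f, x⟫) :
    ∃ w, IsSlice σ f a w := by
  obtain ⟨p, hp, hpa⟩ := h1
  obtain ⟨q, hq, hqa⟩ := h2
  obtain ⟨hne, hfr⟩ := finrank_slice σ.convex σ.finrank_eq hp hpa hq hqa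
  set S := vectorSpan ℝ σ.carrier with hS
  let g : E N := S.starProjection f
  have hgS : g ∈ S := Submodule.starProjection_apply_mem _ _
  have hfg : ∀ x ∈ S, ⟪f, x⟫ = ⟪g, x⟫ := fun x hx =>
    sub_eq_zero.1 (by
      rw [← inner_sub_left]
      exact Submodule.starProjection_inner_eq_zero f x hx)
  have hg0 : g ≠ 0 := by
    intro h0
    have := hfg (q - p) (sub_mem_vectorSpan hq hp)
    rw [h0, inner_zero_left, inner_sub_right] at this
    linarith
  have hgn : 0 < ‖g‖ := norm_pos_iff.2 hg0
  have hνS : ‖g‖⁻¹ • g ∈ S := S.smul_mem _ hgS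
  have hν1 : ‖‖g‖⁻¹ • g‖ = 1 := by
    rw [norm_smul, norm_inv, norm_norm, inv_mul_cancel₀ hgn.ne']
  have hνf : ∀ x ∈ S, ⟪f, x⟫ = ‖g‖ * ⟪‖g‖⁻¹ • g, x⟫ := fun x hx => by
    rw [hfg x hx, inner_smul_left]
    simp only [conj_trivial]
    rw [mul_inv_cancel_left₀ hgn.ne']
  have hTS : vectorSpan ℝ {x ∈ σ.carrier | ⟪f, x⟫ = a} ≤ S := vectorSpan_mono ℝ fun x hx => hx.1
  have hTν : ∀ x ∈ vectorSpan ℝ {x ∈ σ.carrier | ⟪f, x⟫ = a}, ⟪‖g‖⁻¹ • g, x⟫ = 0 := by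
    intro x hx
    have := inner_eq_zero_of_const (g := f) (fun x hx y hy => hx.2.trans hy.2.symm) x hx
    rw [hνf x (hTS hx)] at this
    exact (mul_eq_zero.1 this).resolve_left hgn.ne'
  obtain ⟨ζ, hζ, hηζ⟩ := exists_induced σ.orients hνS hν1 σ.finrank_eq hfr hTS hTν
  have hhs := halfSpaces_inter (halfSpaces_inter σ.halfSpaces f a) (-f) (-a)
  refine ⟨⟨⟨{x ∈ σ.carrier | ⟪f, x⟫ = a}, hne, σ.isBounded.subset fun x hx => hx.1, ?_, hfr⟩,
    ζ, hζ⟩, rfl, _, hνS, hν1, ⟨_, hgn, hνf⟩, hηζ⟩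
  obtain ⟨k, a', b', h'⟩ := hhs
  refine ⟨k, a', b', h' ▸ ?_⟩
  ext x
  simp only [mem_ofPred_eq, inner_neg_left, neg_le_neg_iff, and_assoc]
  exact and_congr_right fun _ => ⟨fun h => ⟨h.le, h.ge⟩, fun h => le_antisymm h.1 h.2⟩

theorem IsSlice.reverse {σ : OrientedPolyhedron (n + 1) N} {f : E N} {a : ℝ}
    {w : OrientedPolyhedron n N} (h : IsSlice σ f a w) : IsSlice σ (-f) (-a) w.reverse := by
  obtain ⟨h1, ν, h2, h3, ⟨c, hc, h4⟩, h5⟩ := h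
  refine ⟨?_, -ν, Submodule.neg_mem _ h2, by rwa [norm_neg], ⟨c, hc, fun x hx => ?_⟩, ?_⟩
  · change w.carrier = _
    rw [h1]; ext x; simp
  · rw [inner_neg_left, inner_neg_left, h4 x hx]; ring
  · change _ = ((-w.η : ⋀[ℝ]^n (E N)) : ExteriorAlgebra ℝ (E N)) * _
    rw [h5]; simp

/-- The facets of the part of `σ` in a half-space: the parts of the facets of `σ`, and the slice. -/
theorem sum_facets_cut {Q : Type*} [AddCommGroup Q] (q : OrientedPolyhedron n N → Q)
    {σ σ' : OrientedPolyhedron (n + 1) N} {f : E N} {a : ℝ}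
    (h1 : ∃ x ∈ σ.carrier, ⟪f, x⟫ < a)
    (hc : σ'.carrier = {x ∈ σ.carrier | ⟪f, x⟫ ≤ a}) (hη : σ'.η = σ.η)
    {w : OrientedPolyhedron n N} (hw : IsSlice σ f a w) :
    ∑ τ ∈ facets σ', q τ =
      (∑ τ ∈ facets σ, open scoped Classical in
        if ∃ x ∈ τ.carrier, ⟪f, x⟫ < a then q (lowerPart f a τ) else 0) + q w := by
  classical
  have hD : vectorSpan ℝ σ'.carrier = vectorSpan ℝ σ.carrier := by
    obtain ⟨p, hp, hpa⟩ := h1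
    rw [hc, vectorSpan_cut σ.convex hp hpa]
  have hDl : ∀ {τ : OrientedPolyhedron n N}, (∃ x ∈ τ.carrier, ⟪f, x⟫ < a) →
      vectorSpan ℝ (lowerPart f a τ).carrier = vectorSpan ℝ τ.carrier := by
    rintro τ h
    obtain ⟨p, hp, hpa⟩ := id h
    rw [lowerPart_carrier h, vectorSpan_cut τ.convex hp hpa]
  rw [← Finset.sum_filter_add_sum_filter_not (facets σ') (fun τ => ∃ x ∈ τ.carrier, ⟪f, x⟫ < a),
    ← Finset.sum_filter]
  congr 1
  · symm
    refine Finset.sum_bij (fun τ _ => lowerPart f a τ) ?_ ?_ ?_ (fun _ _ => rfl)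
    · intro τ hτ
      rw [Finset.mem_filter, mem_facets] at hτ ⊢
      obtain ⟨⟨ν, hν, hνη⟩, hlt⟩ := hτ
      obtain ⟨p, hp, hpa⟩ := id hlt
      have hcar := lowerPart_carrier hlt
      refine ⟨⟨ν, ⟨hD ▸ hν.1, hν.2.1, ?_⟩, ?_⟩, p, ?_, hpa⟩
      · rw [hcar, hc]
        ext x
        constructor
        · rintro ⟨hx, hxa⟩
          rw [hν.2.2] at hx
          exact ⟨⟨hx.1, hxa⟩, fun y hy => hx.2 y hy.1⟩
        · rintro ⟨⟨hx, hxa⟩, hmax⟩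
          refine ⟨?_, hxa⟩
          rw [hν.2.2]
          exact ⟨hx, fun y hy => ((hν.2.2 ▸ hp).2 y hy).trans (hmax p ⟨hν.subset hp, hpa.le⟩)⟩
      · rw [hη, hνη, lowerPart_η]
      · rw [hcar]; exact ⟨hp, hpa.le⟩
    · intro τ₁ hτ₁ τ₂ hτ₂ heq
      rw [Finset.mem_filter, mem_facets] at hτ₁ hτ₂
      obtain ⟨hf₁, hlt₁⟩ := hτ₁
      obtain ⟨hf₂, hlt₂⟩ := hτ₂
      have hv : vectorSpan ℝ τ₁.carrier = vectorSpan ℝ τ₂.carrier := by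
        rw [← hDl hlt₁, ← hDl hlt₂, heq]
      obtain ⟨p, hp, hpa⟩ := id hlt₁
      have hp₂ : p ∈ τ₂.carrier := by
        have : p ∈ (lowerPart f a τ₁).carrier := by
          rw [lowerPart_carrier hlt₁]; exact ⟨hp, hpa.le⟩
        rw [heq, lowerPart_carrier hlt₂] at this
        exact this.1
      have sub : ∀ {τ τ' : OrientedPolyhedron n N}, IsOrientedFacet τ σ → IsOrientedFacet τ' σ →
          vectorSpan ℝ τ.carrier = vectorSpan ℝ τ'.carrier → p ∈ τ.carrier → p ∈ τ'.carrier →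
          τ.carrier ⊆ τ'.carrier := by
        rintro τ τ' ⟨ν, hν, -⟩ ⟨ν', hν', -⟩ hvv hpτ hpτ' y hy
        have h0 := hν'.inner_eq_zero (y - p) (hvv ▸ sub_mem_vectorSpan hy hpτ)
        rw [inner_sub_right, sub_eq_zero] at h0
        rw [hν'.2.2] at hpτ' ⊢
        exact ⟨hν.subset hy, fun z hz => (hpτ'.2 z hz).trans h0.ge⟩
      exact hf₁.ext hf₂ (Subset.antisymm (sub hf₁ hf₂ hv hp hp₂) (sub hf₂ hf₁ hv.symm hp₂ hp))
    · intro τ' hτ'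
      rw [Finset.mem_filter, mem_facets] at hτ'
      obtain ⟨⟨ν, hν, hνη⟩, p, hp, hpa⟩ := hτ'
      have hpσ : p ∈ σ.carrier := by have := hν.subset hp; rw [hc] at this; exact this.1
      -- `ν` attains its maximum over all of `σ` at `p`
      have hmax : ∀ y ∈ σ.carrier, ⟪ν, y⟫ ≤ ⟪ν, p⟫ := by
        intro y hy
        have hcont : Continuous fun t : ℝ => ⟪f, p + t • (y - p)⟫ := by fun_prop
        have h0 := hcont.tendsto 0
        simp only [zero_smul, add_zero] at h0
        have hev := ((h0.eventually (gt_mem_nhds hpa)).filter_mono nhdsWithin_le_nhds).and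
          (Ioc_mem_nhdsGT (zero_lt_one (α := ℝ)))
        obtain ⟨t, ht, ht0, ht1⟩ := hev.exists
        have hmem : p + t • (y - p) ∈ σ'.carrier := by
          rw [hc]; exact ⟨σ.convex.add_smul_sub_mem hpσ hy ⟨ht0.le, ht1⟩, ht.le⟩
        have := (hν.2.2 ▸ hp).2 _ hmem
        rw [inner_add_right, inner_smul_right, inner_sub_right] at this
        have h3 : t * (⟪ν, y⟫ - ⟪ν, p⟫) ≤ 0 := by linarith
        linarith [nonpos_of_mul_nonpos_right h3 ht0]
      set C := {x ∈ σ.carrier | ∀ y ∈ σ.carrier, ⟪ν, y⟫ ≤ ⟪ν, x⟫} with hC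
      have hCeq : C = {x ∈ σ.carrier | ⟪-ν, x⟫ ≤ -⟪ν, p⟫} := by
        ext x
        simp only [hC, mem_ofPred_eq, inner_neg_left, neg_le_neg_iff]
        exact and_congr_right fun _ => ⟨fun h => h p hpσ, fun h y hy => (hmax y hy).trans h⟩
      have hCn : IsOuterNormal ν C σ.carrier := ⟨hD ▸ hν.1, hν.2.1, rfl⟩
      have hsub : τ'.carrier ⊆ C := by
        intro x hx
        have hxσ := hν.subset hx
        rw [hc] at hxσ
        have h2 := (hν.2.2 ▸ hx).2 p (hν.subset hp)
        exact ⟨hxσ.1, fun y hy => (hmax y hy).trans h2⟩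
      have hle : vectorSpan ℝ τ'.carrier ≤ vectorSpan ℝ C := vectorSpan_mono ℝ hsub
      have hspan : vectorSpan ℝ τ'.carrier = vectorSpan ℝ C := by
        refine le_antisymm hle fun x hx => ?_
        exact mem_of_inner_eq_zero hν.1 hν.2.1 σ'.finrank_eq τ'.finrank_eq
          (vectorSpan_mono ℝ hν.subset) hν.inner_eq_zero
          (hD ▸ vectorSpan_mono ℝ hCn.subset hx) (hCn.inner_eq_zero x hx)
      let τ : OrientedPolyhedron n N :=
        { carrier := C
          nonempty := ⟨p, hsub hp⟩
          isBounded := σ.isBounded.subset fun x hx => hx.1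
          halfSpaces := hCeq ▸ halfSpaces_inter σ.halfSpaces _ _
          finrank_eq := hspan ▸ τ'.finrank_eq
          η := τ'.η
          orients := hspan ▸ τ'.orients }
      have hlt : ∃ x ∈ τ.carrier, ⟪f, x⟫ < a := ⟨p, hsub hp, hpa⟩
      refine ⟨τ, ?_, ?_⟩
      · rw [Finset.mem_filter, mem_facets]
        exact ⟨⟨ν, hCn, by rw [← hη, hνη]⟩, hlt⟩
      · refine OrientedPolyhedron.ext' ?_ (lowerPart_η _ _ _)
        rw [lowerPart_carrier hlt, hν.2.2, hc]
        ext x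
        constructor
        · rintro ⟨hx, hxa⟩
          exact ⟨⟨hx.1, hxa⟩, fun y hy => hx.2 y hy.1⟩
        · rintro ⟨⟨hx, hxa⟩, hm⟩
          exact ⟨⟨hx, fun y hy => (hmax y hy).trans (hm p ⟨hpσ, hpa.le⟩)⟩, hxa⟩
  · obtain ⟨hwc, ν, hνS, hν1, ⟨c, hc0, hcf⟩, hνη⟩ := hw
    have hwf : IsOrientedFacet w σ' := by
      obtain ⟨z, hz⟩ := w.nonempty
      rw [hwc] at hz
      have hdiff : ∀ x ∈ σ.carrier, ∀ y ∈ σ.carrier, ⟪f, x⟫ - ⟪f, y⟫ = c * (⟪ν, x⟫ - ⟪ν, y⟫) := by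
        intro x hx y hy
        rw [← inner_sub_right, ← inner_sub_right]
        exact hcf _ (sub_mem_vectorSpan hx hy)
      refine ⟨ν, ⟨hD ▸ hνS, hν1, ?_⟩, by rw [hη, hνη]⟩
      rw [hwc, hc]
      ext x
      constructor
      · rintro ⟨hx, hxa⟩
        refine ⟨⟨hx, hxa.le⟩, fun y hy => ?_⟩
        have h2 := hdiff y hy.1 x hx
        have h3 : c * (⟪ν, y⟫ - ⟪ν, x⟫) ≤ 0 := by linarith [hy.2]
        linarith [nonpos_of_mul_nonpos_right h3 hc0]
      · rintro ⟨⟨hx, hxa⟩, hm⟩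
        refine ⟨hx, le_antisymm hxa ?_⟩
        have h2 := hdiff z hz.1 x hx
        have h3 := hm z ⟨hz.1, hz.2.le⟩
        have h4 : c * (⟪ν, z⟫ - ⟪ν, x⟫) ≤ 0 :=
          mul_nonpos_of_nonneg_of_nonpos hc0.le (by linarith)
        linarith [hz.2]
    have : (facets σ').filter (fun τ => ¬∃ x ∈ τ.carrier, ⟪f, x⟫ < a) = {w} := by
      ext τ
      rw [Finset.mem_filter, mem_facets, Finset.mem_singleton]
      constructor
      · rintro ⟨hτ, hge⟩
        push Not at hge
        obtain ⟨μ, hμ, hμη⟩ := id hτ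
        have hsub : τ.carrier ⊆ w.carrier := by
          intro x hx
          have := hμ.subset hx
          rw [hc] at this
          rw [hwc]
          exact ⟨this.1, le_antisymm this.2 (hge x hx)⟩
        have hspan : vectorSpan ℝ τ.carrier = vectorSpan ℝ w.carrier :=
          Submodule.eq_of_le_of_finrank_eq (vectorSpan_mono ℝ hsub)
            (τ.finrank_eq.trans w.finrank_eq.symm)
        obtain ⟨x, hx⟩ := τ.nonempty
        refine hτ.ext hwf (hsub.antisymm fun y hy => ?_)
        have h0 := hμ.inner_eq_zero (y - x) (hspan ▸ sub_mem_vectorSpan hy (hsub hx))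
        rw [inner_sub_right, sub_eq_zero] at h0
        have hyσ : y ∈ σ'.carrier := by
          rw [hwc] at hy
          rw [hc]
          exact ⟨hy.1, hy.2.le⟩
        rw [hμ.2.2] at hx ⊢
        exact ⟨hyσ, fun z hz => (hx.2 z hz).trans h0.ge⟩
      · rintro rfl
        refine ⟨hwf, ?_⟩
        push Not
        intro x hx
        rw [hwc] at hx
        exact hx.2.ge
    rw [this, Finset.sum_singleton]

/-- The exposed faces of dimension `m - 1` are exactly those that have an outer unit normal. -/
theorem isFacet_iff {τ : Polyhedron n N} {σ : Polyhedron (n + 1) N} :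
    IsFacet τ σ ↔ ∃ ν, IsOuterNormal ν τ.carrier σ.carrier := by
  constructor
  · intro h
    obtain ⟨l, hl⟩ := h τ.nonempty
    let f : E N := (InnerProductSpace.toDual ℝ (E N)).symm l
    have hf : ∀ x, l x = ⟪f, x⟫ := fun x => by simp [f]
    set S := vectorSpan ℝ σ.carrier with hS
    let g : E N := S.starProjection f
    have hgS : g ∈ S := Submodule.starProjection_apply_mem _ _
    have hfg : ∀ x ∈ S, ⟪f, x⟫ = ⟪g, x⟫ := fun x hx =>
      sub_eq_zero.1 (by
        rw [← inner_sub_left]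
        exact Submodule.starProjection_inner_eq_zero f x hx)
    have hd : ∀ x ∈ σ.carrier, ∀ y ∈ σ.carrier, l x - l y = ⟪g, x⟫ - ⟪g, y⟫ := by
      intro x hx y hy
      rw [hf, hf, ← inner_sub_right, ← inner_sub_right, hfg _ (sub_mem_vectorSpan hx hy)]
    have hg0 : g ≠ 0 := by
      intro h0
      have : τ.carrier = σ.carrier := by
        rw [hl]
        ext x
        refine ⟨fun h => h.1, fun hx => ⟨hx, fun y hy => ?_⟩⟩
        have := hd y hy x hx
        rw [h0, inner_zero_left, inner_zero_left] at this
        linarith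
      have h1 := τ.finrank_eq
      rw [this, σ.finrank_eq] at h1
      omega
    have hgn : 0 < ‖g‖ := norm_pos_iff.2 hg0
    refine ⟨‖g‖⁻¹ • g, S.smul_mem _ hgS, ?_, ?_⟩
    · rw [norm_smul, norm_inv, norm_norm, inv_mul_cancel₀ hgn.ne']
    · rw [hl]
      ext x
      refine and_congr_right fun hx => forall₂_congr fun y hy => ?_
      rw [inner_smul_left, inner_smul_left]
      simp only [conj_trivial]
      rw [mul_le_mul_iff_right₀ (inv_pos.2 hgn)]
      have := hd y hy x hx
      constructor <;> intro <;> linarith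
  · rintro ⟨ν, hν⟩ -
    exact ⟨innerSL ℝ ν, hν.2.2⟩

/-! ### Polyhedral chains with coefficients in an abelian group -/

/-- `σ'` and `σ''` are obtained from `σ` by subdivision along a hyperplane that crosses `σ`. -/
def IsSubdivision (σ σ' σ'' : OrientedPolyhedron m N) : Prop :=
  ∃ (f : E N) (a : ℝ), (∃ x ∈ σ.carrier, ⟪f, x⟫ < a) ∧ (∃ x ∈ σ.carrier, a < ⟪f, x⟫) ∧
    σ'.carrier = {x ∈ σ.carrier | ⟪f, x⟫ ≤ a} ∧ σ''.carrier = {x ∈ σ.carrier | a ≤ ⟪f, x⟫} ∧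
    σ'.η = σ.η ∧ σ''.η = σ.η

section Chains

variable (m N) (G : Type*) [AddCommGroup G]

/-- Formal polyhedral `m`-chains: formal sums `∑ gᵢ σᵢ`. -/
abbrev FormalChain := OrientedPolyhedron m N →₀ G

/-- The subgroup generated by `g σ - (g σ' + g σ'')` for subdivisions and by `g σ + g σ̃` for
`σ̃` the reverse of `σ`. -/
noncomputable def relations : AddSubgroup (FormalChain m N G) :=
  AddSubgroup.closure
    ({x | ∃ (g : G) (σ σ' σ'' : OrientedPolyhedron m N), IsSubdivision σ σ' σ'' ∧
        x = Finsupp.single σ g - (Finsupp.single σ' g + Finsupp.single σ'' g)} ∪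
      {x | ∃ (g : G) (σ : OrientedPolyhedron m N),
        x = Finsupp.single σ g + Finsupp.single σ.reverse g})

/-- Polyhedral `m`-chains in `ℝ^N` with coefficients in `G`. -/
abbrev PolyChain := FormalChain m N G ⧸ relations m N G

end Chains

variable {G : Type*} [AddCommGroup G]

/-- The polyhedral chain `g [σ]`. -/
noncomputable def PolyChain.of (σ : OrientedPolyhedron m N) (g : G) : PolyChain m N G :=
  QuotientAddGroup.mk (Finsupp.single σ g)

/-- The chain `A` is supported in the set `K`: it is a sum `∑ gᵢ [σᵢ]` with all `σᵢ ⊆ K`. -/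
def PolyChain.SupportedIn (A : PolyChain m N G) (K : Set (E N)) : Prop :=
  ∃ a : FormalChain m N G, (QuotientAddGroup.mk a : PolyChain m N G) = A ∧
    ∀ σ ∈ a.support, σ.carrier ⊆ K

theorem PolyChain.of_subdivision {σ σ' σ'' : OrientedPolyhedron m N} (h : IsSubdivision σ σ' σ'')
    (g : G) : PolyChain.of σ g = PolyChain.of σ' g + PolyChain.of σ'' g := by
  rw [← sub_eq_zero]
  exact (QuotientAddGroup.eq_zero_iff _).2
    (AddSubgroup.subset_closure (Or.inl ⟨g, σ, σ', σ'', h, rfl⟩))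

theorem PolyChain.of_add_reverse (σ : OrientedPolyhedron m N) (g : G) :
    PolyChain.of σ g + PolyChain.of σ.reverse g = 0 :=
  (QuotientAddGroup.eq_zero_iff _).2 (AddSubgroup.subset_closure (Or.inr ⟨g, σ, rfl⟩))

/-- The boundary of a formal chain: `g σ` goes to the sum of `g τ` over the facets `τ` of `σ` with
the induced orientations. -/
noncomputable def formalBoundary : FormalChain (n + 1) N G →+ FormalChain n N G :=
  Finsupp.liftAddHom fun σ => ∑ τ ∈ facets σ, Finsupp.singleAddHom τ

theorem mk_formalBoundary_single (σ : OrientedPolyhedron (n + 1) N) (g : G) :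
    (QuotientAddGroup.mk (formalBoundary (Finsupp.single σ g)) : PolyChain n N G) =
      ∑ τ ∈ facets σ, PolyChain.of τ g := by
  change QuotientAddGroup.mk' (relations n N G) _ = _
  simp only [formalBoundary, Finsupp.liftAddHom_apply_single, AddMonoidHom.finsetSum_apply,
    Finsupp.singleAddHom_apply, map_sum]
  rfl

theorem reverse_reverse (σ : OrientedPolyhedron m N) : σ.reverse.reverse = σ :=
  OrientedPolyhedron.ext' rfl (neg_neg _)

theorem isOrientedFacet_reverse {τ : OrientedPolyhedron n N} {σ : OrientedPolyhedron (n + 1) N}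
    (h : IsOrientedFacet τ σ) : IsOrientedFacet τ.reverse σ.reverse := by
  obtain ⟨ν, hν, h⟩ := h
  refine ⟨ν, hν, ?_⟩
  change ((-σ.η : ⋀[ℝ]^(n + 1) (E N)) : ExteriorAlgebra ℝ (E N)) =
    ((-τ.η : ⋀[ℝ]^n (E N)) : ExteriorAlgebra ℝ (E N)) * _
  rw [Submodule.coe_neg, Submodule.coe_neg, h, neg_mul]

theorem sum_facets_reverse (σ : OrientedPolyhedron (n + 1) N) (g : G) :
    ∑ τ ∈ facets σ, PolyChain.of τ g + ∑ τ ∈ facets σ.reverse, PolyChain.of τ g = 0 := by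
  have : ∑ τ ∈ facets σ.reverse, PolyChain.of τ g =
      ∑ τ ∈ facets σ, PolyChain.of τ.reverse g := by
    refine Finset.sum_bij' (fun τ _ => τ.reverse) (fun τ _ => τ.reverse) ?_ ?_
      (fun τ _ => reverse_reverse τ) (fun τ _ => reverse_reverse τ)
      (fun τ _ => by rw [reverse_reverse])
    · intro τ hτ
      rw [mem_facets] at hτ ⊢
      simpa only [reverse_reverse] using isOrientedFacet_reverse hτ
    · intro τ hτ
      rw [mem_facets] at hτ ⊢
      exact isOrientedFacet_reverse hτ
  rw [this, ← Finset.sum_add_distrib]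
  exact Finset.sum_eq_zero fun τ _ => PolyChain.of_add_reverse τ g

theorem sum_facets_subdivision {σ σ' σ'' : OrientedPolyhedron (n + 1) N}
    (h : IsSubdivision σ σ' σ'') (g : G) :
    ∑ τ ∈ facets σ, PolyChain.of τ g =
      ∑ τ ∈ facets σ', PolyChain.of τ g + ∑ τ ∈ facets σ'', PolyChain.of τ g := by
  classical
  obtain ⟨f, a, h1, h2, hc', hc'', hη', hη''⟩ := h
  obtain ⟨w, hw⟩ := exists_slice σ h1 h2
  have h2' : ∃ x ∈ σ.carrier, ⟪-f, x⟫ < -a := by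
    obtain ⟨x, hx, hxa⟩ := h2
    exact ⟨x, hx, by rw [inner_neg_left]; linarith⟩
  have hc2 : σ''.carrier = {x ∈ σ.carrier | ⟪-f, x⟫ ≤ -a} := by
    rw [hc'']; ext x; simp [inner_neg_left]
  rw [sum_facets_cut (fun τ => PolyChain.of τ g) h1 hc' hη' hw,
    sum_facets_cut (fun τ => PolyChain.of τ g) h2' hc2 hη'' hw.reverse]
  rw [add_add_add_comm, PolyChain.of_add_reverse, add_zero, ← Finset.sum_add_distrib]
  refine Finset.sum_congr rfl fun τ hτ => ?_
  rw [mem_facets] at hτ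
  by_cases hlo : ∃ x ∈ τ.carrier, ⟪f, x⟫ < a <;>
    by_cases hhi : ∃ x ∈ τ.carrier, ⟪-f, x⟫ < -a
  · rw [if_pos hlo, if_pos hhi]
    refine PolyChain.of_subdivision ⟨f, a, hlo, ?_, lowerPart_carrier hlo, ?_, lowerPart_η _ _ _,
      lowerPart_η _ _ _⟩ g
    · obtain ⟨x, hx, hxa⟩ := hhi
      exact ⟨x, hx, by rw [inner_neg_left] at hxa; linarith⟩
    · rw [lowerPart_carrier hhi]; ext x; simp [inner_neg_left]
  · rw [if_pos hlo, if_neg hhi, add_zero]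
    congr 1
    refine OrientedPolyhedron.ext' ?_ (lowerPart_η _ _ _).symm
    rw [lowerPart_carrier hlo]
    push Not at hhi
    ext x
    refine ⟨fun hx => ⟨hx, ?_⟩, fun hx => hx.1⟩
    have := hhi x hx
    rw [inner_neg_left] at this
    linarith
  · rw [if_neg hlo, if_pos hhi, zero_add]
    congr 1
    refine OrientedPolyhedron.ext' ?_ (lowerPart_η _ _ _).symm
    rw [lowerPart_carrier hhi]
    push Not at hlo
    ext x
    refine ⟨fun hx => ⟨hx, ?_⟩, fun hx => hx.1⟩
    have := hlo x hx
    rw [inner_neg_left]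
    linarith
  · -- a facet cannot lie in a hyperplane that crosses the polyhedron
    exfalso
    push Not at hlo hhi
    obtain ⟨ν, hν, -⟩ := hτ
    have heq : ∀ x ∈ τ.carrier, ⟪f, x⟫ = a := fun x hx => by
      have := hhi x hx
      rw [inner_neg_left] at this
      linarith [hlo x hx]
    obtain ⟨t, ht⟩ := τ.nonempty
    have key : ∀ x ∈ σ.carrier, ⟪f, x⟫ - a = ⟪f, ν⟫ * (⟪ν, x⟫ - ⟪ν, t⟫) := by
      intro x hx
      have := inner_eq_mul_of_forall hν.1 hν.2.1 σ.finrank_eq τ.finrank_eq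
        (vectorSpan_mono ℝ hν.subset) hν.inner_eq_zero
        (inner_eq_zero_of_const fun y hy z hz => (heq y hy).trans (heq z hz).symm)
        (sub_mem_vectorSpan hx (hν.subset ht))
      rw [inner_sub_right, inner_sub_right, heq t ht] at this
      exact this
    have hm := (hν.2.2 ▸ ht).2
    obtain ⟨p, hp, hpa⟩ := h1
    obtain ⟨q, hq, hqa⟩ := h2
    have kp := key p hp
    have kq := key q hq
    have mp := hm p hp
    have mq := hm q hq
    rcases le_total 0 ⟪f, ν⟫ with h0 | h0
    · nlinarith [mul_nonneg h0 (sub_nonneg.2 mq)]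
    · nlinarith [mul_nonneg_of_nonpos_of_nonpos h0 (sub_nonpos.2 mp)]

theorem relations_le :
    relations (n + 1) N G ≤ (relations n N G).comap formalBoundary := by
  rw [relations, AddSubgroup.closure_le]
  rintro _ (⟨g, σ, σ', σ'', h, rfl⟩ | ⟨g, σ, rfl⟩)
  · change formalBoundary _ ∈ relations n N G
    rw [← QuotientAddGroup.eq_zero_iff, map_sub, map_add, QuotientAddGroup.mk_sub,
      QuotientAddGroup.mk_add, mk_formalBoundary_single, mk_formalBoundary_single,
      mk_formalBoundary_single, sum_facets_subdivision h, sub_self]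
  · change formalBoundary _ ∈ relations n N G
    rw [← QuotientAddGroup.eq_zero_iff, map_add, QuotientAddGroup.mk_add,
      mk_formalBoundary_single, mk_formalBoundary_single, sum_facets_reverse]

/-- The boundary homomorphism on polyhedral chains. -/
noncomputable def boundary : PolyChain (n + 1) N G →+ PolyChain n N G :=
  QuotientAddGroup.map _ _ formalBoundary relations_le

/-! ### Varifolds -/

/-- The Grassmannian of `m`-dimensional linear subspaces of `ℝ^N`. -/
def Grassmannian (m N : ℕ) := {S : Submodule ℝ (E N) // Module.finrank ℝ S = m}

/-- The topology in which a subspace is identified with its orthogonal projection. -/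
noncomputable instance : TopologicalSpace (Grassmannian m N) :=
  TopologicalSpace.induced (fun S => S.1.starProjection) inferInstance

noncomputable instance : MeasurableSpace (Grassmannian m N) := borel _

instance : BorelSpace (Grassmannian m N) := ⟨rfl⟩

/-- `m`-dimensional varifolds are (Radon) measures on `ℝ^N × Gr(m, N)`. -/
abbrev Varifold (m N : ℕ) := Measure (E N × Grassmannian m N)

/-- The divergence of `X` at `x` along the subspace `S`: the trace of `P_S ∘ DX(x)`. -/
noncomputable def divAlong (S : Submodule ℝ (E N)) (X : E N → E N) (x : E N) : ℝ :=
  LinearMap.trace ℝ (E N) ((S.starProjection ∘L fderiv ℝ X x : E N →L[ℝ] E N) : E N →ₗ[ℝ] E N)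

/-- The first variation `δV(X) = ∫ div_S X(x) dV(x, S)`. -/
noncomputable def Varifold.firstVariation (V : Varifold m N) (X : E N → E N) : ℝ :=
  ∫ p, divAlong p.2.1 X p.1 ∂V

/-- `V` is stationary in the open set `U`: the first variation vanishes on all `C¹` vector fields
with compact support in `U`. -/
def Varifold.IsStationaryIn (V : Varifold m N) (U : Set (E N)) : Prop :=
  ∀ X : E N → E N, ContDiff ℝ 1 X → HasCompactSupport X → tsupport X ⊆ U → V.firstVariation X = 0

/-- The multiplicity-one rectifiable varifold `var(σ)`: its weight is `ℋ^m ⌞ σ`, and its tangent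
plane is everywhere the plane of `σ`. -/
noncomputable def Polyhedron.var (σ : Polyhedron m N) : Varifold m N :=
  (μHE[m].restrict σ.carrier).map fun x => (x, ⟨vectorSpan ℝ σ.carrier, σ.finrank_eq⟩)

/-- The polyhedron with one of its orientations. -/
noncomputable def Polyhedron.orient (σ : Polyhedron m N) : OrientedPolyhedron m N :=
  { σ with
    η := (exists_orients _ σ.finrank_eq).choose
    orients := (exists_orients _ σ.finrank_eq).choose_spec }

/-- The `Λ_m ℝ^N`-valued chain `c ⟨σ⟩ = (c η(σ)) [σ]`. -/
noncomputable def Polyhedron.angle (c : ℝ≥0) (σ : Polyhedron m N) :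
    PolyChain m N (⋀[ℝ]^m (E N)) :=
  PolyChain.of σ.orient ((c : ℝ) • σ.orient.η)

/-- The chain `c ⟨σ⟩` does not depend on the orientation. -/
theorem angle_eq (c : ℝ≥0) (s : OrientedPolyhedron m N) :
    s.toPolyhedron.angle c = PolyChain.of s ((c : ℝ) • s.η) := by
  rcases s.toPolyhedron.orient.orients.eq_or_eq_neg s.orients with h | h
  · have : s.toPolyhedron.orient = s := OrientedPolyhedron.ext' rfl h
    rw [Polyhedron.angle, this]
  · have : s.toPolyhedron.orient = s.reverse := OrientedPolyhedron.ext' rfl h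
    rw [Polyhedron.angle, this]
    have h2 : (c : ℝ) • s.reverse.η = -((c : ℝ) • s.η) := smul_neg _ _
    have h3 : PolyChain.of s.reverse (-((c : ℝ) • s.η)) =
        -PolyChain.of s.reverse ((c : ℝ) • s.η) := by
      rw [PolyChain.of, Finsupp.single_neg]; rfl
    rw [h2, h3, neg_eq_iff_add_eq_zero, add_comm]
    exact PolyChain.of_add_reverse s _

/-- A polyhedral varifold `∑ cᵢ var(σᵢ)`, `cᵢ ≥ 0`, together with its polyhedra. -/
structure PolyhedralVarifold (m N : ℕ) where
  k : ℕ
  c : Fin k → ℝ≥0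
  σ : Fin k → Polyhedron m N

/-- The varifold `V = ∑ cᵢ var(σᵢ)`. -/
noncomputable def PolyhedralVarifold.toVarifold (V : PolyhedralVarifold m N) : Varifold m N :=
  ∑ i, V.c i • (V.σ i).var

/-- The chain `⟨V⟩ = ∑ cᵢ ⟨σᵢ⟩` with coefficients in `Λ_m ℝ^N`. -/
noncomputable def PolyhedralVarifold.chain (V : PolyhedralVarifold m N) :
    PolyChain m N (⋀[ℝ]^m (E N)) :=
  ∑ i, (V.σ i).angle (V.c i)

/-- Two distinct polyhedra of `V` are disjoint or meet in a common face of dimension `< m`. -/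
def PolyhedralVarifold.IsFaceToFace (V : PolyhedralVarifold m N) : Prop :=
  ∀ i j, i ≠ j → (V.σ i).carrier ∩ (V.σ j).carrier = ∅ ∨
    (IsExposed ℝ (V.σ i).carrier ((V.σ i).carrier ∩ (V.σ j).carrier) ∧
      IsExposed ℝ (V.σ j).carrier ((V.σ i).carrier ∩ (V.σ j).carrier) ∧
      Module.finrank ℝ (vectorSpan ℝ ((V.σ i).carrier ∩ (V.σ j).carrier)) < m)

/-- The balancing identity `∑ cᵢ η(σᵢ) = 0` along each face `τ ⊄ Γ`; the sum is over the polyhedra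
`σᵢ` with the facet `τ`, oriented so as to induce one and the same orientation on `τ`. -/
def PolyhedralVarifold.IsBalancedOff (V : PolyhedralVarifold (n + 1) N) (Γ : Set (E N)) : Prop :=
  open scoped Classical in
  ∀ (τ : OrientedPolyhedron n N) (s : Fin V.k → OrientedPolyhedron (n + 1) N),
    ¬ τ.carrier ⊆ Γ → (∀ i, (s i).toPolyhedron = V.σ i) →
    (∀ i, IsFacet τ.toPolyhedron (V.σ i) → IsOrientedFacet τ (s i)) →
    ∑ i with IsFacet τ.toPolyhedron (V.σ i), (V.c i : ℝ) • (s i).η = 0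

end PolyVar

/-! Stationarity and the boundary condition both say that one object, a system of normal vectors on
the facets, vanishes off Γ. By the divergence theorem on a flat polyhedron
(`Polyhedron.setIntegral_divAlong`), δV(X) is the sum over all `i` and all facets τ of σ_i of ∫_τ
⟨c_i ν, X⟩, where ν is the outer unit normal. On the algebraic side η(σ_i) = η(τ) ∧ ν, so ∂⟨V⟩ is
the sum of the chains (η(τ) ∧ c_i ν)[τ], which do not depend on the orientation of τ.

The two sides are linked by the functional g[τ] ↦ ⟨η(τ) ∧ ∫_τ X, g⟩. It respects subdivision and
reversal (`relations_le_ker`), and ⟨η(τ) ∧ x, η(τ) ∧ w⟩ = ⟨x, w⟩ for w normal to τ, so it maps ∂⟨V⟩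
to δV(X) (`PolyhedralVarifold.firstVariation_eq_chainPairing`). If ∂⟨V⟩ has a representative in Γ, a
field supported off Γ therefore has zero first variation.

Conversely, facets of different σ_i may overlap in part, so that testing with fields does not
isolate their coefficients. Cutting along all hyperplanes of the half-spaces that describe the
facets (`exists_refinement`) produces pieces of which any two distinct ones overlap in a null set,
and each of which lies in a given facet or meets it in a null set. A piece outside Γ with
coefficient w ≠ 0 then has a point away from Γ and from all other pieces carrying a coefficient. A
bump function there, times w, has positive flux, a contradiction (`apply_eq_zero_of_flux_eq_zero`).

In the face-to-face case distinct facets already overlap in null sets, so the same test applies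
without cutting. The coefficient at τ is Σ c_i ν_i, and the wedge with η(τ), injective on normal
vectors, turns it into the balancing sum Σ c_i η(σ_i). -/

namespace PolyVar

variable {m n N : ℕ}

/-! ### Divergence theorem on an intersection of half-spaces, by smooth cutoffs -/

section Divergence

open Filter Topology Real

section Cutoff

variable {W : Type*} [NormedAddCommGroup W] [InnerProductSpace ℝ W]

/-- The argument is d/ε + c, which tends to ±∞ with the sign of d, so the value is eventually
exactly 0 or 1. The term ε c is there because the cutoffs are evaluated at points moving with ε; for
d = 0 the limit would depend on c. -/
theorem tendsto_smoothTransition_div {d : ℝ} (hd : d ≠ 0) (c : ℝ) :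
    Tendsto (fun ε : ℝ => smoothTransition ((d + ε * c) / ε)) (𝓝[>] 0)
      (𝓝 (if 0 ≤ d then 1 else 0)) := by
  have hc : Continuous fun ε : ℝ => d + ε * c - ε := by fun_prop
  have hc' : Continuous fun ε : ℝ => d + ε * c := by fun_prop
  have h1 := (hc.tendsto 0).mono_left (nhdsWithin_le_nhds (s := Ioi 0))
  have h2 := (hc'.tendsto 0).mono_left (nhdsWithin_le_nhds (s := Ioi 0))
  simp only [zero_mul, add_zero, sub_zero] at h1 h2
  refine tendsto_const_nhds.congr' ?_
  rcases hd.lt_or_gt with h | h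
  · filter_upwards [h2.eventually (gt_mem_nhds h), self_mem_nhdsWithin] with ε hε hε0
    rw [if_neg (not_le.2 h), smoothTransition.zero_of_nonpos]
    exact div_nonpos_of_nonpos_of_nonneg hε.le (le_of_lt hε0)
  · filter_upwards [h1.eventually (lt_mem_nhds h), self_mem_nhdsWithin] with ε hε hε0
    rw [if_pos h.le, smoothTransition.one_of_one_le]
    rw [one_le_div hε0]
    linarith

/-- A product of smooth cutoffs of half-spaces. -/
noncomputable def cutoff (J : Finset (W × ℝ)) (ε : ℝ) (x : W) : ℝ :=
  ∏ j ∈ J, smoothTransition ((j.2 - ⟪j.1, x⟫) / ε)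

theorem continuous_cutoff (J : Finset (W × ℝ)) (ε : ℝ) : Continuous (cutoff J ε) :=
  continuous_finsetProd _ fun _ _ => smoothTransition.continuous.comp (by fun_prop)

theorem abs_cutoff_le (J : Finset (W × ℝ)) (ε : ℝ) (x : W) : |cutoff J ε x| ≤ 1 := by
  rw [cutoff, Finset.abs_prod]
  refine Finset.prod_le_one (fun _ _ => abs_nonneg _) fun j _ => ?_
  rw [abs_of_nonneg (smoothTransition.nonneg _)]
  exact smoothTransition.le_one _

theorem hasFDerivAt_cutoff [DecidableEq (W × ℝ)] (J : Finset (W × ℝ)) (ε : ℝ) (x : W) :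
    HasFDerivAt (cutoff J ε) (∑ j ∈ J, cutoff (J.erase j) ε x •
      (deriv smoothTransition ((j.2 - ⟪j.1, x⟫) / ε) * (-ε⁻¹)) • innerSL ℝ j.1) x := by
  refine HasFDerivAt.finsetProd fun j _ => ?_
  have h1 : HasDerivAt smoothTransition (deriv smoothTransition ((j.2 - ⟪j.1, x⟫) / ε))
      ((j.2 - ⟪j.1, x⟫) / ε) :=
    ((smoothTransition.contDiff (n := 1)).differentiable (by norm_num) _).hasDerivAt
  have h2 : HasFDerivAt (fun x : W => (j.2 - ⟪j.1, x⟫) / ε) (-ε⁻¹ • innerSL ℝ j.1) x := by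
    have := (((innerSL ℝ j.1).hasFDerivAt (x := x)).const_sub j.2).const_mul ε⁻¹
    convert! this using 1
    · ext y; simp [div_eq_inv_mul]
    · simp
  have := h1.comp_hasFDerivAt x h2
  rwa [smul_smul] at this

/-- Each factor is eventually constant because `y` lies on none of the hyperplanes, even though the
point of evaluation moves. The choice `w = 0` serves the volume integral, and `w = r • ν` serves the
thin layer along a face. -/
theorem tendsto_cutoff {J : Finset (W × ℝ)} {y w : W}
    (hy : ∀ j ∈ J, ⟪j.1, y⟫ ≠ j.2) :
    Tendsto (fun ε : ℝ => cutoff J ε (y - ε • w)) (𝓝[>] 0)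
      (𝓝 ({x | ∀ j ∈ J, ⟪j.1, x⟫ ≤ j.2}.indicator (fun _ => 1) y)) := by
  have h : ∀ j ∈ J, Tendsto (fun ε : ℝ => smoothTransition ((j.2 - ⟪j.1, y - ε • w⟫) / ε)) (𝓝[>] 0)
      (𝓝 (if 0 ≤ j.2 - ⟪j.1, y⟫ then 1 else 0)) := fun j hj => by
    have := tendsto_smoothTransition_div (sub_ne_zero.2 (hy j hj).symm) ⟪j.1, w⟫
    refine this.congr fun ε => ?_
    rw [inner_sub_right, inner_smul_right]
    congr 2
    ring
  have := tendsto_finsetProd J h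
  classical
  rw [Finset.prod_ite_zero] at this
  simpa [cutoff, indicator_apply] using this

end Cutoff

variable {W : Type*} [NormedAddCommGroup W] [InnerProductSpace ℝ W] [FiniteDimensional ℝ W]
  [MeasurableSpace W] [BorelSpace W]

/-- Hyperplanes are null sets. -/
theorem volume_hyperplane {w : W} (hw : w ≠ 0) (c : ℝ) : volume {y : W | ⟪w, y⟫ = c} = 0 := by
  rcases eq_empty_or_nonempty {y : W | ⟪w, y⟫ = c} with h | ⟨y₀, hy₀⟩
  · rw [h, measure_empty]
  · have hset : {y : W | ⟪w, y⟫ = c} = (AffineSubspace.mk' y₀ (ℝ ∙ w)ᗮ : Set W) := by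
      ext y
      have : ⟪w, y₀⟫ = c := hy₀
      simp only [SetLike.mem_coe, AffineSubspace.mem_mk', vsub_eq_sub,
        Submodule.mem_orthogonal_singleton_iff_inner_right, inner_sub_right, this, sub_eq_zero]
      rfl
    rw [hset]
    refine Measure.addHaar_affineSubspace _ _ fun htop => hw ?_
    have h1 := congrArg AffineSubspace.direction htop
    rw [AffineSubspace.direction_mk', AffineSubspace.direction_top] at h1
    have h2 : w ∈ (ℝ ∙ w)ᗮ := h1 ▸ Submodule.mem_top
    exact inner_self_eq_zero.1 (Submodule.mem_orthogonal_singleton_iff_inner_right.1 h2)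

/-- The splitting of a space along a unit vector preserves the volume. -/
theorem measurePreserving_split {ν : W} (hν : ‖ν‖ = 1) :
    MeasurePreserving (fun p : (ℝ ∙ ν)ᗮ × ℝ => (p.1 : W) + p.2 • ν) := by
  have h1 := ((ℝ ∙ ν).measurePreserving_measurableEquivProd (0 : W)).symm
  rw [InnerProductSpace.euclideanHausdorffMeasure_eq_volume] at h1
  have h2 := (LinearIsometryEquiv.toSpanUnitSingleton (𝕜 := ℝ) ν hν).measurePreserving
  have h3 := (h2.prod (MeasurePreserving.id (volume : Measure (ℝ ∙ ν)ᗮ)))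
  have h4 := (h1.comp h3).comp Measure.measurePreserving_swap
  convert! h4 using 1
  ext p
  simp [add_comm]

theorem continuous_deriv_smoothTransition : Continuous (deriv smoothTransition) :=
  (smoothTransition.contDiff (n := 1)).continuous_deriv (by norm_num)

theorem integrable_deriv_smoothTransition : Integrable (deriv smoothTransition) := by
  refine continuous_deriv_smoothTransition.integrable_of_hasCompactSupport
    (HasCompactSupport.intro (isCompact_Icc (a := (0 : ℝ)) (b := 1)) fun x hx => ?_)
  rcases lt_or_ge x 0 with h | h
  · have : smoothTransition =ᶠ[𝓝 x] fun _ => 0 := by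
      filter_upwards [gt_mem_nhds h] with y hy
      exact smoothTransition.zero_of_nonpos hy.le
    rw [this.deriv_eq, deriv_const]
  · have h1 : 1 < x := by
      by_contra! hc
      exact hx ⟨h, hc⟩
    have : smoothTransition =ᶠ[𝓝 x] fun _ => 1 := by
      filter_upwards [lt_mem_nhds h1] with y hy
      exact smoothTransition.one_of_one_le hy.le
    rw [this.deriv_eq, deriv_const]

theorem integral_deriv_smoothTransition : ∫ r, deriv smoothTransition r = 1 := by
  have hd : ∀ x, HasDerivAt smoothTransition (deriv smoothTransition x) x := fun x =>
    ((smoothTransition.contDiff (n := 1)).differentiable (by norm_num) x).hasDerivAt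
  have h0 : Tendsto smoothTransition atBot (𝓝 0) :=
    tendsto_const_nhds.congr' ((eventually_le_atBot 0).mono fun x hx =>
      (smoothTransition.zero_of_nonpos hx).symm)
  have h1 : Tendsto smoothTransition atTop (𝓝 1) :=
    tendsto_const_nhds.congr' ((eventually_ge_atTop 1).mono fun x hx =>
      (smoothTransition.one_of_one_le hx).symm)
  have hi : Integrable (deriv smoothTransition) := integrable_deriv_smoothTransition
  rw [integral_of_hasDerivAt_of_tendsto hd hi h0 h1, sub_zero]

/-- Concentration of the derivative of a cutoff near a hyperplane. -/
theorem tendsto_integral_strip {ν : W} (hν : ‖ν‖ = 1) (b : ℝ) {u : W → ℝ} (hu : Continuous u)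
    (huc : HasCompactSupport u) {g : ℝ → W → ℝ} (hg : ∀ ε, Continuous (g ε))
    (hg1 : ∀ ε x, |g ε x| ≤ 1) {G : (ℝ ∙ ν)ᗮ → ℝ}
    (hG : ∀ᵐ y : (ℝ ∙ ν)ᗮ, ∀ r : ℝ,
      Tendsto (fun ε => g ε ((y : W) + (b - ε * r) • ν)) (𝓝[>] 0) (𝓝 (G y))) :
    Tendsto (fun ε : ℝ => ∫ x, ε⁻¹ * deriv smoothTransition ((b - ⟪ν, x⟫) / ε) * g ε x * u x)
      (𝓝[>] 0) (𝓝 (∫ y : (ℝ ∙ ν)ᗮ, G y * u ((y : W) + b • ν))) := by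
  set φ' := deriv smoothTransition with hφ'
  have hφc : Continuous φ' := continuous_deriv_smoothTransition
  have hν0 : ∀ y : (ℝ ∙ ν)ᗮ, ⟪ν, (y : W)⟫ = 0 := fun y =>
    Submodule.mem_orthogonal_singleton_iff_inner_right.1 y.2
  have hin : ∀ (y : (ℝ ∙ ν)ᗮ) (t : ℝ), ⟪ν, (y : W) + t • ν⟫ = t := fun y t => by
    rw [inner_add_right, inner_smul_right, hν0, real_inner_self_eq_norm_sq, hν]; ring
  -- The integrand after the substitution x = y + (b - ε r) ν. The Jacobian ε cancels ε⁻¹, and the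
  -- argument of the derivative becomes r.
  let k : ℝ → (ℝ ∙ ν)ᗮ × ℝ → ℝ := fun ε p =>
    φ' p.2 * (g ε ((p.1 : W) + (b - ε * p.2) • ν) * u ((p.1 : W) + (b - ε * p.2) • ν))
  have hkc : ∀ ε, Continuous (k ε) := fun ε => by
    have h1 : Continuous fun p : (ℝ ∙ ν)ᗮ × ℝ => (p.1 : W) + (b - ε * p.2) • ν := by fun_prop
    exact (hφc.comp continuous_snd).mul (((hg ε).comp h1).mul (hu.comp h1))
  obtain ⟨R, hR⟩ := huc.isCompact.isBounded.subset_closedBall (0 : W)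
  obtain ⟨C, hC⟩ := hu.bounded_above_of_compact_support huc
  have hC0 : 0 ≤ C := (norm_nonneg _).trans (hC 0)
  -- A bound uniform in ε: by Pythagoras `u` vanishes once the component orthogonal to ν leaves the
  -- ball of radius `R` that contains the support.
  let D : (ℝ ∙ ν)ᗮ × ℝ → ℝ := fun p =>
    (Metric.closedBall (0 : (ℝ ∙ ν)ᗮ) R).indicator (fun _ => C) p.1 * |φ' p.2|
  have hD : Integrable D := by
    refine Integrable.mul_prod ?_ integrable_deriv_smoothTransition.abs
    exact (integrable_indicator_iff measurableSet_closedBall).2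
      (integrableOn_const (isCompact_closedBall _ _).measure_lt_top.ne)
  have hkD : ∀ ε p, ‖k ε p‖ ≤ D p := by
    intro ε p
    simp only [k, D, norm_mul, Real.norm_eq_abs]
    rw [mul_comm]
    refine mul_le_mul_of_nonneg_right ?_ (abs_nonneg _)
    by_cases hp : p.1 ∈ Metric.closedBall (0 : (ℝ ∙ ν)ᗮ) R
    · rw [indicator_of_mem hp]
      calc _ ≤ 1 * C := mul_le_mul (hg1 _ _) (hC _) (abs_nonneg _) zero_le_one
        _ = C := one_mul C
    · rw [indicator_of_notMem hp]
      have : u ((p.1 : W) + (b - ε * p.2) • ν) = 0 := by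
        by_contra hne
        have hm := hR (subset_tsupport u hne)
        rw [mem_closedBall_zero_iff] at hm
        refine hp ?_
        rw [mem_closedBall_zero_iff]
        refine le_trans ?_ hm
        have hpy := norm_add_sq_eq_norm_sq_add_norm_sq_of_inner_eq_zero (p.1 : W)
          ((b - ε * p.2) • ν) (by rw [inner_smul_right, real_inner_comm, hν0, mul_zero])
        have h3 : ‖(p.1 : W)‖ * ‖(p.1 : W)‖ ≤
            ‖(p.1 : W) + (b - ε * p.2) • ν‖ * ‖(p.1 : W) + (b - ε * p.2) • ν‖ := by
          rw [hpy]; nlinarith [mul_self_nonneg ‖(b - ε * p.2) • ν‖]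
        exact (mul_self_le_mul_self_iff (norm_nonneg _) (norm_nonneg _)).2 h3
      rw [this]; simp
  have hki : ∀ ε, Integrable (k ε) := fun ε =>
    hD.mono' (hkc ε).aestronglyMeasurable (Eventually.of_forall (hkD ε))
  have hlim : Tendsto (fun ε => ∫ p, k ε p) (𝓝[>] 0)
      (𝓝 (∫ p : (ℝ ∙ ν)ᗮ × ℝ, φ' p.2 * (G p.1 * u ((p.1 : W) + b • ν)))) := by
    refine tendsto_integral_filter_of_dominated_convergence D
      (Eventually.of_forall fun ε => (hkc ε).aestronglyMeasurable)
      (Eventually.of_forall fun ε => Eventually.of_forall (hkD ε)) hD ?_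
    have hG' := Measure.quasiMeasurePreserving_fst (μ := (volume : Measure (ℝ ∙ ν)ᗮ))
      (ν := (volume : Measure ℝ)) |>.ae hG
    filter_upwards [hG'] with p hp
    refine ((hp p.2).mul ?_).const_mul _
    have hc : Continuous fun ε : ℝ => u ((p.1 : W) + (b - ε * p.2) • ν) := by fun_prop
    have := hc.tendsto 0
    simp only [zero_mul, sub_zero] at this
    exact this.mono_left nhdsWithin_le_nhds
  have heq : ∫ p : (ℝ ∙ ν)ᗮ × ℝ, φ' p.2 * (G p.1 * u ((p.1 : W) + b • ν)) =
      ∫ y : (ℝ ∙ ν)ᗮ, G y * u ((y : W) + b • ν) := by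
    have := integral_prod_mul (μ := (volume : Measure (ℝ ∙ ν)ᗮ)) (ν := (volume : Measure ℝ))
      (fun y : (ℝ ∙ ν)ᗮ => G y * u ((y : W) + b • ν)) φ'
    rw [integral_deriv_smoothTransition, mul_one] at this
    rw [← this]
    exact integral_congr_ae (Eventually.of_forall fun p => mul_comm _ _)
  rw [heq] at hlim
  refine hlim.congr' ?_
  filter_upwards [self_mem_nhdsWithin] with ε hε
  have hε : 0 < ε := hε
  have hmp := measurePreserving_split hν
  set h : W → ℝ := fun x => ε⁻¹ * φ' ((b - ⟪ν, x⟫) / ε) * g ε x * u x with hh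
  have hhc : Continuous h :=
    ((continuous_const.mul (hφc.comp (by fun_prop))).mul (hg ε)).mul hu
  have hhi : Integrable h := hhc.integrable_of_hasCompactSupport huc.mul_left
  have h1 : ∫ x, h x = ∫ p : (ℝ ∙ ν)ᗮ × ℝ, h ((p.1 : W) + p.2 • ν) := by
    conv_lhs => rw [← hmp.map_eq]
    exact integral_map hmp.measurable.aemeasurable hhc.aestronglyMeasurable
  have hhi' : Integrable (fun p : (ℝ ∙ ν)ᗮ × ℝ => h ((p.1 : W) + p.2 • ν)) :=
    hmp.integrable_comp_of_integrable hhi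
  rw [h1]
  rw [Measure.volume_eq_prod] at hhi' ⊢
  rw [integral_prod _ hhi', integral_prod _ (hki ε)]
  congr 1
  ext y
  -- After Fubini the substitution is one-dimensional on each line parallel to ν: a scaling by ε
  -- followed by the reflection t ↦ b - t.
  have h2 := Measure.integral_comp_mul_left (fun t => h ((y : W) + (b - t) • ν)) ε
  have h3 := integral_sub_left_eq_self (fun t => h ((y : W) + t • ν)) (volume : Measure ℝ) b
  rw [h3, abs_of_pos (inv_pos.2 hε), smul_eq_mul] at h2
  rw [← mul_right_inj' (inv_pos.2 hε).ne', ← h2, ← integral_const_mul]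
  congr 1
  ext r
  simp only [k, hh, hin]
  rw [sub_sub_cancel, mul_div_cancel_left₀ _ hε.ne']
  ring

/-- **Divergence theorem** on a polyhedron with nonempty interior. -/
theorem setIntegral_fderiv_halfSpaces {n : ℕ} (hn : Module.finrank ℝ W = n + 1)
    (J : Finset (W × ℝ)) (hJ : ∀ j ∈ J, ‖j.1‖ = 1) (hint : ∃ x, ∀ j ∈ J, ⟪j.1, x⟫ < j.2)
    {u : W → ℝ} (hu : ContDiff ℝ 1 u) (huc : HasCompactSupport u) (v : W) :
    ∫ x in {x | ∀ j ∈ J, ⟪j.1, x⟫ ≤ j.2}, fderiv ℝ u x v =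
      ∑ j ∈ J, ⟪j.1, v⟫ *
        ∫ x in {x | (∀ i ∈ J, ⟪i.1, x⟫ ≤ i.2) ∧ ⟪j.1, x⟫ = j.2}, u x ∂μHE[n] := by
  classical
  set Q : Set W := {x | ∀ j ∈ J, ⟪j.1, x⟫ ≤ j.2} with hQ
  have hQm : MeasurableSet Q := by
    have : IsClosed Q := by
      rw [hQ]
      simp only [ofPred_forall]
      exact isClosed_biInter fun j _ => isClosed_le (by fun_prop) continuous_const
    exact this.measurableSet
  have hucont := hu.continuous
  have hdc : Continuous fun x => fderiv ℝ u x v :=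
    (hu.continuous_fderiv (by norm_num)).clm_apply continuous_const
  have hdcs : HasCompactSupport fun x => fderiv ℝ u x v := huc.fderiv_apply ℝ v
  have hdi : Integrable fun x => fderiv ℝ u x v := hdc.integrable_of_hasCompactSupport hdcs
  -- the left-hand side as a limit
  have hL : Tendsto (fun ε : ℝ => ∫ x, cutoff J ε x * fderiv ℝ u x v) (𝓝[>] 0)
      (𝓝 (∫ x in Q, fderiv ℝ u x v)) := by
    rw [← integral_indicator hQm]
    refine tendsto_integral_filter_of_dominated_convergence (fun x => ‖fderiv ℝ u x v‖)
      (Eventually.of_forall fun ε => ((continuous_cutoff J ε).mul hdc).aestronglyMeasurable)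
      (Eventually.of_forall fun ε => Eventually.of_forall fun x => ?_) hdi.norm ?_
    · rw [norm_mul]
      exact mul_le_of_le_one_left (norm_nonneg _) (abs_cutoff_le J ε x)
    · have hae : ∀ᵐ x : W, ∀ j ∈ J, ⟪j.1, x⟫ ≠ j.2 := by
        rw [Filter.eventually_all_finset]
        intro j hj
        have hne : j.1 ≠ 0 := norm_ne_zero_iff.1 (by rw [hJ j hj]; exact one_ne_zero)
        rw [ae_iff]
        simpa using volume_hyperplane hne j.2
      filter_upwards [hae] with x hx
      have h1 := (tendsto_cutoff (w := 0) hx).mul_const (fderiv ℝ u x v)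
      simp only [smul_zero, sub_zero] at h1
      convert! h1 using 2
      by_cases hxQ : x ∈ Q
      · rw [indicator_of_mem hxQ, indicator_of_mem hxQ, one_mul]
      · rw [indicator_of_notMem hxQ, indicator_of_notMem hxQ, zero_mul]
  -- integration by parts
  have hI : ∀ ε : ℝ, ∫ x, cutoff J ε x * fderiv ℝ u x v = ∑ j ∈ J, ⟪j.1, v⟫ *
      ∫ x, ε⁻¹ * deriv smoothTransition ((j.2 - ⟪j.1, x⟫) / ε) * cutoff (J.erase j) ε x * u x := by
    intro ε
    have hci : ∀ j : W × ℝ, Integrable fun x =>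
        ε⁻¹ * deriv smoothTransition ((j.2 - ⟪j.1, x⟫) / ε) * cutoff (J.erase j) ε x * u x :=
      fun j => Continuous.integrable_of_hasCompactSupport
        (((continuous_const.mul (continuous_deriv_smoothTransition.comp (by fun_prop))).mul
          (continuous_cutoff _ _)).mul hucont) huc.mul_left
    have hfd : ∀ x, fderiv ℝ (cutoff J ε) x v * u x = ∑ j ∈ J, -⟪j.1, v⟫ *
        (ε⁻¹ * deriv smoothTransition ((j.2 - ⟪j.1, x⟫) / ε) * cutoff (J.erase j) ε x * u x) := by
      intro x
      rw [(hasFDerivAt_cutoff J ε x).fderiv, sum_apply, Finset.sum_mul]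
      refine Finset.sum_congr rfl fun j _ => ?_
      simp only [smul_apply, innerSL_apply_apply, smul_eq_mul]
      ring
    rw [integral_mul_fderiv_eq_neg_fderiv_mul_of_integrable]
    · simp_rw [hfd]
      rw [integral_finsetSum _ fun j _ => (hci j).const_mul _, ← Finset.sum_neg_distrib]
      refine Finset.sum_congr rfl fun j _ => ?_
      rw [integral_const_mul]
      ring
    · simp_rw [hfd]
      exact integrable_finsetSum _ fun j _ => (hci j).const_mul _
    · exact ((continuous_cutoff J ε).mul hdc).integrable_of_hasCompactSupport hdcs.mul_left
    · exact ((continuous_cutoff J ε).mul hucont).integrable_of_hasCompactSupport huc.mul_left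
    · exact fun x _ => (hasFDerivAt_cutoff J ε x).differentiableAt
    · exact fun x _ => hu.differentiable (by norm_num) x
  -- It remains to pass to the limit in each boundary term: the derivative of one cutoff
  -- concentrates on its hyperplane, and the product of the others becomes the indicator of the
  -- remaining constraints.
  refine tendsto_nhds_unique hL ?_
  simp_rw [hI]
  refine tendsto_finsetSum _ fun j hj => Tendsto.const_mul _ ?_
  obtain ⟨ν, b⟩ := j
  have hν : ‖ν‖ = 1 := hJ _ hj
  have hν0 : ∀ y : (ℝ ∙ ν)ᗮ, ⟪ν, (y : W)⟫ = 0 := fun y =>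
    Submodule.mem_orthogonal_singleton_iff_inner_right.1 y.2
  have hνν : ⟪ν, ν⟫ = 1 := by rw [real_inner_self_eq_norm_sq, hν]; norm_num
  have hrank : Module.finrank ℝ (ℝ ∙ ν)ᗮ = n := by
    have : Fact (Module.finrank ℝ W = n + 1) := ⟨hn⟩
    exact Submodule.finrank_orthogonal_span_singleton
      (norm_ne_zero_iff.1 (by rw [hν]; exact one_ne_zero))
  -- the integral over the face in terms of the hyperplane
  have hface : ∫ x in {x | (∀ i ∈ J, ⟪i.1, x⟫ ≤ i.2) ∧ ⟪ν, x⟫ = b}, u x ∂μHE[n] =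
      ∫ y : (ℝ ∙ ν)ᗮ, {x | ∀ i ∈ J.erase (ν, b), ⟪i.1, x⟫ ≤ i.2}.indicator (fun _ => (1 : ℝ))
        ((y : W) + b • ν) * u ((y : W) + b • ν) := by
    let f : (ℝ ∙ ν)ᗮ → W := fun y => (y : W) + b • ν
    have hf : Isometry f := (isometry_add_right (b • ν)).comp isometry_subtype_coe
    have hfe : MeasurableEmbedding f := hf.isClosedEmbedding.measurableEmbedding
    have hfin : ∀ y, ⟪ν, f y⟫ = b := fun y => by
      simp only [f]
      rw [inner_add_right, inner_smul_right, hν0, hνν]; ring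
    have hrange : range f = {x | ⟪ν, x⟫ = b} := by
      ext x
      refine ⟨?_, fun hx => ⟨⟨x - b • ν, ?_⟩, by simp [f]⟩⟩
      · rintro ⟨y, rfl⟩
        exact hfin y
      · rw [Submodule.mem_orthogonal_singleton_iff_inner_right, inner_sub_right, inner_smul_right,
          hνν]
        have : ⟪ν, x⟫ = b := hx
        linarith
    have hmap : (μHE[n] : Measure W).restrict (range f) = (volume : Measure (ℝ ∙ ν)ᗮ).map f := by
      rw [← hf.map_euclideanHausdorffMeasure, ← hrank,
        InnerProductSpace.euclideanHausdorffMeasure_eq_volume]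
    have hset : {x | (∀ i ∈ J, ⟪i.1, x⟫ ≤ i.2) ∧ ⟪ν, x⟫ = b} = Q ∩ range f := by
      rw [hrange]; rfl
    rw [hset, ← Measure.restrict_restrict hQm, hmap, ← integral_indicator hQm, hfe.integral_map]
    congr 1
    ext y
    have hmem : f y ∈ Q ↔ f y ∈ {x | ∀ i ∈ J.erase (ν, b), ⟪i.1, x⟫ ≤ i.2} := by
      refine ⟨fun h i hi => h i (Finset.mem_of_mem_erase hi), fun h i hi => ?_⟩
      by_cases hij : i = (ν, b)
      · rw [hij]; exact (hfin y).le
      · exact h i (Finset.mem_erase.2 ⟨hij, hi⟩)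
    by_cases hy : f y ∈ Q
    · rw [indicator_of_mem hy, indicator_of_mem (hmem.1 hy), one_mul]
    · rw [indicator_of_notMem hy, indicator_of_notMem (fun h => hy (hmem.2 h)), zero_mul]
  rw [hface]
  refine tendsto_integral_strip hν b hucont huc (fun ε => continuous_cutoff _ ε)
    (fun ε x => abs_cutoff_le _ ε x) ?_
  have hae : ∀ᵐ y : (ℝ ∙ ν)ᗮ, ∀ i ∈ J.erase (ν, b), ⟪i.1, (y : W) + b • ν⟫ ≠ i.2 := by
    rw [Filter.eventually_all_finset]
    rintro ⟨μ, c⟩ hi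
    obtain ⟨hne, hiJ⟩ := Finset.mem_erase.1 hi
    set w := (ℝ ∙ ν)ᗮ.orthogonalProjectionOnto μ with hw
    have hwi : ∀ y : (ℝ ∙ ν)ᗮ, ⟪μ, (y : W)⟫ = ⟪w, y⟫ := fun y => by
      rw [hw, Submodule.inner_orthogonalProjectionOnto_eq_of_mem_right]
    by_cases hw0 : w = 0
    · -- parallel hyperplanes
      refine Eventually.of_forall fun y heq => hne ?_
      have hμ : μ ∈ ℝ ∙ ν := by
        have h1 : μ ∈ (ℝ ∙ ν)ᗮᗮ := fun z hz => by
          rw [real_inner_comm, hwi ⟨z, hz⟩, hw0, inner_zero_left]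
        rwa [Submodule.orthogonal_orthogonal] at h1
      obtain ⟨t, rfl⟩ := Submodule.mem_span_singleton.1 hμ
      have ht : |t| = 1 := by
        have := hJ _ hiJ
        simpa [norm_smul, hν] using this
      simp only [inner_add_right, inner_smul_right, inner_smul_left, hν0, hνν, conj_trivial] at heq
      obtain ⟨x₀, hx₀⟩ := hint
      have h1 := hx₀ _ hj
      have h2 := hx₀ _ hiJ
      simp only [inner_smul_left, conj_trivial] at h1 h2
      -- If μ = ν, then c = b and the pair is the erased one. If μ = -ν, the two half-spaces share
      -- only their common hyperplane, against the interior point `x₀`.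
      rcases (abs_eq zero_le_one).1 ht with rfl | rfl
      · rw [one_smul]
        congr 1
        linarith
      · linarith
    · have := volume_hyperplane hw0 (c - b * ⟪μ, ν⟫)
      rw [ae_iff]
      convert! this using 2
      ext y
      simp only [mem_ofPred_eq, not_not, inner_add_right, inner_smul_right, hwi]
      constructor <;> intro h <;> linarith
  filter_upwards [hae] with y hy r
  have := tendsto_cutoff (w := r • ν) hy
  refine this.congr fun ε => ?_
  congr 1
  rw [sub_smul, smul_smul]
  abel

end Divergence

/-! ### Hausdorff measure of polyhedra -/

theorem Polyhedron.isClosed (σ : Polyhedron m N) : IsClosed σ.carrier := by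
  obtain ⟨k, a, b, h⟩ := σ.halfSpaces
  rw [h, ofPred_forall]
  exact isClosed_iInter fun j => isClosed_le (by fun_prop) continuous_const

theorem Polyhedron.isCompact (σ : Polyhedron m N) : IsCompact σ.carrier :=
  Metric.isCompact_of_isClosed_isBounded σ.isClosed σ.isBounded

theorem Polyhedron.measurableSet (σ : Polyhedron m N) : MeasurableSet σ.carrier :=
  σ.isClosed.measurableSet

/-- The plane through `p` with the direction `S`, parametrized by `S`. -/
def planeMap (S : Submodule ℝ (E N)) (p : E N) (x : S) : E N := (x : E N) + p

theorem isometry_planeMap (S : Submodule ℝ (E N)) (p : E N) : Isometry (planeMap S p) :=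
  (isometry_add_right p).comp isometry_subtype_coe

theorem measurableEmbedding_planeMap (S : Submodule ℝ (E N)) (p : E N) :
    MeasurableEmbedding (planeMap S p) :=
  (isometry_planeMap S p).isClosedEmbedding.measurableEmbedding

theorem convex_preimage_planeMap {s : Set (E N)} (hs : Convex ℝ s) (S : Submodule ℝ (E N))
    (p : E N) : Convex ℝ (planeMap S p ⁻¹' s) := by
  let g : S →ᵃ[ℝ] E N := S.subtype.toAffineMap + AffineMap.const ℝ S p
  have hg : ⇑g = planeMap S p := by ext x; simp [g, planeMap]
  rw [← hg]
  exact hs.affine_preimage g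

theorem subset_range_planeMap {s : Set (E N)} {p : E N} (hp : p ∈ s) :
    s ⊆ range (planeMap (vectorSpan ℝ s) p) := fun x hx =>
  ⟨⟨x - p, sub_mem_vectorSpan hx hp⟩, sub_add_cancel x p⟩

theorem image_preimage_planeMap {s : Set (E N)} {p : E N} (hp : p ∈ s) :
    planeMap (vectorSpan ℝ s) p '' (planeMap (vectorSpan ℝ s) p ⁻¹' s) = s :=
  image_preimage_eq_of_subset (subset_range_planeMap hp)

theorem isBounded_preimage_planeMap {s : Set (E N)} (hs : Bornology.IsBounded s)
    (S : Submodule ℝ (E N)) (p : E N) : Bornology.IsBounded (planeMap S p ⁻¹' s) :=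
  (isometry_planeMap S p).antilipschitz.isBounded_preimage hs

/-- The Hausdorff measure of the dimension of a plane, restricted to the plane. -/
theorem map_planeMap (S : Submodule ℝ (E N)) (p : E N) (hS : Module.finrank ℝ S = m) :
    (volume : Measure S).map (planeMap S p) =
      (μHE[m] : Measure (E N)).restrict (range (planeMap S p)) := by
  subst hS
  rw [← (isometry_planeMap S p).map_euclideanHausdorffMeasure,
    InnerProductSpace.euclideanHausdorffMeasure_eq_volume]

theorem hausdorff_eq_volume_preimage {s : Set (E N)} {p : E N} (hp : p ∈ s)
    (hs : Module.finrank ℝ (vectorSpan ℝ s) = m) :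
    (μHE[m] : Measure (E N)) s = volume (planeMap (vectorSpan ℝ s) p ⁻¹' s) := by
  rw [← (measurableEmbedding_planeMap _ p).map_apply, map_planeMap _ p hs,
    Measure.restrict_eq_self _ (subset_range_planeMap hp)]

theorem restrict_eq_map_planeMap {s : Set (E N)} {p : E N} (hp : p ∈ s)
    (hs : Module.finrank ℝ (vectorSpan ℝ s) = m) (hm : MeasurableSet s) :
    (μHE[m] : Measure (E N)).restrict s =
      (volume.restrict (planeMap (vectorSpan ℝ s) p ⁻¹' s)).map (planeMap (vectorSpan ℝ s) p) := by
  rw [← (measurableEmbedding_planeMap _ p).restrict_map, map_planeMap _ p hs,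
    Measure.restrict_restrict hm, inter_eq_left.2 (subset_range_planeMap hp)]

theorem hausdorff_lt_top {s : Set (E N)} (hb : Bornology.IsBounded s)
    (hs : Module.finrank ℝ (vectorSpan ℝ s) = m) : (μHE[m] : Measure (E N)) s < ⊤ := by
  rcases s.eq_empty_or_nonempty with rfl | ⟨p, hp⟩
  · simp
  · rw [hausdorff_eq_volume_preimage hp hs]
    exact (isBounded_preimage_planeMap hb _ p).measure_lt_top

/-- Bounded sets of a lower dimension are null sets. -/
theorem hausdorff_eq_zero {s : Set (E N)} (hb : Bornology.IsBounded s)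
    (hs : Module.finrank ℝ (vectorSpan ℝ s) < m) : (μHE[m] : Measure (E N)) s = 0 :=
  -- A set of finite measure in its own dimension is null in every higher dimension.
  (Measure.euclideanHausdorffMeasure_zero_or_top hs s).resolve_right
    (hausdorff_lt_top hb rfl).ne

instance (σ : Polyhedron m N) :
    IsFiniteMeasure ((μHE[m] : Measure (E N)).restrict σ.carrier) :=
  ⟨by rw [Measure.restrict_apply_univ]; exact hausdorff_lt_top σ.isBounded σ.finrank_eq⟩

/-- A polyhedron meets a hyperplane that does not contain it in a null set. -/
theorem Polyhedron.hausdorff_slice_eq_zero (σ : Polyhedron m N) {f x : E N} {a : ℝ}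
    (hx : x ∈ σ.carrier) (hxa : ⟪f, x⟫ ≠ a) :
    (μHE[m] : Measure (E N)) {y ∈ σ.carrier | ⟪f, y⟫ = a} = 0 := by
  rcases {y ∈ σ.carrier | ⟪f, y⟫ = a}.eq_empty_or_nonempty with h | ⟨z, hz⟩
  · rw [h, measure_empty]
  refine hausdorff_eq_zero (σ.isBounded.subset fun y hy => hy.1) ?_
  refine (Submodule.finrank_lt_finrank_of_lt
    (lt_of_le_of_ne (vectorSpan_mono ℝ fun y hy => hy.1) fun h => hxa ?_)).trans_eq σ.finrank_eq
  have h0 := inner_eq_zero_of_const (g := f) (s := {y ∈ σ.carrier | ⟪f, y⟫ = a})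
    (fun x hx y hy => hx.2.trans hy.2.symm) (x - z) (h ▸ sub_mem_vectorSpan hx hz.1)
  rw [inner_sub_right, hz.2] at h0
  linarith

/-- Seen in its own plane, the polyhedron is a convex set whose affine span is everything, and in
finite dimension such a set has interior points. -/
theorem Polyhedron.interior_preimage_nonempty (σ : Polyhedron m N) {p : E N} (hp : p ∈ σ.carrier) :
    (interior (planeMap (vectorSpan ℝ σ.carrier) p ⁻¹' σ.carrier)).Nonempty := by
  set S := vectorSpan ℝ σ.carrier with hS
  set C := planeMap S p ⁻¹' σ.carrier with hC
  have h0 : (0 : S) ∈ C := by simpa [hC, planeMap] using hp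
  let g : S →ᵃ[ℝ] E N := S.subtype.toAffineMap + AffineMap.const ℝ S p
  have hg : ⇑g = planeMap S p := by ext x; simp [g, planeMap]
  have hconv : Convex ℝ C := convex_preimage_planeMap σ.convex S p
  rw [hconv.interior_nonempty_iff_affineSpan_eq_top,
    AffineSubspace.affineSpan_eq_top_iff_vectorSpan_eq_top_of_nonempty ℝ S S ⟨0, h0⟩]
  have h1 := AffineMap.map_vectorSpan g (s := C)
  rw [hg, hC, image_preimage_planeMap hp, ← hS] at h1
  have h2 : g.linear = S.subtype := by ext x; simp [g]
  rw [h2] at h1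
  refine Submodule.map_injective_of_injective S.subtype_injective ?_
  rw [h1, Submodule.map_top, Submodule.range_subtype]

/-- Every neighborhood of a point of a polyhedron contains a part of positive measure. -/
theorem Polyhedron.hausdorff_inter_ball_pos (σ : Polyhedron m N) {p : E N} (hp : p ∈ σ.carrier)
    {r : ℝ} (hr : 0 < r) : 0 < (μHE[m] : Measure (E N)) (σ.carrier ∩ Metric.ball p r) := by
  set S := vectorSpan ℝ σ.carrier with hS
  set C := planeMap S p ⁻¹' σ.carrier with hC
  obtain ⟨x₀, hx₀⟩ := σ.interior_preimage_nonempty hp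
  have h0 : (0 : S) ∈ C := by simpa [hC, planeMap] using hp
  have hconv : Convex ℝ C := convex_preimage_planeMap σ.convex S p
  -- The point `p` has coordinate 0. By convexity, shrinking an interior point towards 0 keeps it
  -- interior while bringing it into the ball.
  have hcont : Continuous fun t : ℝ => t • x₀ := by fun_prop
  have hlim := hcont.tendsto 0
  rw [zero_smul] at hlim
  have hev := ((hlim.eventually (Metric.ball_mem_nhds 0 hr)).filter_mono nhdsWithin_le_nhds).and
    (Ioc_mem_nhdsGT (zero_lt_one (α := ℝ)))
  obtain ⟨t, ht, ht01⟩ := hev.exists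
  have hti : t • x₀ ∈ interior C := by
    have := hconv.add_smul_mem_interior h0 (by rwa [zero_add]) ht01
    rwa [zero_add] at this
  have hpos : 0 < volume (interior C ∩ Metric.ball 0 r) :=
    (isOpen_interior.inter Metric.isOpen_ball).measure_pos _ ⟨_, hti, ht⟩
  refine hpos.trans_le ?_
  have h1 : planeMap S p '' (interior C ∩ Metric.ball 0 r) ⊆ σ.carrier ∩ Metric.ball p r := by
    rintro _ ⟨x, ⟨hxC, hxr⟩, rfl⟩
    refine ⟨(interior_subset hxC : x ∈ C), ?_⟩
    rw [mem_ball_zero_iff] at hxr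
    rw [Metric.mem_ball, dist_eq_norm, planeMap, add_sub_cancel_right]
    exact hxr
  refine le_trans ?_ (measure_mono h1)
  rw [(isometry_planeMap S p).euclideanHausdorffMeasure_image, ← σ.finrank_eq,
    InnerProductSpace.euclideanHausdorffMeasure_eq_volume]

/-! ### Facets, outer normals and the divergence theorem on a polyhedron -/

/-- The `(m-1)`-dimensional faces of a polyhedron, without orientations. -/
theorem Polyhedron.finite_facets (σ : Polyhedron (n + 1) N) :
    {τ : Polyhedron n N | IsFacet τ σ}.Finite := by
  refine ((PolyVar.finite_facets σ.orient).image OrientedPolyhedron.toPolyhedron).subset ?_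
  intro τ hτ
  obtain ⟨ν, hν⟩ := isFacet_iff.1 hτ
  obtain ⟨ζ, hζ, hη⟩ := exists_induced σ.orient.orients hν.1 hν.2.1 σ.finrank_eq τ.finrank_eq
    (vectorSpan_mono ℝ hν.subset) hν.inner_eq_zero
  exact ⟨⟨τ, ζ, hζ⟩, ⟨ν, hν, hη⟩, rfl⟩

/-- The `(m-1)`-dimensional faces of a polyhedron, without orientations. -/
noncomputable def Polyhedron.facets (σ : Polyhedron (n + 1) N) : Finset (Polyhedron n N) :=
  σ.finite_facets.toFinset

theorem Polyhedron.mem_facets {σ : Polyhedron (n + 1) N} {τ : Polyhedron n N} :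
    τ ∈ σ.facets ↔ IsFacet τ σ := by simp [Polyhedron.facets]

open scoped Classical in
/-- The outer unit normal of `σ` along the face `τ` (zero if `τ` is not a face of `σ`). -/
noncomputable def outerNormal (τ : Polyhedron n N) (σ : Polyhedron (n + 1) N) : E N :=
  if h : ∃ ν, IsOuterNormal ν τ.carrier σ.carrier then h.choose else 0

theorem isOuterNormal_outerNormal {τ : Polyhedron n N} {σ : Polyhedron (n + 1) N}
    (h : IsFacet τ σ) : IsOuterNormal (outerNormal τ σ) τ.carrier σ.carrier := by
  have h' := isFacet_iff.1 h
  rw [outerNormal, dif_pos h']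
  exact h'.choose_spec

theorem IsOuterNormal.eq_outerNormal {τ : Polyhedron n N} {σ : Polyhedron (n + 1) N} {ν : E N}
    (h : IsOuterNormal ν τ.carrier σ.carrier) : ν = outerNormal τ σ :=
  h.unique (isOuterNormal_outerNormal (isFacet_iff.2 ⟨ν, h⟩))

/-- A description of a polyhedron by half-spaces that touch it, with unit normals in its plane. -/
theorem Polyhedron.exists_unit_halfSpaces (σ : Polyhedron (n + 1) N) {p : E N}
    (hp : p ∈ σ.carrier) : ∃ J : Finset (vectorSpan ℝ σ.carrier × ℝ), (∀ j ∈ J, ‖j.1‖ = 1) ∧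
      (planeMap (vectorSpan ℝ σ.carrier) p ⁻¹' σ.carrier = {x | ∀ j ∈ J, ⟪j.1, x⟫ ≤ j.2}) ∧
      (∀ j ∈ J, ∃ x, planeMap (vectorSpan ℝ σ.carrier) p x ∈ σ.carrier ∧ ⟪j.1, x⟫ = j.2) ∧
      ∀ (τ : Polyhedron n N) (ν : E N), IsOuterNormal ν τ.carrier σ.carrier →
        ∃ j ∈ J, (j.1 : E N) = ν := by
  classical
  obtain ⟨k, a, b, hσ⟩ := σ.halfSpaces
  -- The bounds `b j` will be lowered to the maxima of `⟪a j, ·⟫` on σ, attained by compactness, so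
  -- that each half-space touches σ.
  have hmax : ∀ j, ∃ y ∈ σ.carrier, ∀ x ∈ σ.carrier, ⟪a j, x⟫ ≤ ⟪a j, y⟫ := fun j => by
    obtain ⟨y, hy, hmax⟩ := σ.isCompact.exists_isMaxOn σ.nonempty
      (f := fun x => ⟪a j, x⟫) (by fun_prop)
    exact ⟨y, hy, fun x hx => hmax hx⟩
  choose y hyσ hy using hmax
  have hsm : ∀ (r : ℝ) (x y : vectorSpan ℝ σ.carrier), ⟪r • x, y⟫ = r * ⟪x, y⟫ :=
    fun r x y => real_inner_smul_left x y r
  let α : Fin k → vectorSpan ℝ σ.carrier := fun j =>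
    (vectorSpan ℝ σ.carrier).orthogonalProjectionOnto (a j)
  have hα : ∀ j (x : vectorSpan ℝ σ.carrier), ⟪α j, x⟫ = ⟪a j, (x : E N)⟫ := fun j x =>
    Submodule.inner_orthogonalProjectionOnto_eq_of_mem_right x (a j)
  let z : Fin k → vectorSpan ℝ σ.carrier := fun j => ⟨y j - p, sub_mem_vectorSpan (hyσ j) hp⟩
  have hz : ∀ j, planeMap (vectorSpan ℝ σ.carrier) p (z j) = y j := fun j => sub_add_cancel _ _
  let h : Fin k → vectorSpan ℝ σ.carrier × ℝ := fun j => (‖α j‖⁻¹ • α j, ⟪‖α j‖⁻¹ • α j, z j⟫)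
  -- A constraint with `α j = 0` is constant on the plane of σ and can be dropped. After
  -- normalization, constraints that are positive multiples of each other on that plane become the
  -- same pair, so the image counts no facet twice.
  refine ⟨(Finset.univ.filter fun j => α j ≠ 0).image h, ?_, ?_, ?_, ?_⟩
  · intro j hj
    obtain ⟨i, hi, rfl⟩ := Finset.mem_image.1 hj
    have hi0 := (Finset.mem_filter.1 hi).2
    simp [h, norm_smul, hi0]
  · ext x
    simp only [mem_ofPred_eq, mem_preimage, Finset.forall_mem_image, Finset.mem_filter,
      Finset.mem_univ, true_and, h]
    have hinn : ∀ j,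
        ⟪a j, planeMap (vectorSpan ℝ σ.carrier) p x⟫ - ⟪a j, y j⟫ = ⟪α j, x⟫ - ⟪α j, z j⟫ := fun j => by
      rw [hα, hα, ← inner_sub_right, ← inner_sub_right]
      congr 1
      simp only [planeMap, z]
      abel
    constructor
    · intro hx j hj
      rw [hsm, hsm]
      have := hy j _ hx
      exact mul_le_mul_of_nonneg_left (by linarith [hinn j]) (by simp)
    · intro hx
      have hle : ∀ j, ⟪a j, planeMap (vectorSpan ℝ σ.carrier) p x⟫ ≤ ⟪a j, y j⟫ := by
        intro j
        by_cases hj : α j = 0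
        · have := hinn j
          rw [hj, inner_zero_left, inner_zero_left] at this
          linarith
        · have := hx hj
          rw [hsm, hsm] at this
          have := le_of_mul_le_mul_left this (by simpa using hj)
          linarith [hinn j]
      refine hσ.ge fun j => (hle j).trans ?_
      have hyj := hyσ j
      rw [hσ] at hyj
      exact hyj j
  · intro j hj
    obtain ⟨i, hi, rfl⟩ := Finset.mem_image.1 hj
    exact ⟨z i, by rw [hz]; exact hyσ i, rfl⟩
  · intro τ ν hν
    obtain ⟨j, c, hc, hj⟩ := exists_halfSpace hν hσ
    have hαν : α j = c • (⟨ν, hν.1⟩ : vectorSpan ℝ σ.carrier) := by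
      refine ext_inner_right ℝ fun x => ?_
      rw [hα, hj _ x.2, hsm]
      rfl
    have hn : ‖α j‖ = c := by
      have h1 : ‖(⟨ν, hν.1⟩ : vectorSpan ℝ σ.carrier)‖ = 1 := hν.2.1
      rw [hαν, norm_smul, h1, mul_one, Real.norm_of_nonneg hc.le]
    refine ⟨h j, Finset.mem_image_of_mem _ (Finset.mem_filter.2 ⟨Finset.mem_univ _, ?_⟩), ?_⟩
    · rw [← norm_ne_zero_iff, hn]
      exact hc.ne'
    · simp only [h]
      rw [hn, hαν, smul_smul, inv_mul_cancel₀ hc.ne', one_smul]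

/-- **Divergence theorem** on a polyhedron for a derivative in a tangential direction. -/
theorem Polyhedron.setIntegral_fderiv (σ : Polyhedron (n + 1) N) {u : E N → ℝ}
    (hu : ContDiff ℝ 1 u) (huc : HasCompactSupport u) {v : E N}
    (hv : v ∈ vectorSpan ℝ σ.carrier) :
    ∫ x in σ.carrier, fderiv ℝ u x v ∂μHE[n + 1] =
      ∑ τ ∈ σ.facets, ⟪outerNormal τ σ, v⟫ * ∫ x in τ.carrier, u x ∂μHE[n] := by
  classical
  obtain ⟨p, hp⟩ := σ.nonempty
  obtain ⟨J, hJ1, hJ2, hJ3, hJ4⟩ := σ.exists_unit_halfSpaces hp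
  set f := planeMap (vectorSpan ℝ σ.carrier) p with hf
  set C := f ⁻¹' σ.carrier with hC
  have hfi : Isometry f := isometry_planeMap (vectorSpan ℝ σ.carrier) p
  have hfe := measurableEmbedding_planeMap (vectorSpan ℝ σ.carrier) p
  have hfd : ∀ x, HasFDerivAt f (vectorSpan ℝ σ.carrier).subtypeL x := fun x =>
    (vectorSpan ℝ σ.carrier).subtypeL.hasFDerivAt.add_const p
  have hfs : ContDiff ℝ 1 f := (vectorSpan ℝ σ.carrier).subtypeL.contDiff.add contDiff_const
  have hint : ∃ x, ∀ j ∈ J, ⟪j.1, x⟫ < j.2 := by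
    obtain ⟨x₀, hx₀⟩ := σ.interior_preimage_nonempty hp
    refine ⟨x₀, fun j hj => ?_⟩
    -- An interior point can be moved slightly along the unit normal without leaving the set, so its
    -- own constraint is strict.
    have hcont : Continuous fun t : ℝ => x₀ + t • j.1 := by fun_prop
    have hlim := hcont.tendsto 0
    rw [zero_smul, add_zero] at hlim
    have hev := ((hlim.eventually (isOpen_interior.mem_nhds hx₀)).filter_mono
      nhdsWithin_le_nhds).and (self_mem_nhdsWithin (s := Ioi (0 : ℝ)))
    obtain ⟨t, ht, ht0⟩ := hev.exists
    have ht0 : 0 < t := ht0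
    have h1 : x₀ + t • j.1 ∈ C := interior_subset ht
    have h2 := (hJ2 ▸ h1 : x₀ + t • j.1 ∈ {x | ∀ j ∈ J, ⟪j.1, x⟫ ≤ j.2}) j hj
    have h3 : ⟪j.1, t • j.1⟫ = t * ⟪j.1, j.1⟫ := real_inner_smul_right j.1 j.1 t
    rw [inner_add_right, h3, real_inner_self_eq_norm_sq, hJ1 j hj] at h2
    linarith
  have hdiv := setIntegral_fderiv_halfSpaces (n := n) (W := vectorSpan ℝ σ.carrier) σ.finrank_eq
    J hJ1 hint
    (hu.comp hfs) (huc.comp_isClosedEmbedding hfi.isClosedEmbedding) ⟨v, hv⟩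
  rw [← hJ2] at hdiv
  have hL : ∫ x in σ.carrier, fderiv ℝ u x v ∂μHE[n + 1] =
      ∫ x in C, fderiv ℝ (u ∘ f) x ⟨v, hv⟩ := by
    rw [restrict_eq_map_planeMap hp σ.finrank_eq σ.measurableSet, hfe.integral_map]
    refine integral_congr_ae (Filter.Eventually.of_forall fun x => ?_)
    have := ((hu.differentiable (by norm_num) (f x)).hasFDerivAt.comp x (hfd x)).fderiv
    simp only [this]
    rfl
  rw [hL, hdiv]
  -- the slices of `σ` by the bounding hyperplanes
  let T : vectorSpan ℝ σ.carrier × ℝ → Set (E N) := fun j =>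
    f '' {x | (∀ i ∈ J, ⟪i.1, x⟫ ≤ i.2) ∧ ⟪j.1, x⟫ = j.2}
  have hTi : ∀ j : vectorSpan ℝ σ.carrier × ℝ,
      ∫ x in {x | (∀ i ∈ J, ⟪i.1, x⟫ ≤ i.2) ∧ ⟪j.1, x⟫ = j.2},
      (u ∘ f) x ∂μHE[n] = ∫ x in T j, u x ∂μHE[n] := by
    intro j
    have h1 : (μHE[n] : Measure (E N)).restrict (T j) =
        ((μHE[n] : Measure (vectorSpan ℝ σ.carrier)).restrict
          {x | (∀ i ∈ J, ⟪i.1, x⟫ ≤ i.2) ∧ ⟪j.1, x⟫ = j.2}).map f := by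
      have h2 := hfe.restrict_map (μHE[n] : Measure (vectorSpan ℝ σ.carrier)) (T j)
      rw [preimage_image_eq _ hfi.injective] at h2
      rw [← h2, hfi.map_euclideanHausdorffMeasure, Measure.restrict_restrict_of_subset]
      exact image_subset_range _ _
    rw [h1, hfe.integral_map]
    rfl
  have hin : ∀ (w x y : vectorSpan ℝ σ.carrier),
      ⟪(w : E N), f x⟫ ≤ ⟪(w : E N), f y⟫ ↔ ⟪w, x⟫ ≤ ⟪w, y⟫ := by
    intro w x y
    simp only [hf, planeMap, inner_add_right, add_le_add_iff_right]
    rfl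
  -- Because the half-space touches σ, its hyperplane cuts out the exposed face on which the normal
  -- is maximal.
  have hT : ∀ j ∈ J, T j =
      {x ∈ σ.carrier | ∀ y ∈ σ.carrier, ⟪(j.1 : E N), y⟫ ≤ ⟪(j.1 : E N), x⟫} := by
    intro j hj
    ext x
    constructor
    · rintro ⟨x, ⟨hx1, hx2⟩, rfl⟩
      have hxC : x ∈ C := hJ2 ▸ hx1
      refine ⟨hxC, fun y hy => ?_⟩
      obtain ⟨y, rfl⟩ := subset_range_planeMap hp hy
      have hyC : y ∈ {x | ∀ j ∈ J, ⟪j.1, x⟫ ≤ j.2} := hJ2 ▸ hy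
      rw [hin, hx2]
      exact hyC j hj
    · rintro ⟨hx, hmax⟩
      obtain ⟨x, rfl⟩ := subset_range_planeMap hp hx
      have hxC : x ∈ {x | ∀ j ∈ J, ⟪j.1, x⟫ ≤ j.2} := hJ2 ▸ hx
      obtain ⟨z, hz, hzj⟩ := hJ3 j hj
      refine ⟨x, ⟨hxC, le_antisymm (hxC j hj) ?_⟩, rfl⟩
      rw [← hzj, ← hin]
      exact hmax _ hz
  have hTne : ∀ j ∈ J, (T j).Nonempty := fun j hj => by
    obtain ⟨z, hz, hzj⟩ := hJ3 j hj
    exact ⟨f z, z, ⟨(hJ2 ▸ hz : z ∈ {x | ∀ j ∈ J, ⟪j.1, x⟫ ≤ j.2}), hzj⟩, rfl⟩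
  simp_rw [hTi]
  symm
  have H : ∀ τ ∈ σ.facets, ∃ j ∈ J, (j.1 : E N) = outerNormal τ σ := fun τ hτ =>
    hJ4 τ _ (isOuterNormal_outerNormal (Polyhedron.mem_facets.1 hτ))
  choose! e heJ he using H
  have hTe : ∀ τ ∈ σ.facets, T (e τ) = τ.carrier := fun τ hτ => by
    rw [hT _ (heJ τ hτ), he τ hτ]
    exact (isOuterNormal_outerNormal (Polyhedron.mem_facets.1 hτ)).2.2.symm
  -- Facets inject into `J` through their normals. A constraint that is left over cuts out a face of
  -- dimension less than `n`, which is null: a face of dimension `n` would be a facet with this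
  -- normal and the same bound, hence in the image of `e`.
  refine Finset.sum_of_injOn e ?_ (fun τ hτ => heJ τ hτ) ?_ ?_
  · intro τ hτ τ' hτ' heq
    exact Polyhedron.ext' (by rw [← hTe τ hτ, ← hTe τ' hτ', heq])
  · intro j hj hje
    obtain ⟨q, hq⟩ := hTne j hj
    have hq' := hq
    rw [hT j hj] at hq'
    have hsub : T j ⊆ σ.carrier := fun x hx => by rw [hT j hj] at hx; exact hx.1
    have hb : Bornology.IsBounded (T j) := σ.isBounded.subset hsub
    have hjn : ‖(j.1 : E N)‖ = 1 := hJ1 j hj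
    have hle : vectorSpan ℝ (T j) ≤ vectorSpan ℝ σ.carrier ⊓ (ℝ ∙ (j.1 : E N))ᗮ := by
      refine le_inf (vectorSpan_mono ℝ hsub) fun x hx => ?_
      refine Submodule.mem_orthogonal_singleton_iff_inner_right.2
        (inner_eq_zero_of_const (fun x hx y hy => ?_) x hx)
      rw [hT j hj] at hx hy
      exact le_antisymm (hy.2 x hx.1) (hx.2 y hy.1)
    have hlt : Module.finrank ℝ (vectorSpan ℝ (T j)) < n + 1 :=
      ((Submodule.finrank_mono hle).trans_lt (finrank_inf_lt j.1.2 hjn)).trans_eq σ.finrank_eq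
    rcases (Nat.lt_succ_iff.1 hlt).lt_or_eq with h | h
    · rw [Measure.restrict_eq_zero.2 (hausdorff_eq_zero hb h), integral_zero_measure, mul_zero]
    · exfalso
      have hTeq : T j = {x ∈ σ.carrier | ⟪-(j.1 : E N), x⟫ ≤ -⟪(j.1 : E N), q⟫} := by
        rw [hT j hj]
        ext x
        simp only [mem_ofPred_eq, inner_neg_left, neg_le_neg_iff]
        exact and_congr_right fun _ => ⟨fun h => h q hq'.1, fun h y hy => (hq'.2 y hy).trans h⟩
      let τ : Polyhedron n N := ⟨T j, ⟨q, hq⟩, hb, hTeq ▸ halfSpaces_inter σ.halfSpaces _ _, h⟩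
      have hν : IsOuterNormal (j.1 : E N) τ.carrier σ.carrier := ⟨j.1.2, hjn, hT j hj⟩
      have hτ : τ ∈ σ.facets := Polyhedron.mem_facets.2 (isFacet_iff.2 ⟨_, hν⟩)
      refine hje ⟨τ, hτ, ?_⟩
      have h1 : (e τ).1 = j.1 := Subtype.ext ((he τ hτ).trans hν.eq_outerNormal.symm)
      obtain ⟨x, hx, hxq⟩ := hq
      have h2 : q ∈ T (e τ) := by rw [hTe τ hτ]; exact ⟨x, hx, hxq⟩
      obtain ⟨y, hy, hyq⟩ := h2
      obtain rfl : x = y := hfi.injective (hxq.trans hyq.symm)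
      exact Prod.ext h1 (by rw [← hx.2, ← hy.2, h1])
  · intro τ hτ
    rw [hTe τ hτ, ← he τ hτ]
    rfl

/-! ### The first variation of a polyhedral varifold -/

/-- The projection factors through `S`, so cyclicity of the trace makes this a trace over `S`,
computed in an orthonormal basis. It reduces the divergence to scalar derivatives in tangential
directions. -/
theorem divAlong_eq_sum (S : Submodule ℝ (E N)) (X : E N → E N) (x : E N) :
    divAlong S X x = ∑ i, ⟪(stdOrthonormalBasis ℝ S i : E N),
      fderiv ℝ X x (stdOrthonormalBasis ℝ S i)⟫ := by
  have h : ((S.starProjection ∘L fderiv ℝ X x : E N →L[ℝ] E N) : E N →ₗ[ℝ] E N) =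
      S.subtype ∘ₗ ((S.orthogonalProjectionOnto ∘L fderiv ℝ X x : E N →L[ℝ] S) : E N →ₗ[ℝ] S) := by
    ext y
    simp
  rw [divAlong, h, LinearMap.trace_comp_comm', LinearMap.trace_eq_sum_inner _
    (stdOrthonormalBasis ℝ S)]
  refine Finset.sum_congr rfl fun i _ => ?_
  rw [real_inner_comm]
  simp only [LinearMap.comp_apply, ContinuousLinearMap.coe_coe, ContinuousLinearMap.comp_apply,
    Submodule.subtype_apply]
  rw [Submodule.inner_orthogonalProjectionOnto_eq_of_mem_right, real_inner_comm]

theorem Polyhedron.integrableOn (σ : Polyhedron m N) {f : E N → ℝ} (hf : Continuous f) :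
    Integrable f ((μHE[m] : Measure (E N)).restrict σ.carrier) := by
  obtain ⟨C, hC⟩ := σ.isCompact.exists_bound_of_continuousOn hf.continuousOn
  exact (integrable_const C).mono' hf.aestronglyMeasurable
    ((ae_restrict_iff' σ.measurableSet).2 (Filter.Eventually.of_forall fun x hx => hC x hx))

theorem continuous_divAlong (S : Submodule ℝ (E N)) {X : E N → E N} (hX : ContDiff ℝ 1 X) :
    Continuous (divAlong S X) := by
  have : divAlong S X = fun x => ∑ i, ⟪(stdOrthonormalBasis ℝ S i : E N),
      fderiv ℝ X x (stdOrthonormalBasis ℝ S i)⟫ := funext (divAlong_eq_sum S X)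
  rw [this]
  have := hX.continuous_fderiv (by norm_num)
  fun_prop

/-- **Divergence theorem** on a polyhedron. -/
theorem Polyhedron.setIntegral_divAlong (σ : Polyhedron (n + 1) N) {X : E N → E N}
    (hX : ContDiff ℝ 1 X) (hXc : HasCompactSupport X) :
    ∫ x in σ.carrier, divAlong (vectorSpan ℝ σ.carrier) X x ∂μHE[n + 1] =
      ∑ τ ∈ σ.facets, ∫ x in τ.carrier, ⟪outerNormal τ σ, X x⟫ ∂μHE[n] := by
  set e := stdOrthonormalBasis ℝ (vectorSpan ℝ σ.carrier) with he
  have hu : ∀ i, ContDiff ℝ 1 fun x => ⟪(e i : E N), X x⟫ := fun i => contDiff_const.inner ℝ hX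
  have huc : ∀ i, HasCompactSupport fun x => ⟪(e i : E N), X x⟫ := fun i =>
    hXc.comp_left (g := fun y => ⟪(e i : E N), y⟫) (inner_zero_right _)
  have hfd : ∀ i x, fderiv ℝ (fun x => ⟪(e i : E N), X x⟫) x (e i) =
      ⟪(e i : E N), fderiv ℝ X x (e i)⟫ := fun i x => by
    rw [fderiv_inner_apply ℝ (differentiableAt_const _) (hX.differentiable (by norm_num) x)]
    simp
  simp_rw [divAlong_eq_sum, ← he, ← hfd]
  rw [integral_finsetSum]
  · simp_rw [σ.setIntegral_fderiv (hu _) (huc _) (e _).2]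
    rw [Finset.sum_comm]
    refine Finset.sum_congr rfl fun τ hτ => ?_
    simp_rw [← integral_const_mul]
    rw [← integral_finsetSum]
    · congr 1
      ext x
      have hν := (isOuterNormal_outerNormal (Polyhedron.mem_facets.1 hτ)).1
      -- Parseval in the plane of σ: the outer normal lies in this plane, so `X x` may be replaced
      -- by its projection.
      have h1 := e.sum_inner_mul_inner ⟨_, hν⟩
        ((vectorSpan ℝ σ.carrier).orthogonalProjectionOnto (X x))
      rw [real_inner_comm, Submodule.inner_orthogonalProjectionOnto_eq_of_mem_right,
        real_inner_comm] at h1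
      rw [← h1]
      refine Finset.sum_congr rfl fun i _ => ?_
      rw [real_inner_comm _ (e i), Submodule.inner_orthogonalProjectionOnto_eq_of_mem_right,
        real_inner_comm _ (X x)]
      rfl
    · exact fun i _ => (τ.integrableOn (hu i).continuous).const_mul _
  · intro i _
    refine σ.integrableOn ?_
    exact ((hu i).continuous_fderiv (by norm_num)).clm_apply continuous_const

/-- The topology is induced by an injection into a Hausdorff space, so points are closed. This makes
x ↦ (x, S) a measurable embedding, so that integrals against var(σ) pull back to σ with no
measurability assumption on the integrand in the plane variable. -/
instance : MeasurableSingletonClass (Grassmannian m N) := by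
  have hinj : Function.Injective fun S : Grassmannian m N => S.1.starProjection := by
    intro S T h
    exact Subtype.ext (Submodule.starProjection_inj.1 h)
  have : T2Space (Grassmannian m N) := T2Space.of_injective_continuous hinj continuous_induced_dom
  infer_instance

/-- The plane of a polyhedron. -/
noncomputable def Polyhedron.plane (σ : Polyhedron m N) : Grassmannian m N :=
  ⟨vectorSpan ℝ σ.carrier, σ.finrank_eq⟩

theorem Polyhedron.measurableEmbedding_plane (σ : Polyhedron m N) :
    MeasurableEmbedding fun x : E N => (x, σ.plane) :=
  MeasurableEmbedding.id.prodMk_right _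

theorem Polyhedron.var_eq (σ : Polyhedron m N) :
    σ.var = (μHE[m].restrict σ.carrier).map fun x => (x, σ.plane) := rfl

/-- The first variation of a polyhedral varifold is concentrated on the faces. -/
theorem PolyhedralVarifold.firstVariation_eq (V : PolyhedralVarifold (n + 1) N) {X : E N → E N}
    (hX : ContDiff ℝ 1 X) (hXc : HasCompactSupport X) :
    V.toVarifold.firstVariation X = ∑ i, ∑ τ ∈ (V.σ i).facets,
      ∫ x in τ.carrier, ⟪(V.c i : ℝ) • outerNormal τ (V.σ i), X x⟫ ∂μHE[n] := by
  rw [Varifold.firstVariation, toVarifold, integral_finsetSum_measure]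
  · refine Finset.sum_congr rfl fun i _ => ?_
    rw [integral_smul_nnreal_measure, Polyhedron.var_eq,
      (V.σ i).measurableEmbedding_plane.integral_map]
    have h := (V.σ i).setIntegral_divAlong hX hXc
    simp only [Polyhedron.plane]
    rw [h, NNReal.smul_def, smul_eq_mul, Finset.mul_sum]
    refine Finset.sum_congr rfl fun τ _ => ?_
    rw [← integral_const_mul]
    simp_rw [real_inner_smul_left]
  · intro i _
    refine Integrable.smul_measure_nnreal ?_
    rw [Polyhedron.var_eq, (V.σ i).measurableEmbedding_plane.integrable_map_iff]
    exact (V.σ i).integrableOn (continuous_divAlong _ hX)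

/-! ### Wedge with a vector and the Gram pairing of multivectors -/

theorem mul_ι_mem (η : ⋀[ℝ]^n (E N)) (x : E N) :
    (η : ExteriorAlgebra ℝ (E N)) * ExteriorAlgebra.ι ℝ x ∈ ⋀[ℝ]^(n + 1) (E N) := by
  change _ ∈ LinearMap.range (ExteriorAlgebra.ι ℝ) ^ (n + 1)
  rw [pow_succ]
  exact Submodule.mul_mem_mul η.2 ⟨x, rfl⟩

/-- The exterior product of an `n`-vector and a vector. -/
noncomputable def wedge : ⋀[ℝ]^n (E N) →ₗ[ℝ] E N →ₗ[ℝ] ⋀[ℝ]^(n + 1) (E N) :=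
  LinearMap.mk₂ ℝ (fun η x => ⟨η * ExteriorAlgebra.ι ℝ x, mul_ι_mem η x⟩)
    (fun η ζ x => Subtype.ext (by simp [add_mul]))
    (fun c η x => Subtype.ext (by simp))
    (fun η x y => Subtype.ext (by simp [mul_add]))
    (fun c η x => Subtype.ext (by simp))

theorem coe_wedge (η : ⋀[ℝ]^n (E N)) (x : E N) :
    (wedge η x : ExteriorAlgebra ℝ (E N)) =
      (η : ExteriorAlgebra ℝ (E N)) * ExteriorAlgebra.ι ℝ x := rfl

theorem wedge_ιMulti (v : Fin n → E N) (x : E N) :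
    wedge (exteriorPower.ιMulti ℝ n v) x =
      exteriorPower.ιMulti ℝ (n + 1) (Fin.snoc v x : Fin (n + 1) → E N) :=
  Subtype.ext (by rw [coe_wedge, ιMulti_snoc])

/-- The inner product of `m`-vectors. -/
noncomputable def vectorPairing : ⋀[ℝ]^m (E N) →ₗ[ℝ] ⋀[ℝ]^m (E N) →ₗ[ℝ] ℝ :=
  exteriorPower.pairingDual ℝ (E N) m ∘ₗ exteriorPower.map m (innerₗ (E N))

theorem vectorPairing_ιMulti (u v : Fin m → E N) :
    vectorPairing (exteriorPower.ιMulti ℝ m u) (exteriorPower.ιMulti ℝ m v) =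
      Matrix.det (Matrix.of fun i j => ⟪u j, v i⟫) := by
  simp only [vectorPairing, LinearMap.comp_apply, exteriorPower.map_apply_ιMulti,
    exteriorPower.pairingDual_ιMulti_ιMulti]
  rfl

/-- Contraction of `η ∧ w` by the unit `n`-vector `η` of a plane orthogonal to `w`. -/
theorem Orients.vectorPairing_wedge {T : Submodule ℝ (E N)} {η : ⋀[ℝ]^n (E N)} (h : Orients T η)
    {w : E N} (hw : ∀ y ∈ T, ⟪w, y⟫ = 0) (x : E N) :
    vectorPairing (wedge η x) (wedge η w) = ⟪x, w⟫ := by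
  obtain ⟨v, hv, hvT, hη⟩ := h
  -- η enters both arguments, so its sign cancels.
  suffices vectorPairing (wedge (exteriorPower.ιMulti ℝ n v) x)
      (wedge (exteriorPower.ιMulti ℝ n v) w) = ⟪x, w⟫ by
    rcases hη with rfl | rfl <;> simpa using this
  have hvw : ∀ i, ⟪v i, w⟫ = 0 := fun i => by
    rw [real_inner_comm]
    exact hw _ (hvT ▸ Submodule.subset_span ⟨i, rfl⟩)
  have hv1 := hv.1
  rw [orthonormal_iff_ite] at hv
  -- Since `w` is orthogonal to the plane, the Gram matrix is triangular with diagonal 1, …, 1, ⟪x,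
  -- w⟫, even when `x` has a component in the plane.
  rw [wedge_ιMulti, wedge_ιMulti, vectorPairing_ιMulti, Matrix.det_of_isUpperTriangular,
    Fin.prod_univ_castSucc]
  · simp [hv1]
  · intro i j hij
    have hij : j < i := hij
    rw [Matrix.of_apply]
    revert hij
    refine Fin.lastCases (fun hij => ?_) (fun j hij => ?_) j
    · exact absurd hij (Fin.le_last i).not_gt
    · revert hij
      refine Fin.lastCases (fun _ => ?_) (fun i hij => ?_) i
      · simpa using hvw j
      · simp only [Fin.snoc_castSucc]
        rw [hv, if_neg]
        rintro rfl
        exact lt_irrefl _ hij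

/-! ### The boundary of ⟨V⟩ and its pairing with vector fields -/

theorem isOrientedFacet_iff {τ : OrientedPolyhedron n N} {s : OrientedPolyhedron (n + 1) N} :
    IsOrientedFacet τ s ↔ IsFacet τ.toPolyhedron s.toPolyhedron ∧
      s.η = wedge τ.η (outerNormal τ.toPolyhedron s.toPolyhedron) := by
  constructor
  · rintro ⟨ν, hν, h⟩
    refine ⟨isFacet_iff.2 ⟨ν, hν⟩, ?_⟩
    rw [← IsOuterNormal.eq_outerNormal (τ := τ.toPolyhedron) (σ := s.toPolyhedron) hν]
    exact Subtype.ext h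
  · rintro ⟨h, hη⟩
    exact ⟨_, isOuterNormal_outerNormal h, by rw [hη, coe_wedge]⟩

/-- Every facet has an induced orientation. -/
theorem exists_isOrientedFacet {τ : Polyhedron n N} {s : OrientedPolyhedron (n + 1) N}
    (h : IsFacet τ s.toPolyhedron) :
    ∃ t : OrientedPolyhedron n N, t.toPolyhedron = τ ∧ IsOrientedFacet t s := by
  have hν := isOuterNormal_outerNormal h
  obtain ⟨ζ, hζ, hη⟩ := exists_induced s.orients hν.1 hν.2.1 s.finrank_eq τ.finrank_eq
    (vectorSpan_mono ℝ hν.subset) hν.inner_eq_zero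
  exact ⟨⟨τ, ζ, hζ⟩, rfl, _, hν, hη⟩

/-- Each facet carries exactly one induced orientation, so forgetting orientations is a bijection.
-/
theorem sum_facets_toPolyhedron {Q : Type*} [AddCommMonoid Q] (s : OrientedPolyhedron (n + 1) N)
    (F : Polyhedron n N → Q) :
    ∑ τ ∈ facets s, F τ.toPolyhedron = ∑ τ ∈ s.toPolyhedron.facets, F τ := by
  refine Finset.sum_nbij OrientedPolyhedron.toPolyhedron ?_ ?_ ?_ fun _ _ => rfl
  · intro τ hτ
    exact Polyhedron.mem_facets.2 (isOrientedFacet_iff.1 (mem_facets.1 hτ)).1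
  · intro τ hτ τ' hτ' h
    exact (mem_facets.1 hτ).ext (mem_facets.1 hτ') (congrArg Polyhedron.carrier h)
  · intro τ hτ
    obtain ⟨t, rfl, ht⟩ := exists_isOrientedFacet (Polyhedron.mem_facets.1 hτ)
    exact ⟨t, mem_facets.2 ht, rfl⟩

/-- The chain `(η(τ) ∧ w) [τ]`, which does not depend on the orientation of `τ`. -/
noncomputable def wedgeChain (τ : Polyhedron n N) :
    E N →+ PolyChain n N (⋀[ℝ]^(n + 1) (E N)) :=
  ((QuotientAddGroup.mk' _).comp (Finsupp.singleAddHom τ.orient)).comp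
    (wedge τ.orient.η).toAddMonoidHom

theorem of_reverse {G : Type*} [AddCommGroup G] (s : OrientedPolyhedron m N) (g : G) :
    PolyChain.of s.reverse (-g) = PolyChain.of s g := by
  have h3 : PolyChain.of s.reverse (-g) = -PolyChain.of s.reverse g := by
    rw [PolyChain.of, Finsupp.single_neg]; rfl
  rw [h3, neg_eq_iff_add_eq_zero, add_comm]
  exact PolyChain.of_add_reverse s _

/-- Reversing τ changes the sign of both η(τ) and [τ]. The arbitrary choice in `orient` is therefore
harmless, and the induced orientation may be used instead. -/
theorem wedgeChain_eq (s : OrientedPolyhedron n N) (w : E N) :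
    wedgeChain s.toPolyhedron w = PolyChain.of s (wedge s.η w) := by
  change PolyChain.of s.toPolyhedron.orient (wedge s.toPolyhedron.orient.η w) = _
  rcases s.toPolyhedron.orient.orients.eq_or_eq_neg s.orients with h | h
  · rw [show s.toPolyhedron.orient = s from OrientedPolyhedron.ext' rfl h]
  · rw [show s.toPolyhedron.orient = s.reverse from OrientedPolyhedron.ext' rfl h, ← of_reverse s]
    congr 1
    change wedge (-s.η) w = _
    simp

/-- The boundary of `⟨V⟩` in terms of the outer normals. -/
theorem PolyhedralVarifold.boundary_chain (V : PolyhedralVarifold (n + 1) N) :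
    boundary V.chain = ∑ i, ∑ τ ∈ (V.σ i).facets,
      wedgeChain τ ((V.c i : ℝ) • outerNormal τ (V.σ i)) := by
  rw [chain, map_sum]
  refine Finset.sum_congr rfl fun i _ => ?_
  refine Eq.trans ?_ (sum_facets_toPolyhedron (V.σ i).orient
    fun τ => wedgeChain τ ((V.c i : ℝ) • outerNormal τ (V.σ i)))
  refine (mk_formalBoundary_single _ _).trans (Finset.sum_congr rfl fun τ hτ => ?_)
  rw [wedgeChain_eq, map_smul]
  have h := (isOrientedFacet_iff.1 (mem_facets.1 hτ)).2
  rw [h]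
  rfl

/-- The functional `g [τ] ↦ ∫_τ ⟨η(τ) ∧ X, g⟩ dℋⁿ` on formal chains. -/
noncomputable def formalPairing (X : E N → E N) :
    FormalChain n N (⋀[ℝ]^(n + 1) (E N)) →+ ℝ :=
  Finsupp.liftAddHom fun τ =>
    (vectorPairing (wedge τ.η (∫ x in τ.carrier, X x ∂μHE[n]))).toAddMonoidHom

theorem formalPairing_single (X : E N → E N) (τ : OrientedPolyhedron n N)
    (g : ⋀[ℝ]^(n + 1) (E N)) : formalPairing X (Finsupp.single τ g) =
      vectorPairing (wedge τ.η (∫ x in τ.carrier, X x ∂μHE[n])) g := by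
  simp [formalPairing]

theorem Polyhedron.integrableOn_vector (σ : Polyhedron m N) {X : E N → E N} (hX : Continuous X) :
    Integrable X ((μHE[m] : Measure (E N)).restrict σ.carrier) := by
  obtain ⟨C, hC⟩ := σ.isCompact.exists_bound_of_continuousOn hX.continuousOn
  exact (integrable_const C).mono' hX.aestronglyMeasurable
    ((ae_restrict_iff' σ.measurableSet).2 (Filter.Eventually.of_forall fun x hx => hC x hx))

/-- The two parts of a subdivision share η and overlap in a slice of lower dimension, so their
integrals add up. A reversal flips η and hence the value. -/
theorem relations_le_ker {X : E N → E N} (hX : Continuous X) :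
    relations n N (⋀[ℝ]^(n + 1) (E N)) ≤ (formalPairing X).ker := by
  rw [relations, AddSubgroup.closure_le]
  rintro _ (⟨g, σ, σ', σ'', ⟨f, a, ⟨p, hp, hpa⟩, -, hc', hc'', hη', hη''⟩, rfl⟩ | ⟨g, σ, rfl⟩)
  · rw [SetLike.mem_coe, AddMonoidHom.mem_ker, map_sub, map_add, formalPairing_single,
      formalPairing_single, formalPairing_single, hη', hη'', ← LinearMap.add_apply, ← map_add,
      ← map_add]
    have hU : σ.carrier = σ'.carrier ∪ σ''.carrier := by
      rw [hc', hc'']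
      ext x
      simp only [mem_union, mem_ofPred_eq, ← and_or_left]
      exact ⟨fun h => ⟨h, le_total _ _⟩, fun h => h.1⟩
    have hnull : AEDisjoint (μHE[n] : Measure (E N)) σ'.carrier σ''.carrier := by
      refine measure_mono_null ?_ (σ.hausdorff_slice_eq_zero hp hpa.ne)
      rw [hc', hc'']
      exact fun x hx => ⟨hx.1.1, le_antisymm hx.1.2 hx.2.2⟩
    rw [← setIntegral_union₀ hnull σ''.measurableSet.nullMeasurableSet
      (σ'.integrableOn_vector hX) (σ''.integrableOn_vector hX), ← hU, sub_self]
  · rw [SetLike.mem_coe, AddMonoidHom.mem_ker, map_add, formalPairing_single,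
      formalPairing_single]
    change _ + vectorPairing (wedge (-σ.η) (∫ x in σ.carrier, X x ∂μHE[n])) g = 0
    simp

/-- The functional `g [τ] ↦ ∫_τ ⟨η(τ) ∧ X, g⟩ dℋⁿ` on polyhedral chains. -/
noncomputable def chainPairing {X : E N → E N} (hX : Continuous X) :
    PolyChain n N (⋀[ℝ]^(n + 1) (E N)) →+ ℝ :=
  QuotientAddGroup.lift _ (formalPairing X) (relations_le_ker hX)

/-- The contraction identity `Orients.vectorPairing_wedge` removes η(τ); it needs `w` normal to τ,
as multiples of outer normals are. -/
theorem chainPairing_wedgeChain {X : E N → E N} (hX : Continuous X) (τ : Polyhedron n N) {w : E N}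
    (hw : ∀ y ∈ vectorSpan ℝ τ.carrier, ⟪w, y⟫ = 0) :
    chainPairing hX (wedgeChain τ w) = ∫ x in τ.carrier, ⟪w, X x⟫ ∂μHE[n] := by
  change formalPairing X (Finsupp.single τ.orient (wedge τ.orient.η w)) = _
  rw [formalPairing_single, τ.orient.orients.vectorPairing_wedge hw, real_inner_comm]
  exact (integral_inner (τ.integrableOn_vector hX) w).symm

theorem inner_smul_outerNormal {τ : Polyhedron n N} {σ : Polyhedron (n + 1) N} (h : IsFacet τ σ)
    (c : ℝ) : ∀ y ∈ vectorSpan ℝ τ.carrier, ⟪c • outerNormal τ σ, y⟫ = 0 := fun y hy => by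
  rw [real_inner_smul_left, (isOuterNormal_outerNormal h).inner_eq_zero y hy, mul_zero]

/-- The first variation is determined by the boundary of the chain `⟨V⟩`. -/
theorem PolyhedralVarifold.firstVariation_eq_chainPairing (V : PolyhedralVarifold (n + 1) N)
    {X : E N → E N} (hX : ContDiff ℝ 1 X) (hXc : HasCompactSupport X) :
    V.toVarifold.firstVariation X = chainPairing hX.continuous (boundary V.chain) := by
  rw [V.firstVariation_eq hX hXc, V.boundary_chain, map_sum]
  refine Finset.sum_congr rfl fun i _ => ?_
  rw [map_sum]
  refine Finset.sum_congr rfl fun τ hτ => ?_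
  rw [chainPairing_wedgeChain _ _ (inner_smul_outerNormal (Polyhedron.mem_facets.1 hτ) _)]

/-- If the boundary of `⟨V⟩` is supported in `Γ`, then `V` is stationary outside of `Γ`. -/
theorem PolyhedralVarifold.isStationaryIn_of_supportedIn (V : PolyhedralVarifold (n + 1) N)
    {Γ : Set (E N)} (h : (boundary V.chain).SupportedIn Γ) :
    V.toVarifold.IsStationaryIn Γᶜ := by
  intro X hX hXc hXΓ
  obtain ⟨a, ha, haΓ⟩ := h
  rw [V.firstVariation_eq_chainPairing hX hXc, ← ha]
  change formalPairing X a = 0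
  rw [formalPairing, Finsupp.liftAddHom_apply]
  refine Finset.sum_eq_zero fun τ hτ => ?_
  -- `X` vanishes on Γ, which contains every polyhedron of the representative `a`.
  have h0 : ∫ x in τ.carrier, X x ∂μHE[n] = 0 :=
    setIntegral_eq_zero_of_forall_eq_zero fun x hx => by
      by_contra hne
      exact hXΓ (subset_tsupport X hne) (haΓ τ hτ hx)
  change vectorPairing (wedge τ.η (∫ x in τ.carrier, X x ∂μHE[n])) (a τ) = 0
  rw [h0]
  simp

/-! ### Normal vectors on polyhedra and localization of the flux -/

/-- The chain `∑ (η(τ) ∧ w_τ) [τ]`. -/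
noncomputable def normalChain :
    (Polyhedron n N →₀ E N) →+ PolyChain n N (⋀[ℝ]^(n + 1) (E N)) :=
  Finsupp.liftAddHom wedgeChain

theorem normalChain_single (τ : Polyhedron n N) (w : E N) :
    normalChain (Finsupp.single τ w) = wedgeChain τ w := by simp [normalChain]

/-- The flux `∑ ∫_τ ⟨w_τ, X⟩ dℋⁿ`. -/
noncomputable def flux (X : E N → E N) : (Polyhedron n N →₀ E N) →+ ℝ :=
  Finsupp.liftAddHom fun τ => ((innerₗ (E N)) (∫ x in τ.carrier, X x ∂μHE[n])).toAddMonoidHom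

theorem flux_apply (X : E N → E N) (c : Polyhedron n N →₀ E N) :
    flux X c = ∑ τ ∈ c.support, ⟪∫ x in τ.carrier, X x ∂μHE[n], c τ⟫ := rfl

/-- The vectors `w_τ` are normal to the polyhedra `τ`, which have the property `P`. -/
def normalChains (P : Polyhedron n N → Prop) : AddSubgroup (Polyhedron n N →₀ E N) where
  carrier := {c | (∀ τ, c τ ≠ 0 → P τ) ∧ ∀ τ, ∀ y ∈ vectorSpan ℝ τ.carrier, ⟪c τ, y⟫ = 0}
  zero_mem' := by simp
  add_mem' := by
    rintro c d ⟨hc, hc'⟩ ⟨hd, hd'⟩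
    refine ⟨fun τ h => ?_, fun τ y hy => ?_⟩
    · by_cases h0 : c τ = 0
      · exact hd τ (by simpa [h0] using h)
      · exact hc τ h0
    · rw [Finsupp.add_apply, inner_add_left, hc' τ y hy, hd' τ y hy, add_zero]
  neg_mem' := by
    rintro c ⟨hc, hc'⟩
    refine ⟨fun τ h => hc τ (by simpa using h), fun τ y hy => ?_⟩
    rw [Finsupp.neg_apply, inner_neg_left, hc' τ y hy, neg_zero]

theorem single_mem_normalChains {P : Polyhedron n N → Prop} {τ : Polyhedron n N} {w : E N}
    (hτ : P τ) (hw : ∀ y ∈ vectorSpan ℝ τ.carrier, ⟪w, y⟫ = 0) :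
    Finsupp.single τ w ∈ normalChains P := by
  classical
  refine ⟨fun σ h => ?_, fun σ y hy => ?_⟩
  · rw [Finsupp.single_apply] at h
    split_ifs at h with hs
    · exact hs ▸ hτ
    · exact absurd rfl h
  · rw [Finsupp.single_apply]
    split_ifs with hs
    · subst hs
      exact hw y hy
    · exact inner_zero_left _

/-- This passes from a class modulo the relations to the coefficients of a concrete representative,
which can be tested one at a time. -/
theorem chainPairing_normalChain {X : E N → E N} (hX : Continuous X) {P : Polyhedron n N → Prop}
    {c : Polyhedron n N →₀ E N} (hc : c ∈ normalChains P) :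
    chainPairing hX (normalChain c) = flux X c := by
  rw [normalChain, Finsupp.liftAddHom_apply, Finsupp.sum, map_sum, flux_apply]
  refine Finset.sum_congr rfl fun τ _ => ?_
  rw [chainPairing_wedgeChain hX τ (hc.2 τ), real_inner_comm]
  exact integral_inner (τ.integrableOn_vector hX) _

/-- A coefficient vanishes if the flux of every field off `K` does. -/
theorem apply_eq_zero_of_flux_eq_zero {c : Polyhedron n N →₀ E N} {K : Set (E N)}
    (hK : IsClosed K) (hc : ∀ X : E N → E N, ContDiff ℝ 1 X → HasCompactSupport X →
      tsupport X ⊆ Kᶜ → flux X c = 0) {q : Polyhedron n N}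
    (hqK : (μHE[n] : Measure (E N)) (q.carrier ∩ K) = 0)
    (hq : ∀ p, c p ≠ 0 → p = q ∨ (μHE[n] : Measure (E N)) (q.carrier ∩ p.carrier) = 0) :
    c q = 0 := by
  classical
  by_contra hcq
  -- All that the test field must avoid: `K` and every other polyhedron with a coefficient. It meets
  -- `q` in a null set, whereas `q` has positive measure, so some point of `q` remains.
  set K' := K ∪ ⋃ p ∈ c.support.erase q, p.carrier with hK'
  have hcl : IsClosed K' := hK.union (isClosed_biUnion_finset fun p _ => p.isClosed)
  have hnull : (μHE[n] : Measure (E N)) (q.carrier ∩ K') = 0 := by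
    rw [hK', inter_union_distrib_left, measure_union_null_iff]
    refine ⟨hqK, ?_⟩
    rw [inter_iUnion₂]
    refine (measure_biUnion_null_iff (c.support.erase q).countable_toSet).2 fun p hp => ?_
    have hp := Finset.mem_erase.1 hp
    exact (hq p (Finsupp.mem_support_iff.1 hp.2)).resolve_left hp.1
  obtain ⟨x, hx, hxK⟩ : ∃ x ∈ q.carrier, x ∉ K' := by
    by_contra! hall
    obtain ⟨x, hx⟩ := q.nonempty
    have h1 := q.hausdorff_inter_ball_pos hx one_pos
    exact h1.ne' (measure_mono_null (t := q.carrier ∩ K') (fun y hy => ⟨hy.1, hall y hy.1⟩) hnull)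
  obtain ⟨r, hr, hrK⟩ := Metric.isOpen_iff.1 hcl.isOpen_compl x hxK
  let f : ContDiffBump x := ⟨r / 4, r / 2, by linarith, by linarith⟩
  have hft : tsupport f ⊆ K'ᶜ := by
    rw [f.tsupport_eq]
    exact (Metric.closedBall_subset_ball (by simp only [f]; linarith)).trans hrK
  -- Pointing along the coefficient itself makes the flux through `q` equal to the integral of the
  -- bump times ‖c q‖², which is positive.
  let X : E N → E N := fun y => f y • c q
  have hXt : tsupport X ⊆ K'ᶜ :=
    (closure_mono (Function.support_smul_subset_left f fun _ => c q)).trans hft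
  have hflux := hc X (f.contDiff.smul contDiff_const) f.hasCompactSupport.smul_right
    (hXt.trans (compl_subset_compl.2 subset_union_left))
  rw [flux_apply, Finset.sum_eq_single_of_mem q (Finsupp.mem_support_iff.2 hcq),
    integral_smul_const,
    real_inner_smul_left, real_inner_self_eq_norm_sq] at hflux
  · have hpos : 0 < ∫ y in q.carrier, f y ∂μHE[n] := by
      rw [integral_pos_iff_support_of_nonneg (fun y => f.nonneg) (q.integrableOn f.continuous),
        f.support_eq, Measure.restrict_apply measurableSet_ball, inter_comm]
      exact q.hausdorff_inter_ball_pos hx f.rOut_pos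
    have := norm_pos_iff.2 hcq
    exact (mul_pos hpos (pow_pos this 2)).ne' hflux
  · intro p hp hpq
    rw [setIntegral_eq_zero_of_forall_eq_zero, inner_zero_left]
    intro y hy
    by_contra hne
    exact hXt (subset_tsupport X hne)
      (Or.inr (mem_biUnion (Finset.mem_coe.2 (Finset.mem_erase.2 ⟨hpq, hp⟩)) hy))

theorem supportedIn_normalChain {c : Polyhedron n N →₀ E N} {K : Set (E N)}
    (hc : ∀ p, c p ≠ 0 → p.carrier ⊆ K) : (normalChain c).SupportedIn K := by
  classical
  refine ⟨∑ p ∈ c.support, Finsupp.single p.orient (wedge p.orient.η (c p)), ?_, ?_⟩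
  · change QuotientAddGroup.mk' _ _ = _
    rw [map_sum]
    rfl
  · intro σ hσ
    obtain ⟨p, hp, hpσ⟩ := Finset.mem_biUnion.1 (Finsupp.support_finsetSum hσ)
    rw [Finset.mem_singleton.1 (Finsupp.support_single_subset hpσ)]
    exact hc p (Finsupp.mem_support_iff.1 hp)

/-- The faces of a polyhedral varifold with the weighted sums of their outer normals. -/
noncomputable def PolyhedralVarifold.faceChain (V : PolyhedralVarifold (n + 1) N) :
    Polyhedron n N →₀ E N :=
  ∑ i, ∑ τ ∈ (V.σ i).facets, Finsupp.single τ ((V.c i : ℝ) • outerNormal τ (V.σ i))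

theorem PolyhedralVarifold.normalChain_faceChain (V : PolyhedralVarifold (n + 1) N) :
    normalChain V.faceChain = boundary V.chain := by
  simp_rw [faceChain, V.boundary_chain, map_sum, normalChain_single]

theorem PolyhedralVarifold.faceChain_mem (V : PolyhedralVarifold (n + 1) N) :
    V.faceChain ∈ normalChains fun τ => ∃ i, IsFacet τ (V.σ i) :=
  sum_mem fun i _ => sum_mem fun _ hτ =>
    have h := Polyhedron.mem_facets.1 hτ
    single_mem_normalChains ⟨i, h⟩ (inner_smul_outerNormal h _)

open scoped Classical in
theorem PolyhedralVarifold.faceChain_apply (V : PolyhedralVarifold (n + 1) N)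
    (τ : Polyhedron n N) : V.faceChain τ =
      ∑ i with IsFacet τ (V.σ i), (V.c i : ℝ) • outerNormal τ (V.σ i) := by
  rw [faceChain, Finsupp.finsetSum_apply, Finset.sum_filter]
  refine Finset.sum_congr rfl fun i _ => ?_
  simp_rw [Finsupp.finsetSum_apply, Finsupp.single_apply, Finset.sum_ite_eq',
    Polyhedron.mem_facets]

/-- The flux of a stationary varifold vanishes. -/
theorem PolyhedralVarifold.flux_eq_zero {V : PolyhedralVarifold (n + 1) N} {Γ : Set (E N)}
    (hV : V.toVarifold.IsStationaryIn Γᶜ) {P : Polyhedron n N → Prop}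
    {c : Polyhedron n N →₀ E N} (hc : c ∈ normalChains P)
    (hcV : normalChain c = boundary V.chain) (X : E N → E N) (hX : ContDiff ℝ 1 X)
    (hXc : HasCompactSupport X) (hXΓ : tsupport X ⊆ Γᶜ) : flux X c = 0 := by
  rw [← chainPairing_normalChain hX.continuous hc, hcV,
    ← V.firstVariation_eq_chainPairing hX hXc]
  exact hV X hX hXc hXΓ

/-! ### Subdivision by finitely many hyperplanes -/

/-- `p` is an intersection of half-spaces from `D`. -/
def DescribedBy (D : Set (E N × ℝ)) (p : Polyhedron m N) : Prop :=
  ∃ M ⊆ D, p.carrier = {x | ∀ h ∈ M, ⟪h.1, x⟫ ≤ h.2}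

/-- `p` lies on one side of the hyperplane `h`. -/
def IsUncrossed (h : E N × ℝ) (p : Polyhedron m N) : Prop :=
  (∀ x ∈ p.carrier, ⟪h.1, x⟫ ≤ h.2) ∨ ∀ x ∈ p.carrier, h.2 ≤ ⟪h.1, x⟫

theorem IsUncrossed.mono {h : E N × ℝ} {p q : Polyhedron m N} (hq : IsUncrossed h q)
    (hpq : p.carrier ⊆ q.carrier) : IsUncrossed h p :=
  hq.imp (fun H x hx => H x (hpq hx)) fun H x hx => H x (hpq hx)

/-- Finitely many polyhedra are described by finitely many half-spaces. -/
theorem exists_describedBy (s : Set (Polyhedron m N)) (hs : s.Finite) :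
    ∃ D : Finset (E N × ℝ), (∀ h ∈ D, -h ∈ D) ∧ ∀ p ∈ s, DescribedBy (D : Set (E N × ℝ)) p := by
  classical
  have H : ∀ p : Polyhedron m N, ∃ D : Finset (E N × ℝ),
      p.carrier = {x | ∀ h ∈ D, ⟪h.1, x⟫ ≤ h.2} := fun p => by
    obtain ⟨k, a, b, h⟩ := p.halfSpaces
    exact ⟨Finset.univ.image fun j => (a j, b j), by simp [h]⟩
  choose M hM using H
  let D₀ := hs.toFinset.biUnion M
  -- The pair (-a, -b) encodes the opposite closed half-space; with it, both halves of a cut are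
  -- again described by `D`.
  refine ⟨D₀ ∪ D₀.image Neg.neg, fun h hh => ?_, fun p hp => ⟨M p, ?_, hM p⟩⟩
  · rcases Finset.mem_union.1 hh with hh | hh
    · exact Finset.mem_union_right _ (Finset.mem_image_of_mem _ hh)
    · obtain ⟨h', hh', rfl⟩ := Finset.mem_image.1 hh
      exact Finset.mem_union_left _ (by rwa [neg_neg])
  · intro h hh
    exact Finset.mem_union_left _ (Finset.mem_biUnion.2 ⟨p, hs.mem_toFinset.2 hp, hh⟩)

/-- Overlaps of an uncrossed polyhedron with a polyhedron that does not contain it are null. -/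
theorem hausdorff_inter_eq_zero {D : Set (E N × ℝ)} {p q : Polyhedron m N}
    (hp : ∀ h ∈ D, IsUncrossed h p) (hq : DescribedBy D q) (hpq : ¬p.carrier ⊆ q.carrier) :
    (μHE[m] : Measure (E N)) (p.carrier ∩ q.carrier) = 0 := by
  obtain ⟨M, hMD, hM⟩ := hq
  obtain ⟨x, hxp, hxq⟩ := not_subset.1 hpq
  rw [hM, mem_ofPred_eq] at hxq
  push Not at hxq
  obtain ⟨h, hhM, hh⟩ := hxq
  -- `x` violates a half-space of `q`, so the uncrossed `p` lies entirely on the other side of it.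
  -- Hence p ∩ q lies in the bounding hyperplane, which misses `x`.
  have hge := (hp h (hMD hhM)).resolve_left fun H => hh.not_ge (H x hxp)
  refine measure_mono_null ?_ (p.hausdorff_slice_eq_zero hxp hh.ne')
  rintro y ⟨hyp, hyq⟩
  rw [hM] at hyq
  exact ⟨hyp, le_antisymm (hyq h hhM) (hge y hyp)⟩

theorem vectorSpan_eq_of_subset {p q : Polyhedron m N} (h : p.carrier ⊆ q.carrier) :
    vectorSpan ℝ p.carrier = vectorSpan ℝ q.carrier :=
  Submodule.eq_of_le_of_finrank_eq (vectorSpan_mono ℝ h) (p.finrank_eq.trans q.finrank_eq.symm)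

/-- Subdivision along a hyperplane that crosses the polyhedron. -/
theorem Polyhedron.exists_cut (τ : Polyhedron n N) {h : E N × ℝ} (hτ : ¬IsUncrossed h τ) :
    ∃ p q : Polyhedron n N, p.carrier = {x ∈ τ.carrier | ⟪h.1, x⟫ ≤ h.2} ∧
      q.carrier = {x ∈ τ.carrier | h.2 ≤ ⟪h.1, x⟫} ∧
      ∀ w, wedgeChain τ w = wedgeChain p w + wedgeChain q w := by
  rw [IsUncrossed] at hτ
  push Not at hτ
  obtain ⟨hhi, hlo⟩ := hτ
  have hhi' : ∃ x ∈ τ.orient.carrier, ⟪-h.1, x⟫ < -h.2 := by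
    obtain ⟨x, hx, hxa⟩ := hhi
    exact ⟨x, hx, by rw [inner_neg_left]; linarith⟩
  have hc : (lowerPart (-h.1) (-h.2) τ.orient).carrier = {x ∈ τ.carrier | h.2 ≤ ⟪h.1, x⟫} := by
    rw [lowerPart_carrier hhi']
    ext x
    simp only [mem_ofPred_eq, inner_neg_left, neg_le_neg_iff]
    rfl
  have hc' : (lowerPart h.1 h.2 τ.orient).carrier = {x ∈ τ.carrier | ⟪h.1, x⟫ ≤ h.2} :=
    lowerPart_carrier (τ := τ.orient) hlo
  refine ⟨(lowerPart h.1 h.2 τ.orient).toPolyhedron,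
    (lowerPart (-h.1) (-h.2) τ.orient).toPolyhedron, hc', hc, fun w => ?_⟩
  rw [wedgeChain_eq, wedgeChain_eq, lowerPart_η, lowerPart_η]
  exact PolyChain.of_subdivision ⟨h.1, h.2, hlo, hhi, hc', hc, lowerPart_η _ _ _,
    lowerPart_η _ _ _⟩ _

/-- A normal chain can be subdivided until it is not crossed by given hyperplanes. -/
theorem exists_refinement {D : Finset (E N × ℝ)} (hD : ∀ h ∈ D, -h ∈ D)
    {c : Polyhedron n N →₀ E N} (hc : c ∈ normalChains (DescribedBy (D : Set (E N × ℝ))))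
    (L : Finset (E N × ℝ)) (hL : L ⊆ D) :
    ∃ d ∈ normalChains fun p : Polyhedron n N => DescribedBy (D : Set (E N × ℝ)) p ∧
      ∀ h ∈ L, IsUncrossed h p, normalChain d = normalChain c := by
  classical
  induction L using Finset.induction_on with
  | empty => exact ⟨c, ⟨fun τ h => ⟨hc.1 τ h, by simp⟩, hc.2⟩, rfl⟩
  | insert h L _ ih =>
    obtain ⟨d, hd, hdc⟩ := ih ((Finset.subset_insert h L).trans hL)
    have hhD : h ∈ D := hL (Finset.mem_insert_self h L)
    -- A piece crossed by `h` is replaced by its two halves with the same vector. The halves span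
    -- the same plane, so the vector stays normal, and as subsets they remain uncrossed by the
    -- earlier hyperplanes.
    have step : ∀ τ ∈ d.support, ∃ e ∈ normalChains fun p : Polyhedron n N =>
        DescribedBy (D : Set (E N × ℝ)) p ∧ ∀ h' ∈ insert h L, IsUncrossed h' p,
        normalChain e = wedgeChain τ (d τ) := by
      intro τ hτ
      obtain ⟨hτD, hτL⟩ := hd.1 τ (Finsupp.mem_support_iff.1 hτ)
      have hw := hd.2 τ
      by_cases hh : IsUncrossed h τ
      · refine ⟨Finsupp.single τ (d τ), single_mem_normalChains ⟨hτD, fun h' hh' => ?_⟩ hw,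
          normalChain_single _ _⟩
        rcases Finset.mem_insert.1 hh' with rfl | hh'
        · exact hh
        · exact hτL h' hh'
      · obtain ⟨p, q, hp, hq, hpq⟩ := τ.exists_cut hh
        have hpτ : p.carrier ⊆ τ.carrier := fun x hx => by rw [hp] at hx; exact hx.1
        have hqτ : q.carrier ⊆ τ.carrier := fun x hx => by rw [hq] at hx; exact hx.1
        obtain ⟨M, hMD, hM⟩ := hτD
        refine ⟨Finsupp.single p (d τ) + Finsupp.single q (d τ), add_mem
          (single_mem_normalChains ⟨⟨insert h M, insert_subset hhD hMD, ?_⟩, fun h' hh' => ?_⟩ ?_)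
          (single_mem_normalChains
            ⟨⟨insert (-h) M, insert_subset (hD h hhD) hMD, ?_⟩, fun h' hh' => ?_⟩ ?_), ?_⟩
        · rw [hp, hM]
          ext x
          simp [and_comm]
        · rcases Finset.mem_insert.1 hh' with rfl | hh'
          · exact Or.inl fun x hx => by rw [hp] at hx; exact hx.2
          · exact (hτL h' hh').mono hpτ
        · rw [vectorSpan_eq_of_subset hpτ]
          exact hw
        · rw [hq, hM]
          ext x
          simp [and_comm, inner_neg_left]
        · rcases Finset.mem_insert.1 hh' with rfl | hh'
          · exact Or.inr fun x hx => by rw [hq] at hx; exact hx.2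
          · exact (hτL h' hh').mono hqτ
        · rw [vectorSpan_eq_of_subset hqτ]
          exact hw
        · rw [map_add, normalChain_single, normalChain_single, hpq]
    choose! e he hed using step
    refine ⟨∑ τ ∈ d.support, e τ, sum_mem he, ?_⟩
    rw [map_sum, ← hdc, Finset.sum_congr rfl hed]
    rfl

/-! ### From stationarity to the support of the boundary -/

/-- The finitely many faces of a polyhedral varifold. -/
theorem PolyhedralVarifold.finite_faces (V : PolyhedralVarifold (n + 1) N) :
    {τ : Polyhedron n N | ∃ i, IsFacet τ (V.σ i)}.Finite := by
  rw [ofPred_exists]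
  exact finite_iUnion fun i => (V.σ i).finite_facets

/-- The measure of the intersection with a union of faces. -/
theorem hausdorff_inter_iUnion_eq_zero {F : Set (Polyhedron n N)} (hF : F.Finite) {s : Set (E N)}
    (h : ∀ τ ∈ F, (μHE[n] : Measure (E N)) (s ∩ τ.carrier) = 0) :
    (μHE[n] : Measure (E N)) (s ∩ ⋃ τ ∈ F, τ.carrier) = 0 := by
  rw [inter_iUnion₂]
  exact (measure_biUnion_null_iff hF.countable).2 h

theorem isClosed_iUnion_faces {F : Set (Polyhedron n N)} (hF : F.Finite) :
    IsClosed (⋃ τ ∈ F, τ.carrier) :=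
  hF.isClosed_biUnion fun τ _ => τ.isClosed

/-- If `V` is stationary outside of a union `Γ` of faces, then the boundary of `⟨V⟩` is supported
in `Γ`. -/
theorem PolyhedralVarifold.supportedIn_of_isStationaryIn (V : PolyhedralVarifold (n + 1) N)
    {F : Set (Polyhedron n N)} (hF : ∀ τ ∈ F, ∃ i, IsFacet τ (V.σ i))
    (hV : V.toVarifold.IsStationaryIn (⋃ τ ∈ F, τ.carrier)ᶜ) :
    (boundary V.chain).SupportedIn (⋃ τ ∈ F, τ.carrier) := by
  have hFf : F.Finite := V.finite_faces.subset hF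
  obtain ⟨D, hDneg, hD⟩ := exists_describedBy _ V.finite_faces
  -- Taking `L = D` makes every piece both described by `D` and uncrossed by all of `D`, which is
  -- what `hausdorff_inter_eq_zero` needs for any pair of pieces.
  obtain ⟨d, hd, hdV⟩ := exists_refinement hDneg
    (c := V.faceChain) ⟨fun τ h => hD τ (V.faceChain_mem.1 τ h), V.faceChain_mem.2⟩ D subset_rfl
  rw [V.normalChain_faceChain] at hdV
  rw [← hdV]
  refine supportedIn_normalChain fun q hq => ?_
  by_contra hqΓ
  refine hq (apply_eq_zero_of_flux_eq_zero (isClosed_iUnion_faces hFf)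
    (V.flux_eq_zero hV hd hdV) (hausdorff_inter_iUnion_eq_zero hFf fun τ hτ => ?_) fun p hp => ?_)
  · refine hausdorff_inter_eq_zero (hd.1 q hq).2 (hD τ (hF τ hτ)) fun h => hqΓ ?_
    exact h.trans (subset_biUnion_of_mem (u := fun τ : Polyhedron n N => τ.carrier) hτ)
  -- Pieces that contain each other coincide; if one inclusion fails, the overlap is null.
  · by_cases hqp : q.carrier ⊆ p.carrier
    · by_cases hpq : p.carrier ⊆ q.carrier
      · exact Or.inl (Polyhedron.ext' (hpq.antisymm hqp))
      · exact Or.inr (inter_comm p.carrier _ ▸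
          hausdorff_inter_eq_zero (hd.1 p hp).2 (hd.1 q hq).1 hpq)
    · exact Or.inr (hausdorff_inter_eq_zero (hd.1 q hq).2 (hd.1 p hp).1 hqp)

/-! ### Face-to-face varifolds and the balancing identity -/

/-- The overlap lies in the supporting hyperplane of τ. This hyperplane meets σ only in τ, so it
misses any point of τ' outside τ and cuts τ' in a null set. -/
theorem IsFacet.hausdorff_inter_eq_zero {τ τ' : Polyhedron n N} {σ : Polyhedron (n + 1) N}
    (hτ : IsFacet τ σ) (hτ' : IsFacet τ' σ) (h : ¬τ'.carrier ⊆ τ.carrier) :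
    (μHE[n] : Measure (E N)) (τ'.carrier ∩ τ.carrier) = 0 := by
  obtain ⟨ν, hν⟩ := isFacet_iff.1 hτ
  obtain ⟨ν', hν'⟩ := isFacet_iff.1 hτ'
  obtain ⟨x, hx', hx⟩ := not_subset.1 h
  obtain ⟨t, ht⟩ := τ.nonempty
  have hxt : ⟪ν, x⟫ ≠ ⟪ν, t⟫ := fun heq => hx <| by
    rw [hν.2.2] at ht ⊢
    exact ⟨hν'.subset hx', fun y hy => (ht.2 y hy).trans heq.ge⟩
  refine measure_mono_null ?_ (τ'.hausdorff_slice_eq_zero hx' hxt)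
  rintro y ⟨hy', hy⟩
  rw [hν.2.2] at hy ht
  exact ⟨hy', le_antisymm (ht.2 y hy.1) (hy.2 t ht.1)⟩

/-- Distinct faces of a polyhedron have a null intersection. -/
theorem IsFacet.eq_or_hausdorff_inter_eq_zero {τ τ' : Polyhedron n N} {σ : Polyhedron (n + 1) N}
    (hτ : IsFacet τ σ) (hτ' : IsFacet τ' σ) :
    τ = τ' ∨ (μHE[n] : Measure (E N)) (τ.carrier ∩ τ'.carrier) = 0 := by
  by_cases h : τ.carrier ⊆ τ'.carrier
  · by_cases h' : τ'.carrier ⊆ τ.carrier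
    · exact Or.inl (Polyhedron.ext' (h.antisymm h'))
    · exact Or.inr (inter_comm τ'.carrier _ ▸ hτ.hausdorff_inter_eq_zero hτ' h')
  · exact Or.inr (hτ'.hausdorff_inter_eq_zero hτ h)

/-- Exposed faces are polyhedra. -/
theorem exists_polyhedron_of_isExposed {σ : Polyhedron m N} {s : Set (E N)}
    (h : IsExposed ℝ σ.carrier s) (hs : s.Nonempty) (hn : Module.finrank ℝ (vectorSpan ℝ s) = n) :
    ∃ τ : Polyhedron n N, τ.carrier = s := by
  obtain ⟨l, hl⟩ := h hs
  let f : E N := (InnerProductSpace.toDual ℝ (E N)).symm l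
  have hf : ∀ x, l x = ⟪f, x⟫ := fun x => by simp [f]
  obtain ⟨t, ht⟩ := id hs
  have hsub : s ⊆ σ.carrier := fun x hx => by rw [hl] at hx; exact hx.1
  have heq : s = {x ∈ σ.carrier | ⟪-f, x⟫ ≤ -⟪f, t⟫} := by
    rw [hl] at ht
    rw [hl]
    ext x
    simp only [mem_ofPred_eq, inner_neg_left, neg_le_neg_iff, ← hf]
    exact and_congr_right fun _ => ⟨fun h => h t ht.1, fun h y hy => (ht.2 y hy).trans h⟩
  exact ⟨⟨s, hs, σ.isBounded.subset hsub, heq ▸ halfSpaces_inter σ.halfSpaces _ _, hn⟩, rfl⟩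

/-- Distinct faces of a face-to-face varifold have a null intersection. -/
theorem PolyhedralVarifold.IsFaceToFace.eq_or_hausdorff_inter_eq_zero
    {V : PolyhedralVarifold (n + 1) N} (hV : V.IsFaceToFace) {τ τ' : Polyhedron n N}
    (hτ : ∃ i, IsFacet τ (V.σ i)) (hτ' : ∃ i, IsFacet τ' (V.σ i)) :
    τ = τ' ∨ (μHE[n] : Measure (E N)) (τ.carrier ∩ τ'.carrier) = 0 := by
  obtain ⟨i, hi⟩ := hτ
  obtain ⟨j, hj⟩ := hτ'
  by_cases hij : i = j
  · subst hij
    exact hi.eq_or_hausdorff_inter_eq_zero hj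
  obtain ⟨ν, hν⟩ := isFacet_iff.1 hi
  obtain ⟨ν', hν'⟩ := isFacet_iff.1 hj
  have hsub : τ.carrier ∩ τ'.carrier ⊆ (V.σ i).carrier ∩ (V.σ j).carrier :=
    inter_subset_inter hν.subset hν'.subset
  rcases hV i j hij with h | ⟨h, h', hlt⟩
  · right
    rw [h, subset_empty_iff] at hsub
    rw [hsub, measure_empty]
  · have hb : Bornology.IsBounded ((V.σ i).carrier ∩ (V.σ j).carrier) :=
      (V.σ i).isBounded.subset inter_subset_left
    rcases (Nat.lt_succ_iff.1 hlt).lt_or_eq with hlt | heq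
    · exact Or.inr (measure_mono_null hsub (hausdorff_eq_zero hb hlt))
    -- For n = 0 the dimension count alone does not exclude the empty intersection, whose span also
    -- has dimension 0, and the empty set counts as exposed.
    rcases ((V.σ i).carrier ∩ (V.σ j).carrier).eq_empty_or_nonempty with hemp | hne
    · right
      rw [hemp, subset_empty_iff] at hsub
      rw [hsub, measure_empty]
    obtain ⟨κ, hκ⟩ := exists_polyhedron_of_isExposed h hne heq
    rw [← hκ] at h h' hsub
    -- The common face κ has dimension `n`, so it is a facet of both polyhedra. Each of τ, τ' equals
    -- κ or meets it in a null set, and τ ∩ τ' ⊆ κ.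
    rcases hi.eq_or_hausdorff_inter_eq_zero (τ' := κ) h with rfl | h0
    · rcases hj.eq_or_hausdorff_inter_eq_zero (τ' := τ) h' with rfl | h0
      · exact Or.inl rfl
      · exact Or.inr (inter_comm τ'.carrier _ ▸ h0)
    · exact Or.inr (measure_mono_null (subset_inter inter_subset_left hsub) h0)

/-- A facet with a given orientation is induced by an orientation of the polyhedron. -/
theorem exists_orientation {τ : OrientedPolyhedron n N} {σ : Polyhedron (n + 1) N}
    (h : IsFacet τ.toPolyhedron σ) :
    ∃ s : OrientedPolyhedron (n + 1) N, s.toPolyhedron = σ ∧ IsOrientedFacet τ s := by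
  obtain ⟨t, ht, hts⟩ := exists_isOrientedFacet (s := σ.orient) h
  have hc : t.carrier = τ.carrier := congrArg Polyhedron.carrier ht
  rcases t.orients.eq_or_eq_neg (hc ▸ τ.orients) with h1 | h1
  · exact ⟨σ.orient, rfl, OrientedPolyhedron.ext' hc h1 ▸ hts⟩
  · refine ⟨σ.orient.reverse, rfl, ?_⟩
    have := isOrientedFacet_reverse hts
    rwa [show t.reverse = τ from OrientedPolyhedron.ext' hc (neg_eq_iff_eq_neg.2 h1)] at this

/-- The balancing identity in terms of the outer normals. -/
theorem PolyhedralVarifold.isBalancedOff_iff {V : PolyhedralVarifold (n + 1) N} {Γ : Set (E N)} :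
    V.IsBalancedOff Γ ↔ ∀ q : Polyhedron n N, ¬q.carrier ⊆ Γ → V.faceChain q = 0 := by
  classical
  -- The orientations all induce the same η(τ), so η(s i) = η(τ) ∧ ν_i and η(τ) factors out of the
  -- sum.
  have key : ∀ (τ : OrientedPolyhedron n N) (s : Fin V.k → OrientedPolyhedron (n + 1) N),
      (∀ i, (s i).toPolyhedron = V.σ i) →
      (∀ i, IsFacet τ.toPolyhedron (V.σ i) → IsOrientedFacet τ (s i)) →
      (∑ i with IsFacet τ.toPolyhedron (V.σ i), (V.c i : ℝ) • (s i).η) =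
        wedge τ.η (V.faceChain τ.toPolyhedron) := by
    intro τ s hs hτ
    rw [V.faceChain_apply, map_sum]
    refine Finset.sum_congr (by congr) fun i hi => ?_
    rw [map_smul, (isOrientedFacet_iff.1 (hτ i (Finset.mem_filter.1 hi).2)).2, hs]
  constructor
  · intro h q hq
    have H : ∀ i, ∃ s : OrientedPolyhedron (n + 1) N, s.toPolyhedron = V.σ i ∧
        (IsFacet q.orient.toPolyhedron (V.σ i) → IsOrientedFacet q.orient s) := fun i => by
      by_cases hi : IsFacet q.orient.toPolyhedron (V.σ i)
      · obtain ⟨s, hs, hs'⟩ := exists_orientation hi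
        exact ⟨s, hs, fun _ => hs'⟩
      · exact ⟨(V.σ i).orient, rfl, fun h => absurd h hi⟩
    choose s hs hs' using H
    have h0 := key q.orient s hs hs'
    have h1 := h q.orient s hq hs hs'
    have h2 : wedge q.orient.η (V.faceChain q) = 0 := by
      refine h0.symm.trans (Eq.trans ?_ h1)
      congr
    -- The wedge with η(τ) is injective on vectors normal to τ: the pairing of η(τ) ∧ w with itself
    -- is ⟪w, w⟫.
    have h3 := q.orient.orients.vectorPairing_wedge (V.faceChain_mem.2 q) (V.faceChain q)
    rw [h2, map_zero] at h3
    exact inner_self_eq_zero.1 h3.symm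
  · intro h τ s hτ hs hs'
    refine Eq.trans ?_ ((key τ s hs hs').trans ?_)
    · congr
    · rw [h _ hτ, map_zero]

/-- A face-to-face varifold that is stationary outside of `Γ` is balanced. -/
theorem PolyhedralVarifold.isBalancedOff_of_isStationaryIn {V : PolyhedralVarifold (n + 1) N}
    (hf : V.IsFaceToFace) {F : Set (Polyhedron n N)} (hF : ∀ τ ∈ F, ∃ i, IsFacet τ (V.σ i))
    (hV : V.toVarifold.IsStationaryIn (⋃ τ ∈ F, τ.carrier)ᶜ) :
    V.IsBalancedOff (⋃ τ ∈ F, τ.carrier) := by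
  have hFf : F.Finite := V.finite_faces.subset hF
  refine isBalancedOff_iff.2 fun q hq => ?_
  by_contra hq0
  have hqf := V.faceChain_mem.1 q hq0
  -- The localization applies to the facets themselves, since distinct ones already overlap in null
  -- sets.
  refine hq0 (apply_eq_zero_of_flux_eq_zero (isClosed_iUnion_faces hFf)
    (V.flux_eq_zero hV V.faceChain_mem V.normalChain_faceChain)
    (hausdorff_inter_iUnion_eq_zero hFf fun τ hτ => ?_) fun p hp => ?_)
  · refine (hf.eq_or_hausdorff_inter_eq_zero hqf (hF τ hτ)).resolve_left fun h => hq ?_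
    exact h ▸ subset_biUnion_of_mem (u := fun τ : Polyhedron n N => τ.carrier) hτ
  · exact (hf.eq_or_hausdorff_inter_eq_zero hqf (V.faceChain_mem.1 p hp)).imp_left Eq.symm

/-- If `V` is balanced outside of `Γ`, then the boundary of `⟨V⟩` is supported in `Γ`. -/
theorem PolyhedralVarifold.supportedIn_of_isBalancedOff {V : PolyhedralVarifold (n + 1) N}
    {Γ : Set (E N)} (h : V.IsBalancedOff Γ) : (boundary V.chain).SupportedIn Γ := by
  rw [← V.normalChain_faceChain]
  refine supportedIn_normalChain fun p hp => ?_
  by_contra hpΓ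
  exact hp (isBalancedOff_iff.1 h p hpΓ)

end PolyVar

/-! ### The theorem -/

/-- The dimension m is written `n + 1`, which encodes m ≥ 1. -/
theorem mainTheorem5 {n N : ℕ} (V : PolyVar.PolyhedralVarifold (n + 1) N)
    (F : Set (PolyVar.Polyhedron n N)) (hF : ∀ τ ∈ F, ∃ i, PolyVar.IsFacet τ (V.σ i))
    (Γ : Set (PolyVar.E N)) (hΓ : Γ = ⋃ τ ∈ F, τ.carrier) :
    (V.toVarifold.IsStationaryIn Γᶜ ↔ (PolyVar.boundary V.chain).SupportedIn Γ) ∧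
    (V.IsFaceToFace →
      (V.toVarifold.IsStationaryIn Γᶜ ↔ V.IsBalancedOff Γ) ∧
      ((PolyVar.boundary V.chain).SupportedIn Γ ↔ V.IsBalancedOff Γ)) := by
  subst hΓ
  have h1 : V.toVarifold.IsStationaryIn (⋃ τ ∈ F, τ.carrier)ᶜ ↔
      (PolyVar.boundary V.chain).SupportedIn (⋃ τ ∈ F, τ.carrier) :=
    ⟨V.supportedIn_of_isStationaryIn hF, V.isStationaryIn_of_supportedIn⟩
  refine ⟨h1, fun hf => ?_⟩
  -- The three conditions close a cycle: stationary implies balanced, balanced implies that the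
  -- boundary is supported in Γ, and this implies stationary.
  have h2 : V.toVarifold.IsStationaryIn (⋃ τ ∈ F, τ.carrier)ᶜ ↔
      V.IsBalancedOff (⋃ τ ∈ F, τ.carrier) :=
    ⟨V.isBalancedOff_of_isStationaryIn hf hF,
      fun h => h1.2 (PolyVar.PolyhedralVarifold.supportedIn_of_isBalancedOff h)⟩
  exact ⟨h2, h1.symm.trans h2⟩
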